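/- **Setting.** Let $d\in\mathbb{N}$ and let $\mu\in\mathcal{P}_2(\mathbb{R}^d)$ (Borel probability measures with finite second moment) have a density with respect to Lebesgue measure. Time runs over $[0,1]$. - $C_\rho=AC^2(0,1;(\mathcal{P}_2(\mathbb{R}^d),W_2))$ is the set of curves $\rho:[0,1]\to\mathcal{P}_2(\mathbb{R}^d)$ for which there is $m\in L^2(0,1)$ with $W_2(\rho_s,\rho_t)\le\int_s^t m(r)\,dr$ for all $0\le s\le t\le 1$. - $C_{(\rho,v)}$ is the set of pairs $(\rho,v)$ with $\rho\in C_\rho$, $\rho_0=\mu$, $v:\mathbb{R}^d\times[0,1]\to\mathbb{R}^d$ Borel, $\int_0^1\int\|v(x,t)\|^2\,d\rho_t(x)\,dt<\infty$, and $\partial_t\rho+\nabla\cdot(\rho v)=0$ in the sense of distributions on $(0,1)\times\mathbb{R}^d$. - $C_v$ is the set of $v:\mathbb{R}^d\times[0,1]\to\mathbb{R}^d$ which on every compact $B\subset\mathbb{R}^d$ are bounded and Lipschitz in $x$, uniformly in $t\in[0,1]$. - $C_X$ is the set of maps $X\in H^1(0,1;L^2(\mu))$ with $X(x,0)=x$: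 for $\mu$-a.e. $x$ the trajectory $X(x,\cdot)$ is absolutely continuous and starts at $x$, and $\partial_tX\in L^2(\mu\otimes[0,1])$. Write $X_t=X(\cdot,t)$. - $X$ is a family of characteristics of $v$ if $X\in C_X$ and $\partial_tX(x,t)=v(X(x,t),t)$ for $\mu$-a.e. $x$ and a.e. $t\in[0,1]$. *General MFG.* Let $F,G$ assign to each $\rho\in\mathcal{P}_2(\mathbb{R}^d)$ functions $F[\rho],G[\rho]:\mathbb{R}^d\to[-\infty,\infty]$ such that for every $\rho\in C_\rho$ the map $(t,x)\mapsto F[\rho_t](x)$ on $[0,1]\times\mathbb{R}^d$ and the map $G[\rho_1]$ are Borel. Put $$\mathcal{J}(\tilde\rho,\tilde v;\rho)=\int_0^1\!\!\int\Big(\tfrac12\|\tilde v(x,t)\|^2+F[\rho_t](x)\Big)d\tilde\rho_t(x)\,dt+\int G[\rho_1]\,d\tilde\rho_1,$$ $$\mathcal{J}(\tilde X;\rho)=\mathbb{E}_{x\sim\mu}\Big[\int_0^1\Big(\tfrac12\|\partial_t\tilde X(x,t)\|^2+F[\rho_t](\tilde X(x,t))\Big)dt+G[\rho_1](\tilde X(x,1))\Big].$$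 A pair $(\hat\rho,\hat v)\in C_{(\rho,v)}$ solves the Eulerian MFG if it minimizes $\mathcal{J}(\cdot,\cdot;\hat\rho)$ over $C_{(\rho,v)}$. A map $\hat X\in C_X$ solves the Lagrangian MFG if it minimizes $\mathcal{J}(\cdot;\rho)$ over $C_X$, where $\rho_t=(\hat X_t)_\#\mu$. *Potential MFG.* Let $\mathcal{F},\mathcal{G}:\mathcal{P}_2(\mathbb{R}^d)\to[-\infty,\infty]$ and put $$\mathcal{J}(\rho,v)=\int_0^1\!\!\int\tfrac12\|v(x,t)\|^2d\rho_t(x)\,dt+\int_0^1\mathcal{F}(\rho_t)\,dt+\mathcal{G}(\rho_1),$$ $$\mathcal{J}(X)=\mathbb{E}_{x\sim\mu}\Big[\int_0^1\tfrac12\|\partial_tX(x,t)\|^2dt\Big]+\int_0^1\mathcal{F}((X_t)_\#\mu)\,dt+\mathcal{G}((X_1)_\#\mu).$$ The Eulerian and the Lagrangian potential MFG are the problems of minimizing $\mathcal{J}(\rho,v)$ over $C_{(\rho,v)}$ and $\mathcal{J}(X)$ over $C_X$. All costs are extended real numbers: the integral of the positive parts of all terms minus the integral of their negative parts, with the convention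 $\infty-\infty=+\infty$. For $X\in C_X$, a flow-matched Eulerian representation of $X$ is a pair $(\rho,v)$ with $\rho_t=(X_t)_\#\mu$ and $v$ a minimizer of $w\mapsto\int_0^1\int\|w(X(x,t),t)-\partial_tX(x,t)\|^2d\mu(x)\,dt$ among Borel fields $w:\mathbb{R}^d\times[0,1]\to\mathbb{R}^d$. **Theorem 1.** (i) Suppose $(\rho^*,v^*)$ solves the Eulerian MFG and $v^*\in C_v$. Then $v^*$ has characteristics $X^*\in C_X$, and every family $X^*$ of characteristics of $v^*$ satisfies $(X^*_t)_\#\mu=\rho^*_t$ for all $t\in[0,1]$ and solves the Lagrangian MFG. (ii) Suppose $(\rho^*,v^*)$ solves the Eulerian potential MFG and $v^*\in C_v$. Then $v^*$ has characteristics $X^*\in C_X$, and every family $X^*$ of characteristics of $v^*$ satisfies $(X^*_t)_\#\mu=\rho^*_t$ for all $t\in[0,1]$, solves the Lagrangian potential MFG, and $\mathcal{J}(X^*)=\mathcal{J}(\rho^*,v^*)=:J^*$. In addition, every solution $X\in C_X$ of the Lagrangian potential MFG has a flow-matched Eulerian representation, and every flow-matched Eulerian representation $(\rho,v)$ of $X$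 solves the Eulerian potential MFG, with $\mathcal{J}(X)=\mathcal{J}(\rho,v)=J^*$. -/

import Mathlib

open MeasureTheory Set
open scoped ENNReal NNReal ContDiff

noncomputable section

namespace MFG

/-- The state space `ℝ^d` with its Euclidean norm. -/
abbrev E (d : ℕ) : Type := EuclideanSpace ℝ (Fin d)

variable {d : ℕ}

/-- `ρ ∈ 𝒫₂(ℝ^d)`: Borel probability measures with finite second moment. -/
def IsP2 (ρ : Measure (E d)) : Prop :=
  IsProbabilityMeasure ρ ∧ ∫⁻ x, ‖x‖ₑ ^ 2 ∂ρ < ⊤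

/-- `μ ∈ 𝒫₂ʳ(ℝ^d)`: moreover `μ` has a density with respect to Lebesgue measure. -/
def IsP2r (μ : Measure (E d)) : Prop :=
  IsP2 μ ∧ μ ≪ volume

/-- The Wasserstein-2 distance: infimum over all couplings of the quadratic transport cost. -/
def W2 (ρ σ : Measure (E d)) : ℝ≥0∞ :=
  (⨅ π : Measure (E d × E d), ⨅ _ : π.fst = ρ ∧ π.snd = σ,
    ∫⁻ p, edist p.1 p.2 ^ 2 ∂π) ^ (1 / 2 : ℝ)

/-- `C_ρ = AC²(0,1; (𝒫₂(ℝ^d), W₂))`. Curves are functions of `t : ℝ` of which only the part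
`t ∈ [0,1]` matters, here and below. The inequality is imposed up to the endpoints, that is,
`ρ 0` and `ρ 1` are the values of the continuous extension of the curve. -/
def CRho (ρ : ℝ → Measure (E d)) : Prop :=
  (∀ t ∈ Icc (0 : ℝ) 1, IsP2 (ρ t)) ∧
  ∃ m : ℝ → ℝ, MemLp m 2 (volume.restrict (Icc (0 : ℝ) 1)) ∧
    ∀ s t : ℝ, 0 ≤ s → s ≤ t → t ≤ 1 →
      W2 (ρ s) (ρ t) ≤ ENNReal.ofReal (∫ r in s..t, m r)

/-- The continuity equation `∂ₜρ + ∇·(ρ v) = 0` in the sense of distributions on `(0,1) × ℝ^d`.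
Here `fderiv ℝ φ (t, x) (1, v x t)` is `∂ₜφ(t,x) + ∇ₓφ(t,x) · v(x,t)`. -/
def ContinuityEq (ρ : ℝ → Measure (E d)) (v : E d → ℝ → E d) : Prop :=
  ∀ φ : ℝ × E d → ℝ, ContDiff ℝ ∞ φ → HasCompactSupport φ →
    tsupport φ ⊆ Ioo (0 : ℝ) 1 ×ˢ (univ : Set (E d)) →
    ∫ t in Icc (0 : ℝ) 1, ∫ x, fderiv ℝ φ (t, x) (1, v x t) ∂(ρ t) = 0

/-- The constraint set `C_(ρ,v)`: `v` is a Borel field, square integrable along `ρ`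
(`∫₀¹ ‖v_t‖²_{L²(ρ_t)} dt < ∞`), `ρ ∈ C_ρ` starts at `μ`, and the continuity equation holds. -/
structure CRhoV (μ : Measure (E d)) (ρ : ℝ → Measure (E d)) (v : E d → ℝ → E d) : Prop where
  curve : CRho ρ
  init : ρ 0 = μ
  meas : Measurable (fun p : E d × ℝ => v p.1 p.2)
  sq_int : ∫⁻ t in Icc (0 : ℝ) 1, ∫⁻ x, ‖v x t‖ₑ ^ 2 ∂(ρ t) < ⊤
  cont_eq : ContinuityEq ρ v

/-- `C_v`: velocity fields that are bounded and Lipschitz in `x` on every compact set,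
uniformly in `t ∈ [0,1]`. -/
def CV (v : E d → ℝ → E d) : Prop :=
  ∀ B : Set (E d), IsCompact B → ∃ K : ℝ≥0, ∀ t ∈ Icc (0 : ℝ) 1,
    (∀ x ∈ B, ‖v x t‖ ≤ K) ∧ LipschitzOnWith K (fun x => v x t) B

/-- `C_X = H¹(0,1; L²(μ))` with `X(x,0) = x`: for `μ`-a.e. `x` the trajectory `X(x,·)` is the
primitive, starting at `x`, of a velocity, and the velocities form an element of
`L²(μ ⊗ [0,1])`. The velocity `∂ₜX(x,t)` is then `deriv (X x) t` for a.e. `(x,t)`. -/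
def CX (μ : Measure (E d)) (X : E d → ℝ → E d) : Prop :=
  ∃ u : E d → ℝ → E d,
    MemLp (fun p : E d × ℝ => u p.1 p.2) 2 (μ.prod (volume.restrict (Icc (0 : ℝ) 1))) ∧
    ∀ᵐ x ∂μ, ∀ t ∈ Icc (0 : ℝ) 1, X x t = x + ∫ s in (0 : ℝ)..t, u x s

/-- `(X,v) ∈ C_(X,v)`: `X ∈ C_X` solves `∂ₜX(x,t) = v(X(x,t),t)` for `μ`-a.e. `x` and a.e. `t`,
that is, `X` is a family of characteristics of `v`. -/
def CXV (μ : Measure (E d)) (X : E d → ℝ → E d) (v : E d → ℝ → E d) : Prop :=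
  CX μ X ∧ ∀ᵐ x ∂μ, ∀ᵐ t ∂(volume.restrict (Icc (0 : ℝ) 1)), deriv (X x) t = v (X x t) t

/-- The curve `t ↦ (X_t)_# μ`. -/
def pushCurve (μ : Measure (E d)) (X : E d → ℝ → E d) : ℝ → Measure (E d) :=
  fun t => μ.map (fun x => X x t)

/-- The extended real `a - b`, with the convention `∞ - ∞ = +∞`. All costs are integrals of
functions of variable sign, evaluated as (integral of the positive part) minus (integral of the
negative part); with this convention a strategy of undefined cost is never preferred. -/
def extDiff (a b : ℝ≥0∞) : EReal :=
  if a = ⊤ then ⊤ else (a : EReal) - (b : EReal)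

/-- The individual cost
`J(ρ',v';ρ) = ∫₀¹ ∫ (½‖v'‖² + F[ρ_t]) dρ'_t dt + ∫ G[ρ_1] dρ'_1`. -/
def costEuler (F G : Measure (E d) → E d → EReal) (ρ' : ℝ → Measure (E d))
    (v' : E d → ℝ → E d) (ρ : ℝ → Measure (E d)) : EReal :=
  extDiff
    ((∫⁻ t in Icc (0 : ℝ) 1, ∫⁻ x, (2⁻¹ * ‖v' x t‖ₑ ^ 2 + (F (ρ t) x).toENNReal) ∂(ρ' t))
      + ∫⁻ x, (G (ρ 1) x).toENNReal ∂(ρ' 1))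
    ((∫⁻ t in Icc (0 : ℝ) 1, ∫⁻ x, (-F (ρ t) x).toENNReal ∂(ρ' t))
      + ∫⁻ x, (-G (ρ 1) x).toENNReal ∂(ρ' 1))

/-- The individual cost of a characteristic map,
`J(X;ρ) = E_{x∼μ} [∫₀¹ (½‖∂ₜX(x,t)‖² + F[ρ_t](X(x,t))) dt + G[ρ_1](X(x,1))]`. -/
def costLagr (μ : Measure (E d)) (F G : Measure (E d) → E d → EReal)
    (X : E d → ℝ → E d) (ρ : ℝ → Measure (E d)) : EReal :=
  extDiff
    (∫⁻ x, ((∫⁻ t in Icc (0 : ℝ) 1,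
        (2⁻¹ * ‖deriv (X x) t‖ₑ ^ 2 + (F (ρ t) (X x t)).toENNReal))
      + (G (ρ 1) (X x 1)).toENNReal) ∂μ)
    (∫⁻ x, ((∫⁻ t in Icc (0 : ℝ) 1, (-F (ρ t) (X x t)).toENNReal)
      + (-G (ρ 1) (X x 1)).toENNReal) ∂μ)

/-- The population cost
`J(ρ,v) = ∫₀¹ ∫ ½‖v‖² dρ_t dt + ∫₀¹ Φ(ρ_t) dt + Ψ(ρ_1)`. -/
def potCostEuler (Φ Ψ : Measure (E d) → EReal) (ρ : ℝ → Measure (E d))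
    (v : E d → ℝ → E d) : EReal :=
  extDiff
    ((∫⁻ t in Icc (0 : ℝ) 1, ∫⁻ x, 2⁻¹ * ‖v x t‖ₑ ^ 2 ∂(ρ t))
      + (∫⁻ t in Icc (0 : ℝ) 1, (Φ (ρ t)).toENNReal) + (Ψ (ρ 1)).toENNReal)
    ((∫⁻ t in Icc (0 : ℝ) 1, (-Φ (ρ t)).toENNReal) + (-Ψ (ρ 1)).toENNReal)

/-- The population cost of a characteristic map,
`J(X) = E_{x∼μ} [∫₀¹ ½‖∂ₜX(x,t)‖² dt] + ∫₀¹ Φ((X_t)_# μ) dt + Ψ((X_1)_# μ)`. -/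
def potCostLagr (μ : Measure (E d)) (Φ Ψ : Measure (E d) → EReal)
    (X : E d → ℝ → E d) : EReal :=
  extDiff
    ((∫⁻ x, (∫⁻ t in Icc (0 : ℝ) 1, 2⁻¹ * ‖deriv (X x) t‖ₑ ^ 2) ∂μ)
      + (∫⁻ t in Icc (0 : ℝ) 1, (Φ (pushCurve μ X t)).toENNReal)
      + (Ψ (pushCurve μ X 1)).toENNReal)
    ((∫⁻ t in Icc (0 : ℝ) 1, (-Φ (pushCurve μ X t)).toENNReal)
      + (-Ψ (pushCurve μ X 1)).toENNReal)

/-- `(ρ,v)` solves the Eulerian MFG: it is a best response to its own population flow `ρ`. -/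
def SolvesEulerMFG (μ : Measure (E d)) (F G : Measure (E d) → E d → EReal)
    (ρ : ℝ → Measure (E d)) (v : E d → ℝ → E d) : Prop :=
  CRhoV μ ρ v ∧ ∀ (ρ' : ℝ → Measure (E d)) (v' : E d → ℝ → E d), CRhoV μ ρ' v' →
    costEuler F G ρ v ρ ≤ costEuler F G ρ' v' ρ

/-- `X` solves the Lagrangian MFG: it is a best response to its own flow `ρ_t = (X_t)_# μ`. -/
def SolvesLagrMFG (μ : Measure (E d)) (F G : Measure (E d) → E d → EReal)
    (X : E d → ℝ → E d) : Prop :=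
  CX μ X ∧ ∀ X' : E d → ℝ → E d, CX μ X' →
    costLagr μ F G X (pushCurve μ X) ≤ costLagr μ F G X' (pushCurve μ X)

/-- `(ρ,v)` solves the Eulerian potential MFG (mean-field control) problem. -/
def SolvesEulerPot (μ : Measure (E d)) (Φ Ψ : Measure (E d) → EReal)
    (ρ : ℝ → Measure (E d)) (v : E d → ℝ → E d) : Prop :=
  CRhoV μ ρ v ∧ ∀ (ρ' : ℝ → Measure (E d)) (v' : E d → ℝ → E d), CRhoV μ ρ' v' →
    potCostEuler Φ Ψ ρ v ≤ potCostEuler Φ Ψ ρ' v'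

/-- `X` solves the Lagrangian potential MFG (mean-field control) problem. -/
def SolvesLagrPot (μ : Measure (E d)) (Φ Ψ : Measure (E d) → EReal)
    (X : E d → ℝ → E d) : Prop :=
  CX μ X ∧ ∀ X' : E d → ℝ → E d, CX μ X' →
    potCostLagr μ Φ Ψ X ≤ potCostLagr μ Φ Ψ X'

/-- The flow matching loss `∫₀¹ ∫ ‖v(X(x,t),t) - ∂ₜX(x,t)‖² dμ(x) dt`. -/
def flowMatchLoss (μ : Measure (E d)) (X : E d → ℝ → E d) (v : E d → ℝ → E d) : ℝ≥0∞ :=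
  ∫⁻ t in Icc (0 : ℝ) 1, ∫⁻ x, ‖v (X x t) t - deriv (X x) t‖ₑ ^ 2 ∂μ

/-- `v` minimizes the flow matching loss of `X` among all Borel fields. The flow-matched Eulerian
representation of `X` is the pair `(pushCurve μ X, v)`. -/
def IsFlowMatched (μ : Measure (E d)) (X : E d → ℝ → E d) (v : E d → ℝ → E d) : Prop :=
  Measurable (fun p : E d × ℝ => v p.1 p.2) ∧
  ∀ w : E d → ℝ → E d, Measurable (fun p : E d × ℝ => w p.1 p.2) →
    flowMatchLoss μ X v ≤ flowMatchLoss μ X w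

/-- The couplings `F`, `G` are measurable along admissible population flows, so that the
integrals in the individual costs make sense. -/
def MeasurableCouplings (F G : Measure (E d) → E d → EReal) : Prop :=
  ∀ ρ : ℝ → Measure (E d), CRho ρ →
    Measurable (fun p : Icc (0 : ℝ) 1 × E d => F (ρ p.1) p.2) ∧ Measurable (G (ρ 1))

end MFG

end

/-!
The Eulerian and the Lagrangian problem are compared through two maps between their strategies.

*From fields to trajectories.* If `v` is the field of an admissible pair `(ρ, v)` and is locally
Lipschitz in space, it has characteristics from `μ`-almost every point, and every family of
characteristics transports `μ` along `ρ` (`CRhoV.exists_characteristics`, `CRhoV.pushCurve_eq`).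
Both facts rest on one duality estimate. Truncate `v` to a bounded Lipschitz field `w` with flow
`Z`, take a Lipschitz observable `ψ`, and follow `t ↦ ∫ θ · (ψ ∘ Z_{t,T}) dρ_t`, where `θ` is a
cutoff at scale `k` supported where `w = v`. The backward transport `ψ ∘ Z_{t,T}` cancels the action
of `w`, so that only the gradient of `θ`, of size `O(1/k)`, contributes
(`CRhoV.abs_integral_cutoff_sub_flow_le`). As `ψ ∘ Z_{t,T}` is merely Lipschitz and `w` merely Borel
in time, the transported observable is mollified, and the estimate is made on the steps of a uniform
partition, with an error of second order in the step (`abs_sub_le_of_forall_abs_sub_le`). In the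
limit, mass carried by trajectories that stay bounded is carried by `ρ` (`CRhoV.map_le`). Hence a
set of positive measure of trajectories that reach the spheres of all radii would make
`∫∫ ‖v‖ dρ dt` infinite, which it is not: almost no trajectory blows up. Then all the mass is
accounted for, and an inequality between probability measures is an equality. The cost of the
characteristics is that of `(ρ, v)`.

*From trajectories to fields.* Along a map `X` in `C_X`, a flow-matched field is the orthogonal
projection of `∂ₜX` in `L²(μ ⊗ [0,1])` onto the velocities that depend on position and time only
(`exists_orthogonal_factor`). The laws of `X` solve the continuity equation with it, because
test functions contribute the velocities `∇φ(X_t, t)`, which are of this form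
(`IsVersion.continuityEq`); and projecting does not increase the kinetic energy. Since the other
terms of the costs depend on the laws only, flow matching gives an admissible Eulerian strategy of
no larger cost (`IsFlowMatched.cRhoV`, `IsFlowMatched.costEuler_le`,
`IsFlowMatched.potCostEuler_le`).

So a Lagrangian competitor of the characteristics is beaten by its flow-matched representation,
which is beaten by the Eulerian solution, whose cost is that of its characteristics.
-/

open MeasureTheory Set
open scoped ENNReal NNReal ContDiff

noncomputable section

namespace MFG

open Filter Topology ProbabilityTheory
open scoped Convolution

variable {d : ℕ}

/-! ### Flows of globally Lipschitz fields -/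

/-- Grönwall's inequality in integral form. -/
theorem le_exp_of_le_add_integral {f : ℝ → ℝ} {a b c K : ℝ} (hf : ContinuousOn f (Icc a b))
    (hf0 : ∀ t ∈ Icc a b, 0 ≤ f t) (hK : 0 ≤ K) (hc : 0 ≤ c)
    (h : ∀ t ∈ Icc a b, f t ≤ c + K * ∫ s in a..t, f s) :
    ∀ t ∈ Icc a b, f t ≤ c * Real.exp (K * (t - a)) := by
  intro t ht
  have hab : a ≤ b := ht.1.trans ht.2
  have hint : ∀ x ∈ Icc a b, IntervalIntegrable f volume a x := fun x hx =>
    (hf.mono (by rw [uIcc_of_le hx.1]; exact Icc_subset_Icc_right hx.2)).intervalIntegrable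
  have hder : ∀ x ∈ Icc a b, HasDerivWithinAt (fun t => ∫ s in a..t, f s) (f x) (Icc a b) x := by
    intro x hx
    have : Fact (x ∈ Icc a b) := ⟨hx⟩
    exact intervalIntegral.integral_hasDerivWithinAt_right (hint x hx)
      (hf.stronglyMeasurableAtFilter_nhdsWithin measurableSet_Icc x) (hf x hx)
  have h0 : ∀ x ∈ Icc a b, 0 ≤ ∫ s in a..x, f s := fun x hx =>
    intervalIntegral.integral_nonneg hx.1 fun u hu => hf0 u ⟨hu.1, hu.2.trans hx.2⟩
  have key := norm_le_gronwallBound_of_norm_deriv_right_le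
    (f := fun t => c + K * ∫ s in a..t, f s) (f' := fun x => K * f x) (δ := c) (K := K) (ε := 0)
    (a := a) (b := b)
    (fun x hx => (((hder x hx).const_mul K).const_add c).continuousWithinAt)
    (fun x hx => ((((hder x ⟨hx.1, hx.2.le⟩).const_mul K).const_add c).mono_of_mem_nhdsWithin
      (Icc_mem_nhdsGE_of_mem hx)))
    (by simp [abs_of_nonneg hc])
    (fun x hx => by
      have hx' : x ∈ Icc a b := ⟨hx.1, hx.2.le⟩
      rw [Real.norm_of_nonneg (mul_nonneg hK (hf0 x hx')),
        Real.norm_of_nonneg (add_nonneg hc (mul_nonneg hK (h0 x hx'))), add_zero]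
      exact mul_le_mul_of_nonneg_left (h x hx') hK) t ht
  rw [gronwallBound_ε0, Real.norm_of_nonneg (add_nonneg hc (mul_nonneg hK (h0 t ht)))] at key
  exact (h t ht).trans key

/-- A Borel time-dependent field that is bounded and Lipschitz in space, with the same constant
`K` for all times. -/
structure BddLip (K : ℝ≥0) (w : E d → ℝ → E d) : Prop where
  meas : Measurable (fun p : E d × ℝ => w p.1 p.2)
  bdd : ∀ x t, ‖w x t‖ ≤ K
  lip : ∀ t, LipschitzWith K (fun x => w x t)

namespace BddLip

variable {K : ℝ≥0} {w : E d → ℝ → E d}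

theorem intervalIntegrable (hw : BddLip K w) {y : ℝ → E d} {a b : ℝ}
    (hy : ContinuousOn y (uIcc a b)) : IntervalIntegrable (fun r => w (y r) r) volume a b := by
  rw [intervalIntegrable_iff']
  have h1 : AEMeasurable y (volume.restrict (uIcc a b)) := hy.aemeasurable measurableSet_uIcc
  have h2 : AEMeasurable (fun r => w (y r) r) (volume.restrict (uIcc a b)) :=
    hw.meas.comp_aemeasurable (h1.prodMk aemeasurable_id)
  have : IsFiniteMeasure (volume.restrict (uIcc a b)) :=
    ⟨by rw [Measure.restrict_apply_univ]; exact isCompact_uIcc.measure_lt_top⟩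
  exact Integrable.of_bound h2.aestronglyMeasurable K (Eventually.of_forall fun r => hw.bdd _ _)

theorem norm_integral_le (hw : BddLip K w) (y : ℝ → E d) (a b : ℝ) :
    ‖∫ r in a..b, w (y r) r‖ ≤ K * |b - a| :=
  intervalIntegral.norm_integral_le_of_norm_le_const fun _ _ => hw.bdd _ _

/-- The Picard operator on curves on `[0,1]`, conjugated with the weight `exp (-lam * t)` so as to
be a contraction. -/
def picard (hw : BddLip K w) (x : E d) (lam : ℝ) (z : C(Icc (0 : ℝ) 1, E d)) :
    C(Icc (0 : ℝ) 1, E d) where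
  toFun t := Real.exp (-lam * t) •
    (x + ∫ r in (0 : ℝ)..t, w (Real.exp (lam * r) • IccExtend zero_le_one z r) r)
  continuous_toFun := by
    have hc : Continuous fun r : ℝ => Real.exp (lam * r) • IccExtend zero_le_one z r :=
      (by fun_prop : Continuous fun r : ℝ => Real.exp (lam * r)).smul z.continuous.Icc_extend'
    have := intervalIntegral.continuous_primitive
      (fun a b => hw.intervalIntegrable (a := a) (b := b) hc.continuousOn) 0
    have h2 : Continuous fun t : ℝ => Real.exp (-lam * t) •
      (x + ∫ r in (0 : ℝ)..t, w (Real.exp (lam * r) • IccExtend zero_le_one z r) r) := by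
      fun_prop
    exact h2.comp continuous_subtype_val

theorem contracting_picard (hw : BddLip K w) (x : E d) :
    ContractingWith (1 / 2) (hw.picard x (2 * K + 1)) := by
  refine ⟨by norm_num, LipschitzWith.of_dist_le_mul fun z1 z2 => ?_⟩
  -- The operator contracts by the factor `K / lam < 1 / 2`.
  set lam : ℝ := 2 * K + 1 with hlam
  have hlam0 : 0 < lam := by positivity
  have hcz : ∀ z : C(Icc (0 : ℝ) 1, E d),
      Continuous fun r : ℝ => Real.exp (lam * r) • IccExtend zero_le_one z r := fun z =>
    (by fun_prop : Continuous fun r : ℝ => Real.exp (lam * r)).smul z.continuous.Icc_extend'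
  refine (ContinuousMap.dist_le (by positivity)).2 fun t => ?_
  have ht0 : (0 : ℝ) ≤ t := t.2.1
  have hI : ∫ r in (0 : ℝ)..t, Real.exp (lam * r) = (Real.exp (lam * t) - 1) / lam := by
    rw [intervalIntegral.integral_comp_mul_left (fun u => Real.exp u) hlam0.ne']
    simp [div_eq_inv_mul]
  have hb : ‖∫ r in (0 : ℝ)..t, (w (Real.exp (lam * r) • IccExtend zero_le_one z1 r) r -
      w (Real.exp (lam * r) • IccExtend zero_le_one z2 r) r)‖ ≤
      ∫ r in (0 : ℝ)..t, K * dist z1 z2 * Real.exp (lam * r) := by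
    refine intervalIntegral.norm_integral_le_of_norm_le ht0 (Eventually.of_forall fun r _ => ?_)
      (Continuous.intervalIntegrable (by fun_prop) _ _)
    rw [← dist_eq_norm]
    refine ((hw.lip r).dist_le_mul _ _).trans ?_
    rw [dist_smul₀, Real.norm_of_nonneg (Real.exp_nonneg _), mul_assoc, mul_comm (dist z1 z2)]
    gcongr
    exact ContinuousMap.dist_apply_le_dist _
  rw [intervalIntegral.integral_const_mul, hI] at hb
  simp only [picard, ContinuousMap.coe_mk, dist_eq_norm, ← smul_sub, add_sub_add_left_eq_sub]
  rw [← intervalIntegral.integral_sub (hw.intervalIntegrable (hcz z1).continuousOn)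
    (hw.intervalIntegrable (hcz z2).continuousOn), norm_smul,
    Real.norm_of_nonneg (Real.exp_nonneg _)]
  refine (mul_le_mul_of_nonneg_left hb (Real.exp_nonneg _)).trans ?_
  rw [← dist_eq_norm]
  have h3 : Real.exp (-lam * t) * (Real.exp (lam * t) - 1) ≤ 1 := by
    rw [mul_sub, ← Real.exp_add]
    simp [Real.exp_nonneg]
  have h4 : (K : ℝ) / lam ≤ 1 / 2 := by
    rw [div_le_div_iff₀ hlam0 (by norm_num)]; rw [hlam]; linarith
  calc Real.exp (-lam * t) * (K * dist z1 z2 * ((Real.exp (lam * t) - 1) / lam))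
      = (K / lam) * dist z1 z2 * (Real.exp (-lam * t) * (Real.exp (lam * t) - 1)) := by ring
    _ ≤ (1 / 2) * dist z1 z2 * 1 := by
        apply mul_le_mul _ h3 (mul_nonneg (Real.exp_nonneg _) _) (by positivity)
        · gcongr
        · rw [sub_nonneg]; exact Real.one_le_exp (by positivity)
    _ = _ := by norm_num

theorem exists_trajectory (hw : BddLip K w) (x : E d) :
    ∃ y : ℝ → E d, Continuous y ∧ (∀ t, y t = y (projIcc 0 1 zero_le_one t)) ∧
      ∀ t ∈ Icc (0 : ℝ) 1, y t = x + ∫ r in (0 : ℝ)..t, w (y r) r := by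
  set lam : ℝ := 2 * K + 1
  obtain ⟨z, hz⟩ : ∃ z, hw.picard x lam z = z :=
    ⟨_, (hw.contracting_picard x).fixedPoint_isFixedPt⟩
  have hcz : Continuous fun t : Icc (0 : ℝ) 1 => Real.exp (lam * t) • z t :=
    (by fun_prop : Continuous fun r : Icc (0 : ℝ) 1 => Real.exp (lam * r)).smul z.continuous
  refine ⟨IccExtend zero_le_one fun t => Real.exp (lam * t) • z t, hcz.Icc_extend', fun t => ?_,
    fun t ht => ?_⟩
  · simp [IccExtend]
  · rw [IccExtend_of_mem _ _ ht]
    nth_rewrite 1 [← hz]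
    simp only [picard, ContinuousMap.coe_mk, smul_smul, ← Real.exp_add]
    rw [show lam * t + -lam * t = 0 by ring, Real.exp_zero, one_smul]
    congr 1
    apply intervalIntegral.integral_congr
    intro r hr
    rw [uIcc_of_le ht.1] at hr
    have hr' : r ∈ Icc (0 : ℝ) 1 := ⟨hr.1, hr.2.trans ht.2⟩
    simp only [IccExtend_of_mem _ _ hr']

end BddLip

/-- Solutions of an integral equation depend continuously on the initial value. The Lipschitz bound
is only needed along the two solutions. -/
theorem dist_le_of_integral_eq {w : E d → ℝ → E d} {K : ℝ≥0} {a b : ℝ} {y₁ y₂ : ℝ → E d}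
    {x₁ x₂ : E d} (hy₁ : ContinuousOn y₁ (Icc a b)) (hy₂ : ContinuousOn y₂ (Icc a b))
    (hi₁ : IntervalIntegrable (fun r => w (y₁ r) r) volume a b)
    (hi₂ : IntervalIntegrable (fun r => w (y₂ r) r) volume a b)
    (hL : ∀ r ∈ Icc a b, ‖w (y₁ r) r - w (y₂ r) r‖ ≤ K * ‖y₁ r - y₂ r‖)
    (h₁ : ∀ t ∈ Icc a b, y₁ t = x₁ + ∫ r in a..t, w (y₁ r) r)
    (h₂ : ∀ t ∈ Icc a b, y₂ t = x₂ + ∫ r in a..t, w (y₂ r) r) :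
    ∀ t ∈ Icc a b, ‖y₁ t - y₂ t‖ ≤ ‖x₁ - x₂‖ * Real.exp (K * (t - a)) := by
  have hc : ContinuousOn (fun t => ‖y₁ t - y₂ t‖) (Icc a b) := (hy₁.sub hy₂).norm
  refine le_exp_of_le_add_integral hc (fun _ _ => norm_nonneg _) K.2 (norm_nonneg _) fun t ht => ?_
  have hsub : uIcc a t ⊆ uIcc a b := by
    rw [uIcc_of_le ht.1, uIcc_of_le (ht.1.trans ht.2)]; exact Icc_subset_Icc_right ht.2
  have e : y₁ t - y₂ t = (x₁ - x₂) + ∫ r in a..t, (w (y₁ r) r - w (y₂ r) r) := by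
    rw [intervalIntegral.integral_sub (hi₁.mono_set hsub) (hi₂.mono_set hsub), h₁ t ht, h₂ t ht]
    abel
  rw [e]
  refine (norm_add_le _ _).trans (add_le_add_right ?_ _)
  rw [← intervalIntegral.integral_const_mul]
  refine intervalIntegral.norm_integral_le_of_norm_le ht.1
    (Eventually.of_forall fun r hr => hL r ⟨hr.1.le, hr.2.trans ht.2⟩) ?_
  refine ContinuousOn.intervalIntegrable (continuousOn_const.mul (hc.mono ?_))
  rw [uIcc_of_le ht.1]; exact Icc_subset_Icc_right ht.2

theorem eqOn_of_integral_eq {w : E d → ℝ → E d} {K : ℝ≥0} {a b : ℝ} {y₁ y₂ : ℝ → E d}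
    {x : E d} (hy₁ : ContinuousOn y₁ (Icc a b)) (hy₂ : ContinuousOn y₂ (Icc a b))
    (hi₁ : IntervalIntegrable (fun r => w (y₁ r) r) volume a b)
    (hi₂ : IntervalIntegrable (fun r => w (y₂ r) r) volume a b)
    (hL : ∀ r ∈ Icc a b, ‖w (y₁ r) r - w (y₂ r) r‖ ≤ K * ‖y₁ r - y₂ r‖)
    (h₁ : ∀ t ∈ Icc a b, y₁ t = x + ∫ r in a..t, w (y₁ r) r)
    (h₂ : ∀ t ∈ Icc a b, y₂ t = x + ∫ r in a..t, w (y₂ r) r) : EqOn y₁ y₂ (Icc a b) := by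
  intro t ht
  have := dist_le_of_integral_eq hy₁ hy₂ hi₁ hi₂ hL h₁ h₂ t ht
  rw [sub_self, norm_zero, zero_mul] at this
  exact sub_eq_zero.1 (norm_le_zero_iff.1 this)

/-- `flow w s x` is the trajectory of the field `w` on `[s,1]` that starts at `x` at time `s`. It is
obtained as a trajectory on `[0,1]` of the field switched off before time `s`, and is frozen outside
`[0,1]`; for fields without trajectories it has the junk value `x`. -/
def flow (w : E d → ℝ → E d) (s : ℝ) (x : E d) : ℝ → E d := by
  classical exact
  if h : ∃ y : ℝ → E d, Continuous y ∧ (∀ t, y t = y (projIcc 0 1 zero_le_one t)) ∧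
      ∀ t ∈ Icc (0 : ℝ) 1, y t = x + ∫ r in (0 : ℝ)..t, (Ioi s).indicator (w (y r)) r
  then h.choose else fun _ => x

namespace BddLip

variable {K : ℝ≥0} {w : E d → ℝ → E d}

/-- Switching a field off before time `s` keeps it bounded and Lipschitz. -/
theorem switch (hw : BddLip K w) (s : ℝ) :
    BddLip K (fun x r => (Ioi s).indicator (w x) r) where
  meas := by
    have : (fun p : E d × ℝ => (Ioi s).indicator (w p.1) p.2) =
        (Prod.snd ⁻¹' Ioi s).indicator (fun p : E d × ℝ => w p.1 p.2) := by
      ext p; simp [indicator]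
    rw [this]
    exact hw.meas.indicator (measurable_snd measurableSet_Ioi)
  bdd x t := (norm_indicator_le_norm_self _ _).trans (hw.bdd x t)
  lip t := by
    by_cases ht : t ∈ Ioi s
    · simpa [indicator_of_mem ht] using hw.lip t
    · simp only [indicator_of_notMem ht]; exact LipschitzWith.const' _

theorem flow_spec (hw : BddLip K w) (s : ℝ) (x : E d) :
    Continuous (flow w s x) ∧ (∀ t, flow w s x t = flow w s x (projIcc 0 1 zero_le_one t)) ∧
      ∀ t ∈ Icc (0 : ℝ) 1,
        flow w s x t = x + ∫ r in (0 : ℝ)..t, (Ioi s).indicator (w (flow w s x r)) r := by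
  have h := (hw.switch s).exists_trajectory x
  rw [flow, dif_pos h]
  exact h.choose_spec

theorem continuous_flow_right (hw : BddLip K w) (s : ℝ) (x : E d) : Continuous (flow w s x) :=
  (hw.flow_spec s x).1

theorem flow_eq (hw : BddLip K w) {s t : ℝ} (hs : 0 ≤ s) (hst : s ≤ t) (ht : t ≤ 1) (x : E d) :
    flow w s x t = x + ∫ r in s..t, w (flow w s x r) r := by
  have hc := hw.continuous_flow_right s x
  rw [(hw.flow_spec s x).2.2 t ⟨hs.trans hst, ht⟩,
    ← intervalIntegral.integral_add_adjacent_intervals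
    ((hw.switch s).intervalIntegrable (a := 0) (b := s) hc.continuousOn)
    ((hw.switch s).intervalIntegrable (a := s) (b := t) hc.continuousOn)]
  have e1 : ∫ r in (0 : ℝ)..s, (Ioi s).indicator (w (flow w s x r)) r = 0 := by
    rw [intervalIntegral.integral_of_le hs]
    refine integral_eq_zero_of_ae ?_
    filter_upwards [ae_restrict_mem measurableSet_Ioc] with r hr
    exact indicator_of_notMem (by simpa using hr.2) _
  rw [e1, zero_add, intervalIntegral.integral_of_le hst, intervalIntegral.integral_of_le hst]
  congr 1
  refine setIntegral_congr_fun measurableSet_Ioc fun r hr => ?_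
  exact indicator_of_mem (by exact hr.1) _

theorem flow_self (hw : BddLip K w) {s : ℝ} (hs : s ∈ Icc (0 : ℝ) 1) (x : E d) :
    flow w s x s = x := by
  simpa using hw.flow_eq hs.1 le_rfl hs.2 x

theorem eqOn_flow (hw : BddLip K w) {s T : ℝ} (hs : 0 ≤ s) (hT : T ≤ 1) {x : E d} {y : ℝ → E d}
    (hy : ContinuousOn y (Icc s T)) (h : ∀ t ∈ Icc s T, y t = x + ∫ r in s..t, w (y r) r) :
    EqOn y (flow w s x) (Icc s T) := by
  rcases lt_or_ge T s with hsT | hsT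
  · simp [Icc_eq_empty_of_lt hsT]
  have hc := hw.continuous_flow_right s x
  refine eqOn_of_integral_eq (K := K) hy hc.continuousOn (hw.intervalIntegrable ?_)
    (hw.intervalIntegrable hc.continuousOn) (fun r _ => (hw.lip r).norm_sub_le _ _) h
    fun t ht => hw.flow_eq hs ht.1 (ht.2.trans hT) x
  rwa [uIcc_of_le hsT]

theorem norm_flow_sub_le (hw : BddLip K w) {s t : ℝ} (hs : 0 ≤ s) (hst : s ≤ t) (ht : t ≤ 1)
    (x y : E d) : ‖flow w s x t - flow w s y t‖ ≤ ‖x - y‖ * Real.exp K := by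
  have hx := hw.continuous_flow_right s x
  have hy := hw.continuous_flow_right s y
  refine (dist_le_of_integral_eq (K := K) (a := s) (b := t) hx.continuousOn hy.continuousOn
    (hw.intervalIntegrable hx.continuousOn) (hw.intervalIntegrable hy.continuousOn)
    (fun r _ => (hw.lip r).norm_sub_le _ _)
    (fun r hr => hw.flow_eq hs hr.1 (hr.2.trans ht) x)
    (fun r hr => hw.flow_eq hs hr.1 (hr.2.trans ht) y) t ⟨hst, le_rfl⟩).trans ?_
  gcongr
  have : t - s ≤ 1 := by linarith
  nlinarith [K.2, NNReal.coe_nonneg K]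

/-- The semigroup property. -/
theorem flow_flow (hw : BddLip K w) {r s t : ℝ} (hr : 0 ≤ r) (hrs : r ≤ s) (hst : s ≤ t)
    (ht : t ≤ 1) (x : E d) : flow w s (flow w r x s) t = flow w r x t := by
  have hc := hw.continuous_flow_right r x
  refine (hw.eqOn_flow (hr.trans hrs) ht hc.continuousOn (fun q hq => ?_) ⟨hst, le_rfl⟩).symm
  rw [hw.flow_eq hr (hrs.trans hq.1) (hq.2.trans ht), hw.flow_eq hr hrs (hst.trans ht), add_assoc,
    intervalIntegral.integral_add_adjacent_intervals (hw.intervalIntegrable hc.continuousOn)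
    (hw.intervalIntegrable hc.continuousOn)]

theorem norm_flow_sub_self_le (hw : BddLip K w) {s t : ℝ} (hs : 0 ≤ s) (hst : s ≤ t) (ht : t ≤ 1)
    (x : E d) : ‖flow w s x t - x‖ ≤ K * (t - s) := by
  rw [hw.flow_eq hs hst ht, add_sub_cancel_left]
  simpa [abs_of_nonneg (sub_nonneg.2 hst)] using hw.norm_integral_le (flow w s x) s t

theorem lipschitzWith_flow (hw : BddLip K w) (t : ℝ) :
    LipschitzWith (Real.exp K).toNNReal fun x => flow w 0 x t := by
  refine LipschitzWith.of_dist_le_mul fun x y => ?_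
  rw [(hw.flow_spec 0 x).2.1 t, (hw.flow_spec 0 y).2.1 t, dist_eq_norm, dist_eq_norm]
  have h := (projIcc (0 : ℝ) 1 zero_le_one t).2
  have := hw.norm_flow_sub_le le_rfl h.1 h.2 x y
  rwa [Real.coe_toNNReal _ (Real.exp_nonneg _), mul_comm]

theorem continuous_flow (hw : BddLip K w) : Continuous fun p : E d × ℝ => flow w 0 p.1 p.2 :=
  continuous_prod_of_continuous_lipschitzWith _ _ (fun x => hw.continuous_flow_right 0 x)
    (fun t => hw.lipschitzWith_flow t)

end BddLip

/-! ### Mollification -/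

/-- Mollification of a function by a normalized bump function. -/
def mollify (φ : ContDiffBump (0 : E d)) (g : E d → ℝ) : E d → ℝ :=
  φ.normed volume ⋆[ContinuousLinearMap.lsmul ℝ ℝ, volume] g

section mollify

variable (φ : ContDiffBump (0 : E d)) {g : E d → ℝ} {Λ : ℝ≥0}

theorem mollify_apply (g : E d → ℝ) (x : E d) :
    mollify φ g x = ∫ z, φ.normed volume z * g (x - z) := by
  simp [mollify, convolution_def]

theorem integrable_normed_mul {a : E d → ℝ} (ha : Continuous a) :
    Integrable (fun z => φ.normed volume z * a z) :=
  (φ.continuous_normed.mul ha).integrable_of_hasCompactSupport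
    (φ.hasCompactSupport_normed.mul_right)

theorem abs_integral_normed_mul_le {a : E d → ℝ} {δ : ℝ}
    (h : ∀ z ∈ Metric.ball (0 : E d) φ.rOut, |a z| ≤ δ) :
    |∫ z, φ.normed volume z * a z| ≤ δ := by
  calc |∫ z, φ.normed volume z * a z| ≤ ∫ z, φ.normed volume z * δ := by
        rw [← Real.norm_eq_abs]
        refine norm_integral_le_of_norm_le ((integrable_normed_mul φ continuous_const))
          (Eventually.of_forall fun z => ?_)
        rw [norm_mul, Real.norm_of_nonneg (φ.nonneg_normed z), Real.norm_eq_abs]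
        by_cases hz : z ∈ Metric.ball (0 : E d) φ.rOut
        · exact mul_le_mul_of_nonneg_left (h z hz) (φ.nonneg_normed z)
        · rw [← φ.support_normed_eq (μ := volume), Function.notMem_support] at hz
          simp [hz]
    _ = δ := by rw [integral_mul_const, φ.integral_normed, one_mul]

theorem abs_mollify_sub_le (hg : LipschitzWith Λ g) (x : E d) :
    |mollify φ g x - g x| ≤ Λ * φ.rOut := by
  have e : mollify φ g x - g x = ∫ z, φ.normed volume z * (g (x - z) - g x) := by
    have h1 : Continuous fun z => g (x - z) := hg.continuous.comp (by fun_prop)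
    simp_rw [mul_sub]
    rw [integral_sub (integrable_normed_mul φ h1)
      (integrable_normed_mul φ continuous_const), integral_mul_const, φ.integral_normed, one_mul,
      mollify_apply]
  rw [e]
  refine abs_integral_normed_mul_le φ fun z hz => ?_
  refine (hg.norm_sub_le _ _).trans ?_
  have : ‖z‖ ≤ φ.rOut := by simpa using (Metric.mem_ball.1 hz).le
  simpa using mul_le_mul_of_nonneg_left this Λ.2

theorem abs_mollify_le {M : ℝ} (hM : ∀ x, |g x| ≤ M) (x : E d) :
    |mollify φ g x| ≤ M := by
  rw [mollify_apply]
  exact abs_integral_normed_mul_le φ fun z _ => hM _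

/-- Mollifying `g ∘ Z` or translating the mollification of `g` by `c` is nearly the same when `Z`
is nearly the translation by `c` on the support of the mollifier. -/
theorem abs_mollify_comp_sub_le (hg : LipschitzWith Λ g) {Z : E d → E d} (hZ : Continuous Z)
    {x c : E d} {δ : ℝ} (h : ∀ y ∈ Metric.ball x φ.rOut, ‖Z y - (y + c)‖ ≤ δ) :
    |mollify φ (g ∘ Z) x - mollify φ g (x + c)| ≤ Λ * δ := by
  have e : mollify φ (g ∘ Z) x - mollify φ g (x + c) =
      ∫ z, φ.normed volume z * (g (Z (x - z)) - g (x + c - z)) := by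
    have h1 : Continuous fun z => g (Z (x - z)) := hg.continuous.comp (hZ.comp (by fun_prop))
    have h2 : Continuous fun z => g (x + c - z) := hg.continuous.comp (by fun_prop)
    simp_rw [mul_sub]
    rw [integral_sub (integrable_normed_mul φ h1) (integrable_normed_mul φ h2), mollify_apply,
      mollify_apply]
    rfl
  rw [e]
  refine abs_integral_normed_mul_le φ fun z hz => ?_
  refine (hg.norm_sub_le _ _).trans (mul_le_mul_of_nonneg_left ?_ Λ.2)
  have := h (x - z) (by simpa [Metric.mem_ball, dist_eq_norm] using hz)
  rwa [show x + c - z = x - z + c by abel]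

theorem lipschitzWith_mollify (hg : LipschitzWith Λ g) : LipschitzWith Λ (mollify φ g) := by
  refine LipschitzWith.of_dist_le_mul fun x y => ?_
  have := abs_mollify_comp_sub_le φ hg continuous_id (x := x) (c := y - x) (δ := ‖x - y‖)
    fun z _ => by simp
  rw [Real.dist_eq, dist_eq_norm]
  simpa using this

theorem contDiff_mollify (hg : Continuous g) : ContDiff ℝ ∞ (mollify φ g) :=
  φ.hasCompactSupport_normed.contDiff_convolution_left _ φ.contDiff_normed hg.locallyIntegrable

/-- The derivative of a mollification is Lipschitz; its constant depends on the mollifier and the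
Lipschitz constant of the function only. -/
theorem exists_lipschitzWith_fderiv_mollify (Λ : ℝ≥0) : ∃ C : ℝ≥0, ∀ g : E d → ℝ,
    LipschitzWith Λ g → LipschitzWith C (fderiv ℝ (mollify φ g)) := by
  set η := φ.normed volume
  have hη : ContDiff ℝ 1 η := φ.contDiff_normed
  have hc : Continuous (fderiv ℝ η) := hη.continuous_fderiv one_ne_zero
  have hcs : HasCompactSupport (fderiv ℝ η) := φ.hasCompactSupport_normed.fderiv ℝ
  have hI : Integrable (fun t => ‖fderiv ℝ η t‖) :=
    hc.norm.integrable_of_hasCompactSupport hcs.norm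
  refine ⟨(Λ * ∫ t, ‖fderiv ℝ η t‖).toNNReal, fun g hg => ?_⟩
  refine LipschitzWith.of_dist_le_mul fun x y => ?_
  have hd : ∀ x, fderiv ℝ (mollify φ g) x = ∫ t, g (x - t) • fderiv ℝ η t := fun x => by
    rw [mollify, (φ.hasCompactSupport_normed.hasFDerivAt_convolution_left _ hη
      hg.continuous.locallyIntegrable x).fderiv, convolution_def]
    congr 1
    ext t v
    simp [ContinuousLinearMap.precompL_apply, mul_comm, η]
  have hint : ∀ x, Integrable (fun t => g (x - t) • fderiv ℝ η t) := fun x =>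
    ((hg.continuous.comp (by fun_prop : Continuous fun t => x - t)).smul
      hc).integrable_of_hasCompactSupport hcs.smul_left
  have h0 : 0 ≤ Λ * ∫ t, ‖fderiv ℝ η t‖ :=
    mul_nonneg Λ.2 (integral_nonneg fun _ => norm_nonneg _)
  rw [hd, hd, dist_eq_norm, ← integral_sub (hint x) (hint y), Real.coe_toNNReal _ h0]
  calc ‖∫ t, (g (x - t) • fderiv ℝ η t - g (y - t) • fderiv ℝ η t)‖
      ≤ ∫ t, Λ * dist x y * ‖fderiv ℝ η t‖ := by
        refine norm_integral_le_of_norm_le (hI.const_mul _) (Eventually.of_forall fun t => ?_)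
        rw [← sub_smul, norm_smul]
        gcongr
        refine (hg.norm_sub_le _ _).trans ?_
        rw [dist_eq_norm]; simp
    _ = _ := by rw [integral_const_mul]; ring

end mollify

/-! ### Absolutely continuous curves of measures -/

theorem enorm_integral_sub_le_of_coupling {ρ σ : Measure (E d)} [IsProbabilityMeasure ρ]
    [IsProbabilityMeasure σ] {f : E d → ℝ} {L : ℝ≥0} (hf : LipschitzWith L f)
    (hρ : Integrable f ρ) (hσ : Integrable f σ)
    {π : Measure (E d × E d)} (hπ : π.fst = ρ ∧ π.snd = σ) :
    ‖∫ x, f x ∂ρ - ∫ x, f x ∂σ‖ₑ ≤ L * (∫⁻ p, edist p.1 p.2 ^ 2 ∂π) ^ (1 / 2 : ℝ) := by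
  obtain ⟨rfl, rfl⟩ := hπ
  have hprob : IsProbabilityMeasure π := by
    constructor
    have := measure_univ (μ := π.fst)
    rwa [Measure.fst_univ] at this
  have hfm : StronglyMeasurable f := hf.continuous.stronglyMeasurable
  have e1 : ∫ x, f x ∂π.fst = ∫ p, f p.1 ∂π :=
    integral_map measurable_fst.aemeasurable hfm.aestronglyMeasurable
  have e2 : ∫ x, f x ∂π.snd = ∫ p, f p.2 ∂π :=
    integral_map measurable_snd.aemeasurable hfm.aestronglyMeasurable
  have i1 : Integrable (fun p : E d × E d => f p.1) π := hρ.comp_measurable measurable_fst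
  have i2 : Integrable (fun p : E d × E d => f p.2) π := hσ.comp_measurable measurable_snd
  rw [e1, e2, ← integral_sub i1 i2]
  have hm : AEMeasurable (fun p : E d × E d => edist p.1 p.2) π := by fun_prop
  calc ‖∫ p, (f p.1 - f p.2) ∂π‖ₑ ≤ ∫⁻ p, ‖f p.1 - f p.2‖ₑ ∂π := enorm_integral_le_lintegral_enorm _
    _ ≤ ∫⁻ p, L * edist p.1 p.2 ∂π := lintegral_mono fun p => by
        rw [← edist_eq_enorm_sub]; exact hf _ _
    _ = L * ∫⁻ p, edist p.1 p.2 ∂π := lintegral_const_mul'' _ hm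
    _ ≤ L * (∫⁻ p, edist p.1 p.2 ^ 2 ∂π) ^ (1 / 2 : ℝ) := by
        gcongr
        have := ENNReal.lintegral_mul_le_Lp_mul_Lq π Real.HolderConjugate.two_two hm
          (aemeasurable_const (b := (1 : ℝ≥0∞)))
        simpa using this

/-- The easy half of Kantorovich duality. -/
theorem enorm_integral_sub_le_W2 {ρ σ : Measure (E d)} [IsProbabilityMeasure ρ]
    [IsProbabilityMeasure σ] {f : E d → ℝ} {L : ℝ≥0} (hf : LipschitzWith L f)
    (hρ : Integrable f ρ) (hσ : Integrable f σ) :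
    ‖∫ x, f x ∂ρ - ∫ x, f x ∂σ‖ₑ ≤ L * W2 ρ σ := by
  rcases eq_or_ne L 0 with rfl | hL
  · have : f = fun _ => f 0 := funext fun x => by
      have := hf x 0
      simpa using this
    rw [this]; simp
  have hL' : (L : ℝ≥0∞) ≠ 0 := by simpa using hL
  have key : (‖∫ x, f x ∂ρ - ∫ x, f x ∂σ‖ₑ / L) ^ (2 : ℝ) ≤
      ⨅ π : Measure (E d × E d), ⨅ _ : π.fst = ρ ∧ π.snd = σ, ∫⁻ p, edist p.1 p.2 ^ 2 ∂π := by
    refine le_iInf₂ fun π hπ => ?_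
    have h := enorm_integral_sub_le_of_coupling hf hρ hσ hπ
    have h' : ‖∫ x, f x ∂ρ - ∫ x, f x ∂σ‖ₑ / L ≤ (∫⁻ p, edist p.1 p.2 ^ 2 ∂π) ^ (1 / 2 : ℝ) :=
      ENNReal.div_le_of_le_mul' h
    refine (ENNReal.rpow_le_rpow h' zero_le_two).trans ?_
    rw [← ENNReal.rpow_mul]
    norm_num
  have h2 := ENNReal.rpow_le_rpow key (by norm_num : (0 : ℝ) ≤ 1 / 2)
  rw [← ENNReal.rpow_mul] at h2
  norm_num only [ENNReal.rpow_one] at h2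
  rw [W2, mul_comm]
  exact (ENNReal.div_le_iff hL' ENNReal.coe_ne_top).1 (by simpa using h2)

/-- A modulus of continuity for a curve in `AC²`: an integrable density `m ≥ 0` on `[0,1]` that
controls the variation of integrals of bounded Lipschitz functions. -/
theorem CRho.exists_modulus {ρ : ℝ → Measure (E d)} (hρ : CRho ρ) :
    ∃ m : ℝ → ℝ, (∀ t, 0 ≤ m t) ∧ IntervalIntegrable m volume 0 1 ∧
      ∀ (f : E d → ℝ) (L : ℝ≥0) (M : ℝ), LipschitzWith L f → (∀ x, |f x| ≤ M) →
        ∀ s t : ℝ, 0 ≤ s → s ≤ t → t ≤ 1 →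
          |∫ x, f x ∂(ρ t) - ∫ x, f x ∂(ρ s)| ≤ L * ∫ r in s..t, m r := by
  obtain ⟨hP, m, hm, hW⟩ := hρ
  have hmi : IntervalIntegrable m volume 0 1 := by
    rw [intervalIntegrable_iff', uIcc_of_le zero_le_one]
    exact hm.integrable one_le_two
  refine ⟨fun t => |m t|, fun t => abs_nonneg _, hmi.abs, ?_⟩
  intro f L M hf hM s t hs hst ht
  have := (hP s ⟨hs, hst.trans ht⟩).1
  have := (hP t ⟨hs.trans hst, ht⟩).1
  have hi : ∀ ν : Measure (E d), IsProbabilityMeasure ν → Integrable f ν := fun ν _ =>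
    Integrable.of_bound hf.continuous.aestronglyMeasurable M (Eventually.of_forall hM)
  have h1 := enorm_integral_sub_le_W2 hf (hi (ρ s) inferInstance) (hi (ρ t) inferInstance)
  have h2 : ‖∫ x, f x ∂(ρ s) - ∫ x, f x ∂(ρ t)‖ₑ ≤
      ENNReal.ofReal (L * ∫ r in s..t, |m r|) := by
    refine h1.trans ?_
    rw [ENNReal.ofReal_mul L.coe_nonneg, ENNReal.ofReal_coe_nnreal]
    gcongr
    refine (hW s t hs hst ht).trans (ENNReal.ofReal_le_ofReal ?_)
    exact (le_abs_self _).trans (intervalIntegral.abs_integral_le_integral_abs hst)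
  rw [abs_sub_comm, ← Real.norm_eq_abs]
  rw [← ofReal_norm] at h2
  exact (ENNReal.ofReal_le_ofReal_iff (mul_nonneg L.2
    (intervalIntegral.integral_nonneg hst fun _ _ => abs_nonneg _))).1 h2

theorem continuousOn_primitive_Icc {m : ℝ → ℝ} (hm : IntervalIntegrable m volume 0 1) :
    ContinuousOn (fun t => ∫ r in (0 : ℝ)..t, m r) (Icc 0 1) := by
  have := intervalIntegral.continuousOn_primitive_interval (μ := volume) (f := m) (a := 0) (b := 1)
    (by rwa [← intervalIntegrable_iff'])
  rwa [uIcc_of_le zero_le_one] at this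

theorem integral_sub_primitive {m : ℝ → ℝ} (hm : IntervalIntegrable m volume 0 1) {s t : ℝ}
    (hs : s ∈ Icc (0 : ℝ) 1) (ht : t ∈ Icc (0 : ℝ) 1) :
    ∫ r in s..t, m r = (∫ r in (0 : ℝ)..t, m r) - ∫ r in (0 : ℝ)..s, m r := by
  rw [intervalIntegral.integral_interval_sub_left]
  · refine hm.mono_set ?_
    rw [uIcc_of_le ht.1, uIcc_of_le zero_le_one]; exact Icc_subset_Icc_right ht.2
  · refine hm.mono_set ?_
    rw [uIcc_of_le hs.1, uIcc_of_le zero_le_one]; exact Icc_subset_Icc_right hs.2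

theorem CRho.continuousOn_integral {ρ : ℝ → Measure (E d)} (hρ : CRho ρ) {f : E d → ℝ} {L : ℝ≥0}
    {M : ℝ} (hf : LipschitzWith L f) (hM : ∀ x, |f x| ≤ M) :
    ContinuousOn (fun t => ∫ x, f x ∂(ρ t)) (Icc 0 1) := by
  obtain ⟨m, hm0, hmi, hm⟩ := hρ.exists_modulus
  have hc := continuousOn_primitive_Icc hmi
  have key : ∀ s ∈ Icc (0 : ℝ) 1, ∀ t ∈ Icc (0 : ℝ) 1,
      dist (∫ x, f x ∂(ρ t)) (∫ x, f x ∂(ρ s)) ≤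
        L * dist (∫ r in (0 : ℝ)..t, m r) (∫ r in (0 : ℝ)..s, m r) := by
    intro s hs t ht
    wlog hst : s ≤ t generalizing s t
    · rw [dist_comm, dist_comm (∫ r in (0 : ℝ)..t, m r)]
      exact this t ht s hs (le_of_not_ge hst)
    rw [Real.dist_eq, Real.dist_eq, ← integral_sub_primitive hmi hs ht]
    refine (hm f L M hf hM s t hs.1 hst ht.2).trans (mul_le_mul_of_nonneg_left (le_abs_self _) L.2)
  intro s hs
  rw [ContinuousWithinAt, tendsto_iff_dist_tendsto_zero]
  have h0 := (tendsto_iff_dist_tendsto_zero.1 (hc s hs)).const_mul (L : ℝ)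
  rw [mul_zero] at h0
  refine squeeze_zero' (Eventually.of_forall fun _ => dist_nonneg) ?_ h0
  filter_upwards [self_mem_nhdsWithin] with t ht using key s hs t ht

/-- A curve in `AC²` is, on `[0,1]`, a Markov kernel from time to space. -/
theorem CRho.exists_kernel {ρ : ℝ → Measure (E d)} (hρ : CRho ρ) :
    ∃ κ : ProbabilityTheory.Kernel ℝ (E d), ProbabilityTheory.IsMarkovKernel κ ∧
      ∀ t ∈ Icc (0 : ℝ) 1, κ t = ρ t := by
  have hp : ∀ t : ℝ, IsProbabilityMeasure (ρ (projIcc 0 1 zero_le_one t)) := fun t =>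
    (hρ.1 _ (projIcc (0 : ℝ) 1 zero_le_one t).2).1
  -- Masses of closed sets are limits of integrals of Lipschitz functions, continuous in time.
  have hmeas : Measurable fun t : ℝ => ρ (projIcc 0 1 zero_le_one t) := by
    refine Measurable.measure_of_isPiSystem_of_isProbabilityMeasure
      (S := {F | IsClosed F}) (borel_eq_generateFrom_isClosed (α := E d) ▸ BorelSpace.measurable_eq)
      isPiSystem_isClosed fun F hF => ?_
    have hδ : ∀ n : ℕ, (0 : ℝ) < 1 / (n + 1) := fun n => Nat.one_div_pos_of_nat
    refine measurable_of_tendsto_metrizable (f := fun (n : ℕ) t =>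
      ∫⁻ x, (thickenedIndicator (hδ n) F x : ℝ≥0∞) ∂(ρ (projIcc 0 1 zero_le_one t))) (fun n => ?_)
      (tendsto_pi_nhds.2 fun t => tendsto_lintegral_thickenedIndicator_of_isClosed _ hF hδ
        tendsto_one_div_add_atTop_nhds_zero_nat)
    have hl := lipschitzWith_thickenedIndicator (hδ n) F
    have hb : ∀ x, |(thickenedIndicator (hδ n) F x : ℝ)| ≤ 1 := fun x => by
      rw [abs_of_nonneg (NNReal.coe_nonneg _)]
      exact_mod_cast thickenedIndicator_le_one (hδ n) F x
    have hc := hρ.continuousOn_integral (f := fun x => (thickenedIndicator (hδ n) F x : ℝ)) hl hb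
    have hc' := (continuousOn_iff_continuous_domRestrict.1 hc).comp
      (continuous_projIcc (a := (0 : ℝ)) (b := 1) (h := zero_le_one))
    have e : (fun t : ℝ => ∫⁻ x, (thickenedIndicator (hδ n) F x : ℝ≥0∞)
        ∂(ρ (projIcc 0 1 zero_le_one t))) = fun t : ℝ =>
        ENNReal.ofReal (∫ x, (thickenedIndicator (hδ n) F x : ℝ)
          ∂(ρ (projIcc 0 1 zero_le_one t))) := by
      ext t
      exact lintegral_coe_eq_integral _ (integrable_thickenedIndicator F (hδ n))
    rw [e]
    exact hc'.measurable.ennreal_ofReal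
  refine ⟨⟨_, hmeas⟩, ⟨hp⟩, fun t ht => ?_⟩
  change ρ _ = ρ t
  rw [projIcc_of_mem _ ht]

/-! ### The continuity equation in integrated form -/

theorem memLp_two_of_lintegral_lt_top {Ω F : Type*} [MeasurableSpace Ω] [NormedAddCommGroup F]
    {m : Measure Ω} {f : Ω → F} (hf : AEStronglyMeasurable f m) (h : ∫⁻ p, ‖f p‖ₑ ^ 2 ∂m < ⊤) :
    MemLp f 2 m := by
  refine ⟨hf, ?_⟩
  rw [eLpNorm_lt_top_iff_lintegral_rpow_enorm_lt_top two_ne_zero ENNReal.ofNat_ne_top]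
  simpa using h

/-- Functions growing at most like the velocity are integrable along the curve. -/
theorem CRhoV.integrable_slice {μ : Measure (E d)} {ρ : ℝ → Measure (E d)} {v : E d → ℝ → E d}
    (h : CRhoV μ ρ v) {g : ℝ → E d → ℝ} (hg : Measurable fun p : ℝ × E d => g p.1 p.2) {C : ℝ}
    (hC : ∀ t x, |g t x| ≤ C * (‖v x t‖ + 1)) :
    (∀ᵐ t ∂volume.restrict (Icc (0 : ℝ) 1), Integrable (g t) (ρ t)) ∧
      IntervalIntegrable (fun t => ∫ x, g t x ∂(ρ t)) volume 0 1 := by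
  obtain ⟨κ, hκ, hκρ⟩ := h.curve.exists_kernel
  set I := volume.restrict (Icc (0 : ℝ) 1)
  have hvm : Measurable fun p : ℝ × E d => v p.2 p.1 := h.meas.comp measurable_swap
  have hI : ∀ᵐ t ∂I, t ∈ Icc (0 : ℝ) 1 := ae_restrict_mem measurableSet_Icc
  have hv2 : MemLp (fun p : ℝ × E d => v p.2 p.1) 2 (I ⊗ₘ κ) := by
    refine memLp_two_of_lintegral_lt_top hvm.aestronglyMeasurable ?_
    rw [Measure.lintegral_compProd (hvm.enorm.pow_const 2)]
    refine lt_of_eq_of_lt (lintegral_congr_ae ?_) h.sq_int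
    filter_upwards [hI] with t ht
    simp only [hκρ t ht]
  have hgi : Integrable (fun p : ℝ × E d => g p.1 p.2) (I ⊗ₘ κ) :=
    (((hv2.integrable one_le_two).norm.add (integrable_const (1 : ℝ))).const_mul C).mono'
      hg.aestronglyMeasurable (Eventually.of_forall fun p => hC p.1 p.2)
  constructor
  · filter_upwards [((Measure.integrable_compProd_iff hg.aestronglyMeasurable).1 hgi).1, hI]
      with t ht htI
    rwa [← hκρ t htI]
  · rw [intervalIntegrable_iff', uIcc_of_le zero_le_one]
    refine (hgi.integral_compProd).congr ?_
    filter_upwards [hI] with t ht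
    simp [hκρ t ht]

/-- A smooth step from `0` to `1`: the primitive of a bump. -/
def smoothStep (φ : ContDiffBump (0 : ℝ)) (r : ℝ) : ℝ := ∫ u in (-1 : ℝ)..r, φ.normed volume u

section smoothStep

variable (φ : ContDiffBump (0 : ℝ))

theorem hasDerivAt_smoothStep (r : ℝ) : HasDerivAt (smoothStep φ) (φ.normed volume r) r :=
  intervalIntegral.integral_hasDerivAt_right (φ.continuous_normed.intervalIntegrable _ _)
    (φ.continuous_normed.stronglyMeasurableAtFilter _ _) φ.continuous_normed.continuousAt

theorem contDiff_smoothStep : ContDiff ℝ ∞ (smoothStep φ) := by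
  refine contDiff_infty_iff_deriv.2 ⟨fun r => (hasDerivAt_smoothStep φ r).differentiableAt, ?_⟩
  rw [funext fun r => (hasDerivAt_smoothStep φ r).deriv]
  exact φ.contDiff_normed

theorem abs_smoothStep_le (r : ℝ) : |smoothStep φ r| ≤ 1 := by
  rw [← Real.norm_eq_abs, smoothStep]
  refine (intervalIntegral.norm_integral_le_integral_norm_uIoc).trans ?_
  simp_rw [Real.norm_of_nonneg (φ.nonneg_normed _)]
  calc ∫ u in uIoc (-1) r, φ.normed volume u ≤ ∫ u, φ.normed volume u :=
        setIntegral_le_integral φ.integrable_normed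
          (Eventually.of_forall fun u => φ.nonneg_normed u)
    _ = 1 := φ.integral_normed

theorem smoothStep_of_le (h1 : φ.rOut < 1) {r : ℝ} (hr : r ≤ -φ.rOut) : smoothStep φ r = 0 := by
  rw [smoothStep, intervalIntegral.integral_congr (g := fun _ => (0 : ℝ)),
    intervalIntegral.integral_zero]
  intro u hu
  have hu' : u ≤ -φ.rOut := by
    refine hu.2.trans (max_le (by linarith) hr)
  have : u ∉ Function.support (φ.normed volume) := by
    rw [φ.support_normed_eq, Metric.mem_ball, Real.dist_eq, sub_zero, abs_lt]
    rintro ⟨h, -⟩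
    linarith
  simpa using this

theorem smoothStep_of_ge (h1 : φ.rOut < 1) {r : ℝ} (hr : φ.rOut ≤ r) : smoothStep φ r = 1 := by
  rw [smoothStep, intervalIntegral.integral_eq_integral_of_support_subset, φ.integral_normed]
  rw [φ.support_normed_eq]
  intro u hu
  rw [Metric.mem_ball, Real.dist_eq, sub_zero, abs_lt] at hu
  exact ⟨by linarith, by linarith⟩

end smoothStep

theorem tendsto_integral_normed_mul {φ : ℕ → ContDiffBump (0 : ℝ)}
    (hφ : Tendsto (fun n => (φ n).rOut) atTop (𝓝 0)) {a : ℝ → ℝ} (ha : Continuous a) (s : ℝ) :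
    Tendsto (fun n => ∫ r, (φ n).normed volume (r - s) * a r) atTop (𝓝 (a s)) := by
  have h := ContDiffBump.convolution_tendsto_right_of_continuous (μ := volume) hφ ha s
  refine h.congr fun n => ?_
  rw [convolution_def, ← integral_sub_left_eq_self _ volume s]
  refine integral_congr_ae (Eventually.of_forall fun z => ?_)
  simp only [sub_sub_cancel, ContinuousLinearMap.lsmul_apply, smul_eq_mul]
  rw [← neg_sub z s, ContDiffBump.normed_neg]

/-- If `a' = b` in the sense of distributions on `(0,1)` then increments of the continuous function
`a` are integrals of `b`. -/
theorem sub_eq_integral_of_weak_deriv {a b : ℝ → ℝ} (ha : ContinuousOn a (Icc 0 1))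
    (hb : IntervalIntegrable b volume 0 1)
    (h : ∀ θ : ℝ → ℝ, ContDiff ℝ ∞ θ → HasCompactSupport θ → tsupport θ ⊆ Ioo 0 1 →
      ∫ t in Icc (0 : ℝ) 1, (deriv θ t * a t + θ t * b t) = 0) {s t : ℝ} (hs : 0 ≤ s) (hst : s ≤ t)
    (ht : t ≤ 1) : a t - a s = ∫ r in s..t, b r := by
  -- It is enough to treat interior times, by continuity.
  suffices H : ∀ s ∈ Ioo (0 : ℝ) 1, ∀ t ∈ Ioo (0 : ℝ) 1, s < t → a t - a s = ∫ r in s..t, b r by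
    have hc : ContinuousOn (fun t => a t - ∫ r in (0 : ℝ)..t, b r) (Icc 0 1) :=
      ha.sub (continuousOn_primitive_Icc hb)
    have key : EqOn (fun t => a t - ∫ r in (0 : ℝ)..t, b r)
        (fun _ => a (1 / 2) - ∫ r in (0 : ℝ)..(1 / 2), b r) (Icc 0 1) := by
      refine EqOn.of_subset_closure (s := Ioo 0 1) (fun t ht => ?_) hc continuousOn_const
        Ioo_subset_Icc_self (by rw [closure_Ioo (zero_ne_one)])
      have hh : (1 / 2 : ℝ) ∈ Ioo (0 : ℝ) 1 := by constructor <;> norm_num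
      rcases lt_trichotomy t (1 / 2) with hlt | rfl | hlt
      · have := H t ht _ hh hlt
        rw [integral_sub_primitive hb (Ioo_subset_Icc_self ht) (Ioo_subset_Icc_self hh)] at this
        linarith
      · rfl
      · have := H _ hh t ht hlt
        rw [integral_sub_primitive hb (Ioo_subset_Icc_self hh) (Ioo_subset_Icc_self ht)] at this
        linarith
    have hs' : s ∈ Icc (0 : ℝ) 1 := ⟨hs, hst.trans ht⟩
    have ht' : t ∈ Icc (0 : ℝ) 1 := ⟨hs.trans hst, ht⟩
    have e1 := key hs'
    have e2 := key ht'
    simp only at e1 e2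
    rw [integral_sub_primitive hb hs' ht']
    linarith
  intro s hs t ht hst
  -- Test with the difference of two smooth steps, at `s` and at `t`.
  let φ : ℕ → ContDiffBump (0 : ℝ) := fun n =>
    ⟨1 / ((n : ℝ) + 1) / 2, 1 / ((n : ℝ) + 1), by positivity, half_lt_self (by positivity)⟩
  have hφ : Tendsto (fun n => (φ n).rOut) atTop (𝓝 0) := tendsto_one_div_add_atTop_nhds_zero_nat
  set θ : ℕ → ℝ → ℝ := fun n r => smoothStep (φ n) (r - s) - smoothStep (φ n) (r - t) with hθ
  have hθd : ∀ n, ContDiff ℝ ∞ (θ n) := fun n =>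
    ((contDiff_smoothStep (φ n)).comp (by fun_prop)).sub
      ((contDiff_smoothStep (φ n)).comp (by fun_prop))
  have hθ' : ∀ n r, deriv (θ n) r =
      (φ n).normed volume (r - s) - (φ n).normed volume (r - t) := fun n r =>
    (((hasDerivAt_smoothStep (φ n) (r - s)).comp_sub_const r s).sub
      ((hasDerivAt_smoothStep (φ n) (r - t)).comp_sub_const r t)).deriv
  have hsmall : ∀ᶠ n in atTop, (φ n).rOut < 1 ∧ (φ n).rOut < s ∧ (φ n).rOut < 1 - t := by
    have h1 := hφ.eventually_lt_const (zero_lt_one)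
    have h2 := hφ.eventually_lt_const hs.1
    have h3 := hφ.eventually_lt_const (sub_pos.2 ht.2)
    filter_upwards [h1, h2, h3] with n a b c using ⟨a, b, c⟩
  have hsupp : ∀ n, (φ n).rOut < 1 →
      Function.support (θ n) ⊆ Icc (s - (φ n).rOut) (t + (φ n).rOut) := by
    intro n hn r hr
    by_contra hcon
    apply hr
    rw [mem_Icc, not_and_or, not_le, not_le] at hcon
    rcases hcon with hlt | hlt
    · simp only [hθ]
      rw [smoothStep_of_le _ hn (by linarith), smoothStep_of_le _ hn (by linarith), sub_zero]
    · simp only [hθ]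
      rw [smoothStep_of_ge _ hn (by linarith), smoothStep_of_ge _ hn (by linarith), sub_self]
  set a' : ℝ → ℝ := IccExtend (zero_le_one' ℝ) ((Icc 0 1).domRestrict a) with ha'
  have ha'c : Continuous a' := (continuousOn_iff_continuous_domRestrict.1 ha).Icc_extend'
  have ha'e : ∀ r ∈ Icc (0 : ℝ) 1, a' r = a r := fun r hr => by
    simp [ha', IccExtend_of_mem _ _ hr, domRestrict]
  have hzero : ∀ n (q r : ℝ), (φ n).rOut < q → (φ n).rOut < 1 - q → r ∉ Icc (0 : ℝ) 1 →
      (φ n).normed volume (r - q) = 0 := by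
    intro n q r h1 h2 hr
    have : r - q ∉ Function.support ((φ n).normed volume) := by
      rw [(φ n).support_normed_eq, Metric.mem_ball, Real.dist_eq, sub_zero, abs_lt]
      rintro ⟨h3, h4⟩
      exact hr ⟨by linarith, by linarith⟩
    simpa using this
  have hA : Tendsto (fun n => ∫ r in Icc (0 : ℝ) 1, deriv (θ n) r * a r) atTop
      (𝓝 (a s - a t)) := by
    have h1 := (tendsto_integral_normed_mul hφ ha'c s).sub (tendsto_integral_normed_mul hφ ha'c t)
    rw [ha'e s (Ioo_subset_Icc_self hs), ha'e t (Ioo_subset_Icc_self ht)] at h1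
    refine h1.congr' ?_
    filter_upwards [hsmall] with n hn
    have hint : ∀ q, Integrable (fun r => (φ n).normed volume (r - q) * a' r) := fun q => by
      refine Continuous.integrable_of_hasCompactSupport
        (((φ n).continuous_normed.comp (by fun_prop)).mul ha'c) ?_
      exact ((φ n).hasCompactSupport_normed.comp_homeomorph (Homeomorph.subRight q)).mul_right
    rw [← integral_sub (hint s) (hint t), ← setIntegral_eq_integral_of_forall_compl_eq_zero
      (s := Icc (0 : ℝ) 1)]
    · refine setIntegral_congr_fun measurableSet_Icc fun r hr => ?_
      simp only [hθ', ha'e r hr]; ring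
    · intro r hr
      rw [hzero n s r hn.2.1 (by linarith [hn.2.2]) hr,
        hzero n t r (by linarith [hn.2.1]) hn.2.2 hr]
      ring
  have hb' : Integrable b (volume.restrict (Icc (0 : ℝ) 1)) := by
    rwa [intervalIntegrable_iff', uIcc_of_le zero_le_one] at hb
  have hB : Tendsto (fun n => ∫ r in Icc (0 : ℝ) 1, θ n r * b r) atTop
      (𝓝 (∫ r in s..t, b r)) := by
    have e : ∫ r in s..t, b r = ∫ r in Icc (0 : ℝ) 1, (Ioc s t).indicator b r := by
      rw [intervalIntegral.integral_of_le hst.le, setIntegral_indicator measurableSet_Ioc,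
        inter_eq_self_of_subset_right
          (Ioc_subset_Icc_self.trans (Icc_subset_Icc hs.1.le ht.2.le))]
    rw [e]
    refine tendsto_integral_of_dominated_convergence (fun r => 2 * |b r|)
      (fun n => (hθd n).continuous.aestronglyMeasurable.mul hb'.aestronglyMeasurable)
      (hb'.abs.const_mul 2) (fun n => Eventually.of_forall fun r => ?_) ?_
    · rw [norm_mul]
      refine mul_le_mul_of_nonneg_right ?_ (abs_nonneg _)
      refine (norm_sub_le _ _).trans ?_
      have h1 := abs_smoothStep_le (φ n) (r - s)
      have h2 := abs_smoothStep_le (φ n) (r - t)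
      simp only [Real.norm_eq_abs]
      linarith
    · have hne : ∀ q : ℝ, ∀ᵐ r ∂volume.restrict (Icc (0 : ℝ) 1), r ≠ q := fun q =>
        ae_restrict_of_ae (by simp [ae_iff, measure_singleton])
      filter_upwards [hne s, hne t] with r hrs hrt
      rcases lt_or_gt_of_ne hrs with h1 | h1
      · rw [indicator_of_notMem (fun h => absurd h.1 (not_lt.2 h1.le))]
        refine tendsto_const_nhds.congr' ?_
        filter_upwards [hsmall, hφ.eventually_lt_const (sub_pos.2 h1)] with n hn hn2
        simp only [hθ]
        rw [smoothStep_of_le _ hn.1 (by linarith), smoothStep_of_le _ hn.1 (by linarith)]; ring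
      · rcases lt_or_gt_of_ne hrt with h2 | h2
        · rw [indicator_of_mem (show r ∈ Ioc s t from ⟨h1, h2.le⟩)]
          refine tendsto_const_nhds.congr' ?_
          filter_upwards [hsmall, hφ.eventually_lt_const (sub_pos.2 h1),
            hφ.eventually_lt_const (sub_pos.2 h2)] with n hn hn2 hn3
          simp only [hθ]
          rw [smoothStep_of_ge _ hn.1 (by linarith), smoothStep_of_le _ hn.1 (by linarith)]; ring
        · rw [indicator_of_notMem (fun h => absurd h.2 (not_le.2 h2))]
          refine tendsto_const_nhds.congr' ?_
          filter_upwards [hsmall, hφ.eventually_lt_const (sub_pos.2 h2)] with n hn hn2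
          simp only [hθ]
          rw [smoothStep_of_ge _ hn.1 (by linarith), smoothStep_of_ge _ hn.1 (by linarith)]; ring
  have hlim := hA.add hB
  have h0 : a s - a t + ∫ r in s..t, b r = 0 := by
    refine tendsto_nhds_unique hlim (tendsto_const_nhds.congr' ?_)
    filter_upwards [hsmall] with n hn
    have hts : tsupport (θ n) ⊆ Icc (s - (φ n).rOut) (t + (φ n).rOut) :=
      closure_minimal (hsupp n hn.1) isClosed_Icc
    have hcs : HasCompactSupport (θ n) := isCompact_Icc.of_isClosed_subset (isClosed_tsupport _) hts
    have := h (θ n) (hθd n) hcs (hts.trans fun r hr =>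
      ⟨by linarith [hr.1, hn.2.1], by linarith [hr.2, hn.2.2]⟩)
    refine this.symm.trans (integral_add ?_ ?_)
    · have hd : Continuous (deriv (θ n)) := (hθd n).continuous_deriv (by simp)
      exact ((hd.continuousOn.mul ha).integrableOn_compact isCompact_Icc)
    · refine (hb'.bdd_mul (c := 2) (hθd n).continuous.aestronglyMeasurable
        (Eventually.of_forall fun r => ?_))
      refine (norm_sub_le _ _).trans ?_
      have h1 := abs_smoothStep_le (φ n) (r - s)
      have h2 := abs_smoothStep_le (φ n) (r - t)
      simp only [Real.norm_eq_abs]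
      linarith
  linarith

theorem exists_lipschitzWith_bound {f : E d → ℝ} (hf : ContDiff ℝ ∞ f) (hfc : HasCompactSupport f) :
    ∃ (L : ℝ≥0) (M : ℝ), LipschitzWith L f ∧ ∀ x, |f x| ≤ M := by
  obtain ⟨L, hL⟩ := (hf.of_le (by simp)).lipschitzWith_of_hasCompactSupport hfc one_ne_zero
  obtain ⟨M, hM⟩ := hf.continuous.bounded_above_of_compact_support hfc
  exact ⟨L, M, hL, hM⟩

theorem measurable_fderiv_apply {f : E d → ℝ} (hf : ContDiff ℝ ∞ f) {u : E d → ℝ → E d}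
    (hu : Measurable fun p : E d × ℝ => u p.1 p.2) :
    Measurable fun p : ℝ × E d => fderiv ℝ f p.2 (u p.2 p.1) := by
  have h1 : Measurable fun p : ℝ × E d => fderiv ℝ f p.2 :=
    ((hf.continuous_fderiv (by simp)).comp continuous_snd).measurable
  have h2 : Measurable fun p : ℝ × E d => u p.2 p.1 := hu.comp measurable_swap
  have h3 : Continuous fun q : (E d →L[ℝ] ℝ) × E d => q.1 q.2 := by fun_prop
  exact h3.measurable.comp (h1.prodMk h2)

/-- The continuity equation in integrated form, tested with functions of space only. -/
theorem CRhoV.integral_increment {μ : Measure (E d)} {ρ : ℝ → Measure (E d)} {v : E d → ℝ → E d}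
    (h : CRhoV μ ρ v) {f : E d → ℝ} (hf : ContDiff ℝ ∞ f) (hfc : HasCompactSupport f) {s t : ℝ}
    (hs : 0 ≤ s) (hst : s ≤ t) (ht : t ≤ 1) :
    ∫ x, f x ∂(ρ t) - ∫ x, f x ∂(ρ s) = ∫ r in s..t, ∫ x, fderiv ℝ f x (v x r) ∂(ρ r) := by
  obtain ⟨L, M, hL, hM⟩ := exists_lipschitzWith_bound hf hfc
  have hfd : Continuous (fderiv ℝ f) := hf.continuous_fderiv (by simp)
  have hbd : ∀ x, ‖fderiv ℝ f x‖ ≤ L := fun x => norm_fderiv_le_of_lipschitz ℝ hL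
  obtain ⟨hi1, hi2⟩ := h.integrable_slice (g := fun t x => fderiv ℝ f x (v x t))
    (measurable_fderiv_apply hf h.meas) (C := L)
    fun t x => by
      rw [← Real.norm_eq_abs]
      refine ((fderiv ℝ f x).le_opNorm _).trans ?_
      have := hbd x
      gcongr
      linarith
  refine sub_eq_integral_of_weak_deriv (a := fun t => ∫ x, f x ∂(ρ t))
    (h.curve.continuousOn_integral hL hM) hi2 (fun θ hθ hθc hθs => ?_) hs hst ht
  have hφ := h.cont_eq (fun p => θ p.1 * f p.2)
    ((hθ.comp contDiff_fst).mul (hf.comp contDiff_snd)) ?_ ?_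
  · refine Eq.trans (integral_congr_ae ?_) hφ
    filter_upwards [hi1, ae_restrict_mem measurableSet_Icc] with t hti htI
    have := (h.curve.1 t htI).1
    have hd : ∀ x, fderiv ℝ (fun p : ℝ × E d => θ p.1 * f p.2) (t, x) (1, v x t) =
        deriv θ t * f x + θ t * fderiv ℝ f x (v x t) := by
      intro x
      have h1 : HasFDerivAt (fun p : ℝ × E d => θ p.1)
          ((fderiv ℝ θ t).comp (ContinuousLinearMap.fst ℝ ℝ (E d))) (t, x) :=
        HasFDerivAt.comp (t, x) ((hθ.differentiable (by simp)).differentiableAt.hasFDerivAt)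
          hasFDerivAt_fst
      have h2 : HasFDerivAt (fun p : ℝ × E d => f p.2)
          ((fderiv ℝ f x).comp (ContinuousLinearMap.snd ℝ ℝ (E d))) (t, x) :=
        HasFDerivAt.comp (t, x) ((hf.differentiable (by simp)).differentiableAt.hasFDerivAt)
          hasFDerivAt_snd
      have h12 : fderiv ℝ (fun p : ℝ × E d => θ p.1 * f p.2) (t, x) = _ := (h1.mul h2).fderiv
      rw [h12]
      simp [fderiv_eq_smul_deriv]
      ring
    simp_rw [hd]
    have hfi : Integrable f (ρ t) :=
      Integrable.of_bound hL.continuous.aestronglyMeasurable M (Eventually.of_forall hM)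
    rw [integral_add (hfi.const_mul _) (hti.const_mul _), integral_const_mul, integral_const_mul]
  · refine HasCompactSupport.of_support_subset_isCompact (hθc.isCompact.prod hfc.isCompact) ?_
    intro p hp
    exact ⟨subset_tsupport _ fun h0 => hp (by simp [h0]),
      subset_tsupport _ fun h0 => hp (by simp [h0])⟩
  · refine (closure_minimal (t := tsupport θ ×ˢ univ) (fun p hp => ⟨?_, mem_univ _⟩)
      ((isClosed_tsupport θ).prod isClosed_univ)).trans (prod_mono hθs Subset.rfl)
    exact subset_tsupport _ fun h0 => hp (by simp [h0])

/-! ### The duality estimate -/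

/-- Summation over finer and finer uniform partitions removes a second-order error. -/
theorem abs_sub_le_of_forall_abs_sub_le {D P Q : ℝ → ℝ} {T : ℝ} (hT : 0 ≤ T)
    (h : ∀ s t, 0 ≤ s → s ≤ t → t ≤ T → |D t - D s| ≤ (P t - P s) + (t - s) * (Q t - Q s)) :
    |D T - D 0| ≤ P T - P 0 := by
  have key : ∀ N : ℕ, |D T - D 0| ≤ P T - P 0 + T * (Q T - Q 0) * (1 / ((N : ℝ) + 1)) := by
    intro N
    set δ : ℝ := T / (N + 1) with hδ
    have hN : (0 : ℝ) < N + 1 := by positivity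
    have hδ0 : 0 ≤ δ := by positivity
    have hδN : δ * (N + 1) = T := by rw [hδ]; field_simp
    have step : ∀ k : ℕ, k ≤ N + 1 →
        |D (δ * k) - D 0| ≤ P (δ * k) - P 0 + δ * (Q (δ * k) - Q 0) := by
      intro k
      induction k with
      | zero => intro _; simp
      | succ k ih =>
        intro hk
        have hk' : (k : ℝ) + 1 ≤ N + 1 := by exact_mod_cast hk
        have h1 := ih (by omega)
        have h2 := h (δ * k) (δ * (k + 1)) (by positivity)
          (mul_le_mul_of_nonneg_left (by linarith) hδ0)
          ((mul_le_mul_of_nonneg_left hk' hδ0).trans hδN.le)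
        rw [show δ * (k + 1) - δ * k = δ by ring] at h2
        push_cast
        calc |D (δ * (k + 1)) - D 0|
            ≤ |D (δ * (k + 1)) - D (δ * k)| + |D (δ * k) - D 0| := abs_sub_le _ _ _
          _ ≤ _ := by linarith
    have := step (N + 1) le_rfl
    push_cast at this
    rw [hδN] at this
    calc |D T - D 0| ≤ _ := this
      _ = _ := by rw [hδ]; ring
  have hlim : Tendsto (fun N : ℕ => P T - P 0 + T * (Q T - Q 0) * (1 / ((N : ℝ) + 1))) atTop
      (𝓝 (P T - P 0)) := by
    simpa using (tendsto_one_div_add_atTop_nhds_zero_nat.const_mul (T * (Q T - Q 0))).const_add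
      (P T - P 0)
  exact ge_of_tendsto' hlim key

/-- Quadratic Taylor bound for a function with Lipschitz derivative. -/
theorem abs_taylor_le {f : E d → ℝ} {C : ℝ≥0} (hf : Differentiable ℝ f)
    (hC : LipschitzWith C (fderiv ℝ f)) (x c : E d) :
    |f (x + c) - f x - fderiv ℝ f x c| ≤ C * ‖c‖ ^ 2 := by
  have := Convex.norm_image_sub_le_of_norm_hasFDerivWithin_le' (𝕜 := ℝ) (f := f)
    (f' := fderiv ℝ f) (s := segment ℝ x (x + c)) (x := x) (y := x + c) (φ := fderiv ℝ f x)
    (C := C * ‖c‖) (fun y _ => (hf y).hasFDerivAt.hasFDerivWithinAt) (fun y hy => ?_)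
    (convex_segment _ _) (left_mem_segment _ _ _) (right_mem_segment _ _ _)
  · rw [add_sub_cancel_left] at this
    rw [pow_two, ← mul_assoc]; exact this
  · refine (hC.norm_sub_le _ _).trans (mul_le_mul_of_nonneg_left ?_ C.2)
    have := norm_sub_le_of_mem_segment hy
    simpa using this

/-- One step of the duality argument: error of the mollified backward transport over `[s,t]`. -/
theorem abs_mollify_flow_sub_le {K Λ C : ℝ≥0} {w : E d → ℝ → E d} (hw : BddLip K w)
    (φ : ContDiffBump (0 : E d)) {g : E d → ℝ} (hg : LipschitzWith Λ g)
    (hC : LipschitzWith C (fderiv ℝ (mollify φ g))) {s t : ℝ} (hs : 0 ≤ s) (hst : s ≤ t)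
    (ht : t ≤ 1) (x : E d) :
    |mollify φ g x - mollify φ (fun y => g (flow w s y t)) x +
        fderiv ℝ (mollify φ g) x (∫ r in s..t, w x r)| ≤
      Λ * K * φ.rOut * (t - s) + (Λ * K ^ 2 + C * K ^ 2) * (t - s) ^ 2 := by
  set c := ∫ r in s..t, w x r
  have hts : 0 ≤ t - s := sub_nonneg.2 hst
  have hcn : ‖c‖ ≤ K * (t - s) := by
    simpa [abs_of_nonneg hts] using hw.norm_integral_le (fun _ => x) s t
  have hZ : Continuous fun y => flow w s y t := by
    refine LipschitzWith.continuous (K := (Real.exp K).toNNReal) (LipschitzWith.of_dist_le_mul ?_)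
    intro y z
    rw [Real.coe_toNNReal _ (Real.exp_nonneg _), mul_comm, dist_eq_norm, dist_eq_norm]
    exact hw.norm_flow_sub_le hs hst ht y z
  have h1 : |mollify φ (fun y => g (flow w s y t)) x - mollify φ g (x + c)| ≤
      Λ * (K * (φ.rOut + K * (t - s)) * (t - s)) := by
    refine abs_mollify_comp_sub_le φ hg hZ fun y hy => ?_
    have hc := hw.continuous_flow_right s y
    rw [hw.flow_eq hs hst ht, add_sub_add_left_eq_sub, ← intervalIntegral.integral_sub
      (hw.intervalIntegrable hc.continuousOn) (hw.intervalIntegrable (y := fun _ => x)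
        continuousOn_const)]
    have : ∀ r ∈ uIoc s t, ‖w (flow w s y r) r - w x r‖ ≤ K * (φ.rOut + K * (t - s)) := by
      intro r hr
      rw [uIoc_of_le hst] at hr
      refine ((hw.lip r).norm_sub_le _ _).trans (mul_le_mul_of_nonneg_left ?_ K.2)
      have e1 := hw.norm_flow_sub_self_le hs hr.1.le (hr.2.trans ht) y
      have e2 : ‖y - x‖ ≤ φ.rOut := by rw [← dist_eq_norm]; exact (Metric.mem_ball.1 hy).le
      have e3 : (K : ℝ) * (r - s) ≤ K * (t - s) :=
        mul_le_mul_of_nonneg_left (by linarith [hr.2]) K.2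
      calc ‖flow w s y r - x‖ ≤ ‖flow w s y r - y‖ + ‖y - x‖ :=
            norm_sub_le_norm_sub_add_norm_sub _ _ _
        _ ≤ _ := by linarith
    refine (intervalIntegral.norm_integral_le_of_norm_le_const this).trans ?_
    rw [abs_of_nonneg hts]
  have h2 := abs_taylor_le ((contDiff_mollify φ hg.continuous).differentiable (by simp)) hC x c
  have h3 : (C : ℝ) * ‖c‖ ^ 2 ≤ C * (K * (t - s)) ^ 2 := by gcongr
  have e : mollify φ g x - mollify φ (fun y => g (flow w s y t)) x + fderiv ℝ (mollify φ g) x c =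
      -(mollify φ (fun y => g (flow w s y t)) x - mollify φ g (x + c)) -
      (mollify φ g (x + c) - mollify φ g x - fderiv ℝ (mollify φ g) x c) := by ring
  rw [e]
  refine (abs_sub _ _).trans ?_
  rw [abs_neg]
  nlinarith

theorem abs_integral_le_of_abs_le {ν : Measure (E d)} [IsProbabilityMeasure ν] {f : E d → ℝ} {C : ℝ}
    (h : ∀ x, |f x| ≤ C) : |∫ x, f x ∂ν| ≤ C := by
  have := norm_integral_le_of_norm_le_const (μ := ν) (f := f) (Eventually.of_forall h)
  rwa [probReal_univ, mul_one] at this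

/-- The increment of `∫ θ G dρ` over `[s,t]` is, up to a second-order error, given by transporting
`G` with the field `w`, which agrees with `v` where the cutoff `θ` is supported. The gradient of the
cutoff is charged to the total speed of the curve. -/
theorem CRhoV.abs_integral_cutoff_mul_sub_le {μ : Measure (E d)} {ρ : ℝ → Measure (E d)}
    {v w : E d → ℝ → E d} (h : CRhoV μ ρ v) {m : ℝ → ℝ} (hm0 : ∀ t, 0 ≤ m t)
    (hmi : IntervalIntegrable m volume 0 1)
    (hm : ∀ (f : E d → ℝ) (L : ℝ≥0) (M : ℝ), LipschitzWith L f → (∀ x, |f x| ≤ M) →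
        ∀ s t : ℝ, 0 ≤ s → s ≤ t → t ≤ 1 →
          |∫ x, f x ∂(ρ t) - ∫ x, f x ∂(ρ s)| ≤ L * ∫ r in s..t, m r)
    {K Λ C Lθ : ℝ≥0} (hw : BddLip K w) {θ : E d → ℝ} (hθ : ContDiff ℝ ∞ θ)
    (hθc : HasCompactSupport θ) (hθ1 : ∀ x, |θ x| ≤ 1) (hθL : LipschitzWith Lθ θ)
    (hwv : ∀ t ∈ Icc (0 : ℝ) 1, ∀ x, θ x ≠ 0 → w x t = v x t)
    {G : E d → ℝ} (hG : ContDiff ℝ ∞ G) {M : ℝ≥0} (hGM : ∀ x, |G x| ≤ M) (hGL : LipschitzWith Λ G)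
    (hGC : LipschitzWith C (fderiv ℝ G)) {s t : ℝ} (hs : 0 ≤ s) (hst : s ≤ t) (ht : t ≤ 1) :
    |∫ x, θ x * G x ∂(ρ t) - ∫ x, θ x * G x ∂(ρ s) -
        ∫ x, θ x * fderiv ℝ G x (∫ r in s..t, w x r) ∂(ρ s)| ≤
      M * Lθ * (∫ r in s..t, ∫ x, ‖v x r‖ ∂(ρ r)) +
        (Lθ * Λ * K + C * K + Λ * K) * (t - s) * ∫ r in s..t, m r := by
  have hts : 0 ≤ t - s := sub_nonneg.2 hst
  have hs01 : s ∈ Icc (0 : ℝ) 1 := ⟨hs, hst.trans ht⟩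
  have ht01 : t ∈ Icc (0 : ℝ) 1 := ⟨hs.trans hst, ht⟩
  have hps := (h.curve.1 s hs01).1
  have hsub : uIcc s t ⊆ uIcc (0 : ℝ) 1 := by
    rw [uIcc_of_le hst, uIcc_of_le zero_le_one]; exact Icc_subset_Icc hs ht
  have hDG : ∀ x, ‖fderiv ℝ G x‖ ≤ Λ := fun x => norm_fderiv_le_of_lipschitz ℝ hGL
  have hDθ : ∀ x, ‖fderiv ℝ θ x‖ ≤ Lθ := fun x => norm_fderiv_le_of_lipschitz ℝ hθL
  have hDGw : ∀ x r, ‖fderiv ℝ G x (w x r)‖ ≤ Λ * K := fun x r =>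
    ((fderiv ℝ G x).le_opNorm _).trans (mul_le_mul (hDG x) (hw.bdd x r) (norm_nonneg _) Λ.2)
  have hAb : ∀ x r, |θ x * fderiv ℝ G x (w x r)| ≤ Λ * K := fun x r => by
    rw [abs_mul, ← one_mul ((Λ : ℝ) * K)]
    exact mul_le_mul (hθ1 x) (hDGw x r) (abs_nonneg _) zero_le_one
  have hAm : Measurable fun p : ℝ × E d => θ p.2 * fderiv ℝ G p.2 (w p.2 p.1) :=
    ((hθ.continuous.comp continuous_snd).measurable).mul (measurable_fderiv_apply hG hw.meas)
  obtain ⟨hA1, hA2⟩ := h.integrable_slice (g := fun r x => θ x * fderiv ℝ G x (w x r)) hAm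
    (C := Λ * K) fun r x => (hAb x r).trans
      (le_mul_of_one_le_right (by positivity) (by linarith [norm_nonneg (v x r)]))
  have hBm : Measurable fun p : ℝ × E d => G p.2 * fderiv ℝ θ p.2 (v p.2 p.1) :=
    ((hG.continuous.comp continuous_snd).measurable).mul (measurable_fderiv_apply hθ h.meas)
  have hBb : ∀ r x, ‖G x * fderiv ℝ θ x (v x r)‖ ≤ M * Lθ * ‖v x r‖ := fun r x => by
    rw [norm_mul, mul_assoc]
    refine mul_le_mul (hGM x) (((fderiv ℝ θ x).le_opNorm _).trans ?_) (norm_nonneg _) M.2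
    exact mul_le_mul_of_nonneg_right (hDθ x) (norm_nonneg _)
  obtain ⟨hB1, hB2⟩ := h.integrable_slice (g := fun r x => G x * fderiv ℝ θ x (v x r)) hBm
    (C := M * Lθ) fun r x => (hBb r x).trans
      (mul_le_mul_of_nonneg_left (by linarith) (by positivity))
  obtain ⟨hV1, hV2⟩ := h.integrable_slice (g := fun r x => ‖v x r‖)
    ((h.meas.comp measurable_swap).norm) (C := 1) fun r x => by
      rw [abs_of_nonneg (norm_nonneg _), one_mul]; linarith
  have hmem : ∀ᵐ r ∂volume.restrict (Icc (0 : ℝ) 1), r ∈ Icc (0 : ℝ) 1 :=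
    ae_restrict_mem measurableSet_Icc
  have toIoc : ∀ {p : ℝ → Prop}, (∀ᵐ r ∂volume.restrict (Icc (0 : ℝ) 1), p r) →
      ∀ᵐ r, r ∈ Ioc s t → p r := fun {p} hp => by
    rw [ae_restrict_iff' measurableSet_Icc] at hp
    filter_upwards [hp] with r hr hrI using hr ⟨hs.trans hrI.1.le, hrI.2.trans ht⟩
  -- The product rule; on the support of `θ` the field `v` is replaced by `w`.
  have e1 : ∫ x, θ x * G x ∂(ρ t) - ∫ x, θ x * G x ∂(ρ s) =
      (∫ r in s..t, ∫ x, θ x * fderiv ℝ G x (w x r) ∂(ρ r)) +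
        ∫ r in s..t, ∫ x, G x * fderiv ℝ θ x (v x r) ∂(ρ r) := by
    rw [h.integral_increment (f := fun x => θ x * G x) (hθ.mul hG) hθc.mul_right hs hst ht,
      ← intervalIntegral.integral_add (hA2.mono_set hsub) (hB2.mono_set hsub)]
    refine intervalIntegral.integral_congr_ae ?_
    rw [uIoc_of_le hst]
    filter_upwards [toIoc hA1, toIoc hB1, toIoc hmem] with r h1 h2 h3 hr
    rw [← integral_add (h1 hr) (h2 hr)]
    refine integral_congr_ae (Eventually.of_forall fun x => ?_)
    have hd : HasFDerivAt (fun x => θ x * G x) _ x :=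
      ((hθ.differentiable (by simp)) x).hasFDerivAt.mul
        ((hG.differentiable (by simp)) x).hasFDerivAt
    simp only [hd.fderiv, add_apply, smul_apply, smul_eq_mul]
    by_cases hx : θ x = 0
    · simp [hx]
    · rw [hwv r (h3 hr) x hx]
  have hAi : Integrable (Function.uncurry fun r x => θ x * fderiv ℝ G x (w x r))
      ((volume.restrict (Ioc s t)).prod (ρ s)) :=
    Integrable.of_bound hAm.aestronglyMeasurable (Λ * K) (Eventually.of_forall fun p => hAb _ _)
  have e2 : ∫ x, θ x * fderiv ℝ G x (∫ r in s..t, w x r) ∂(ρ s) =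
      ∫ r in s..t, ∫ x, θ x * fderiv ℝ G x (w x r) ∂(ρ s) := by
    rw [intervalIntegral.integral_of_le hst, integral_integral_swap hAi]
    refine integral_congr_ae (Eventually.of_forall fun x => ?_)
    simp only
    rw [integral_const_mul, ← intervalIntegral.integral_of_le hst,
      ← ContinuousLinearMap.intervalIntegral_comp_comm _
        (hw.intervalIntegrable (y := fun _ => x) continuousOn_const)]
  have hA3 : IntervalIntegrable (fun r => ∫ x, θ x * fderiv ℝ G x (w x r) ∂(ρ s)) volume s t := by
    rw [intervalIntegrable_iff, uIoc_of_le hst]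
    exact hAi.integral_prod_left
  have hM1 : 0 ≤ ∫ r in s..t, m r := intervalIntegral.integral_nonneg hst fun r _ => hm0 r
  -- Freezing the measure at time `s` costs the modulus of continuity of the curve.
  have bA : |(∫ r in s..t, ∫ x, θ x * fderiv ℝ G x (w x r) ∂(ρ r)) -
      ∫ r in s..t, ∫ x, θ x * fderiv ℝ G x (w x r) ∂(ρ s)| ≤
      (Lθ * Λ * K + C * K + Λ * K) * (t - s) * ∫ r in s..t, m r := by
    rw [← intervalIntegral.integral_sub (hA2.mono_set hsub) hA3]
    have := intervalIntegral.norm_integral_le_of_norm_le_const (a := s) (b := t)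
      (f := fun r => (∫ x, θ x * fderiv ℝ G x (w x r) ∂(ρ r)) -
        ∫ x, θ x * fderiv ℝ G x (w x r) ∂(ρ s))
      (C := (Lθ * Λ * K + C * K + Λ * K) * ∫ r in s..t, m r) fun r hr => ?_
    · rw [Real.norm_eq_abs, abs_of_nonneg hts] at this
      refine this.trans_eq (by ring)
    · rw [uIoc_of_le hst] at hr
      have hL : LipschitzWith (Lθ * Λ * K + C * K + Λ * K)
          fun x => θ x * fderiv ℝ G x (w x r) := by
        refine LipschitzWith.of_dist_le_mul fun x y => ?_
        rw [Real.dist_eq, dist_eq_norm]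
        have e : θ x * fderiv ℝ G x (w x r) - θ y * fderiv ℝ G y (w y r) =
            (θ x - θ y) * fderiv ℝ G x (w x r) +
              θ y * (fderiv ℝ G x - fderiv ℝ G y : E d →L[ℝ] ℝ) (w x r) +
              θ y * fderiv ℝ G y (w x r - w y r) := by
          simp only [sub_apply, map_sub]; ring
        have b1 : |(θ x - θ y) * fderiv ℝ G x (w x r)| ≤ Lθ * ‖x - y‖ * (Λ * K) := by
          rw [abs_mul]
          exact mul_le_mul (hθL.norm_sub_le x y) (hDGw x r) (abs_nonneg _) (by positivity)
        have b2 : |θ y * (fderiv ℝ G x - fderiv ℝ G y : E d →L[ℝ] ℝ) (w x r)| ≤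
            1 * (C * ‖x - y‖ * K) := by
          rw [abs_mul]
          refine mul_le_mul (hθ1 y) ?_ (abs_nonneg _) zero_le_one
          refine ((fderiv ℝ G x - fderiv ℝ G y).le_opNorm (w x r)).trans ?_
          exact mul_le_mul (hGC.norm_sub_le x y) (hw.bdd x r) (norm_nonneg _) (by positivity)
        have b3 : |θ y * fderiv ℝ G y (w x r - w y r)| ≤ 1 * (Λ * (K * ‖x - y‖)) := by
          rw [abs_mul]
          refine mul_le_mul (hθ1 y) ?_ (abs_nonneg _) zero_le_one
          refine ((fderiv ℝ G y).le_opNorm (w x r - w y r)).trans ?_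
          exact mul_le_mul (hDG y) ((hw.lip r).norm_sub_le x y) (norm_nonneg _) Λ.2
        rw [e]
        refine (abs_add_three _ _ _).trans ?_
        simp only [NNReal.coe_add, NNReal.coe_mul]
        linarith
      refine (hm _ _ _ hL (fun x => hAb x r) s r hs hr.1.le (hr.2.trans ht)).trans ?_
      push_cast
      refine mul_le_mul_of_nonneg_left ?_ (by positivity)
      exact intervalIntegral.integral_mono_interval le_rfl hr.1.le hr.2
        (Eventually.of_forall hm0) (hmi.mono_set hsub)
  have bB : |∫ r in s..t, ∫ x, G x * fderiv ℝ θ x (v x r) ∂(ρ r)| ≤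
      M * Lθ * ∫ r in s..t, ∫ x, ‖v x r‖ ∂(ρ r) := by
    rw [← intervalIntegral.integral_const_mul, ← Real.norm_eq_abs]
    refine intervalIntegral.norm_integral_le_of_norm_le hst ?_ ((hV2.mono_set hsub).const_mul _)
    filter_upwards [toIoc hV1] with r hr hrI
    rw [← integral_const_mul]
    exact norm_integral_le_of_norm_le ((hr hrI).const_mul _) (Eventually.of_forall (hBb r))
  rw [e1, e2]
  have := abs_add_le ((∫ r in s..t, ∫ x, θ x * fderiv ℝ G x (w x r) ∂(ρ r)) -
      ∫ r in s..t, ∫ x, θ x * fderiv ℝ G x (w x r) ∂(ρ s))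
      (∫ r in s..t, ∫ x, G x * fderiv ℝ θ x (v x r) ∂(ρ r))
  rw [add_sub_right_comm]
  linarith

/-- Duality estimate: up to the escape term, the curve integrates cut-off observables as the
transport of the initial measure by the flow of a globally Lipschitz field `w` does, when `w`
agrees with the velocity of the curve on the support of the cutoff. -/
theorem CRhoV.abs_integral_cutoff_sub_flow_le {μ : Measure (E d)} {ρ : ℝ → Measure (E d)}
    {v w : E d → ℝ → E d} (h : CRhoV μ ρ v) {K Λ Lθ : ℝ≥0} (hw : BddLip K w) {θ : E d → ℝ}
    (hθ : ContDiff ℝ ∞ θ) (hθc : HasCompactSupport θ) (hθ1 : ∀ x, |θ x| ≤ 1)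
    (hθL : LipschitzWith Lθ θ) (hwv : ∀ t ∈ Icc (0 : ℝ) 1, ∀ x, θ x ≠ 0 → w x t = v x t)
    {ψ : E d → ℝ} (hψ : LipschitzWith Λ ψ) {M : ℝ≥0} (hψM : ∀ x, |ψ x| ≤ M) {T : ℝ}
    (hT : T ∈ Icc (0 : ℝ) 1) :
    |∫ x, θ x * ψ x ∂(ρ T) - ∫ x, θ x * ψ (flow w 0 x T) ∂μ| ≤
      M * Lθ * ∫ r in (0 : ℝ)..1, ∫ x, ‖v x r‖ ∂(ρ r) := by
  obtain ⟨m, hm0, hmi, hm⟩ := h.curve.exists_modulus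
  obtain ⟨hV1, hV2⟩ := h.integrable_slice (g := fun r x => ‖v x r‖)
    ((h.meas.comp measurable_swap).norm) (C := 1) fun r x => by
      rw [abs_of_nonneg (norm_nonneg _), one_mul]; linarith
  set V : ℝ → ℝ := fun r => ∫ x, ‖v x r‖ ∂(ρ r)
  have hV0 : ∀ r, 0 ≤ V r := fun r => integral_nonneg fun _ => norm_nonneg _
  set g : ℝ → E d → ℝ := fun t x => ψ (flow w t x T) with hgdef
  set Λ' : ℝ≥0 := Λ * (Real.exp K).toNNReal with hΛ'
  have hgL : ∀ t, 0 ≤ t → t ≤ T → LipschitzWith Λ' (g t) := fun t ht htT => by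
    refine hψ.comp (LipschitzWith.of_dist_le_mul fun x y => ?_)
    rw [Real.coe_toNNReal _ (Real.exp_nonneg _), mul_comm, dist_eq_norm, dist_eq_norm]
    exact hw.norm_flow_sub_le ht htT hT.2 x y
  have hgT : g T = ψ := funext fun x => by simp only [hgdef]; rw [hw.flow_self hT]
  have hg0 : ∀ x, g 0 x = ψ (flow w 0 x T) := fun x => rfl
  have hρ0 : ρ 0 = μ := h.init
  -- It suffices to bound by an arbitrarily small multiple of the mollification scale.
  refine le_of_forall_pos_le_add fun ε' hε' => ?_
  obtain ⟨ε, hε, hεle⟩ : ∃ ε : ℝ, 0 < ε ∧ (Λ' * K + 2 * Λ') * ε ≤ ε' := by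
    refine ⟨ε' / (Λ' * K + 2 * Λ' + 1), by positivity, ?_⟩
    rw [mul_div_assoc', div_le_iff₀ (by positivity)]
    nlinarith [hε'.le]
  let φ : ContDiffBump (0 : E d) := ⟨ε / 2, ε, by positivity, by linarith⟩
  have hφε : φ.rOut = ε := rfl
  obtain ⟨C, hC⟩ := exists_lipschitzWith_fderiv_mollify φ Λ'
  have hprob : ∀ t ∈ Icc (0 : ℝ) 1, IsProbabilityMeasure (ρ t) := fun t ht => (h.curve.1 t ht).1
  have hθi : ∀ t ∈ Icc (0 : ℝ) 1, ∀ f : E d → ℝ, Continuous f → (∃ B, ∀ x, |f x| ≤ B) →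
      Integrable (fun x => θ x * f x) (ρ t) := fun t ht f hf ⟨B, hB⟩ => by
    have := hprob t ht
    refine Integrable.of_bound (hθ.continuous.mul hf).aestronglyMeasurable B
      (Eventually.of_forall fun x => ?_)
    rw [norm_mul, ← one_mul B]
    exact mul_le_mul (hθ1 x) (hB x) (norm_nonneg _) zero_le_one
  have hmb : ∀ t x, |mollify φ (g t) x| ≤ M := fun t x => abs_mollify_le φ (fun x => hψM _) x
  have hgc : ∀ t, 0 ≤ t → t ≤ T → Continuous (g t) := fun t h1 h2 => (hgL t h1 h2).continuous
  have hmc : ∀ t, 0 ≤ t → t ≤ T → ContDiff ℝ ∞ (mollify φ (g t)) := fun t h1 h2 =>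
    contDiff_mollify φ (hgc t h1 h2)
  set C1 : ℝ := Lθ * Λ' * K + C * K + Λ' * K
  have hC1 : 0 ≤ C1 := by positivity
  -- `P` collects the escape term and the mollification error, `Q` the errors of second order.
  have hmain := abs_sub_le_of_forall_abs_sub_le (D := fun t => ∫ x, θ x * mollify φ (g t) x ∂(ρ t))
    (P := fun t => M * Lθ * (∫ r in (0 : ℝ)..t, V r) + Λ' * K * ε * t)
    (Q := fun t => C1 * (∫ r in (0 : ℝ)..t, m r) + (Λ' * K ^ 2 + C * K ^ 2) * t) hT.1 ?_
  · simp only [intervalIntegral.integral_same, mul_zero, add_zero, sub_zero] at hmain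
    rw [hgT, hρ0] at hmain
    have approx : ∀ t (ht : 0 ≤ t) (htT : t ≤ T),
        |∫ x, θ x * mollify φ (g t) x ∂(ρ t) - ∫ x, θ x * g t x ∂(ρ t)| ≤ Λ' * ε := by
      intro t ht htT
      have htI : t ∈ Icc (0 : ℝ) 1 := ⟨ht, htT.trans hT.2⟩
      have := hprob t htI
      rw [← integral_sub (hθi t htI _ (hmc t ht htT).continuous ⟨M, hmb t⟩)
        (hθi t htI _ (hgc t ht htT) ⟨M, fun x => hψM _⟩)]
      refine abs_integral_le_of_abs_le fun x => ?_
      rw [← mul_sub, abs_mul, ← one_mul ((Λ' : ℝ) * ε)]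
      exact mul_le_mul (hθ1 x) (abs_mollify_sub_le φ (hgL t ht htT) x) (abs_nonneg _) zero_le_one
    have a1 := approx T hT.1 le_rfl
    have a0 := approx 0 le_rfl hT.1
    rw [hgT] at a1
    rw [hρ0] at a0
    simp only [hg0] at a0
    have hVT : ∫ r in (0 : ℝ)..T, V r ≤ ∫ r in (0 : ℝ)..1, V r :=
      intervalIntegral.integral_mono_interval le_rfl hT.1 hT.2 (Eventually.of_forall hV0) hV2
    have hVT' : (M : ℝ) * Lθ * (∫ r in (0 : ℝ)..T, V r) ≤ M * Lθ * ∫ r in (0 : ℝ)..1, V r :=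
      mul_le_mul_of_nonneg_left hVT (by positivity)
    have hKT : (Λ' : ℝ) * K * ε * T ≤ Λ' * K * ε := mul_le_of_le_one_right (by positivity) hT.2
    rw [abs_le] at *
    constructor <;> linarith [a1.1, a1.2, a0.1, a0.2, hmain.1, hmain.2]
  · intro s t hs hst htT
    have ht1 : t ≤ 1 := htT.trans hT.2
    have hsI : s ∈ Icc (0 : ℝ) 1 := ⟨hs, hst.trans ht1⟩
    have htI : t ∈ Icc (0 : ℝ) 1 := ⟨hs.trans hst, ht1⟩
    have hps := hprob s hsI
    have h0t := hs.trans hst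
    have hts : 0 ≤ t - s := sub_nonneg.2 hst
    have b1 := h.abs_integral_cutoff_mul_sub_le hm0 hmi hm hw hθ hθc hθ1 hθL hwv
      (hmc t h0t htT) (hmb t) (lipschitzWith_mollify φ (hgL t h0t htT)) (hC _ (hgL t h0t htT))
      hs hst ht1
    -- The increment is the sum of one of the curve and one of the observable.
    have hgs : g s = fun y => g t (flow w s y t) := funext fun y => by
      simp only [hgdef]; rw [hw.flow_flow hs hst htT hT.2]
    have hcint : Continuous fun x => ∫ r in s..t, w x r := by
      refine LipschitzWith.continuous (K := K * (t - s).toNNReal)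
        (LipschitzWith.of_dist_le_mul fun x y => ?_)
      rw [dist_eq_norm, ← intervalIntegral.integral_sub
        (hw.intervalIntegrable (y := fun _ => x) continuousOn_const)
        (hw.intervalIntegrable (y := fun _ => y) continuousOn_const)]
      refine (intervalIntegral.norm_integral_le_of_norm_le_const
        (fun r _ => (hw.lip r).norm_sub_le x y)).trans_eq ?_
      rw [abs_of_nonneg hts, NNReal.coe_mul, Real.coe_toNNReal _ hts, dist_eq_norm]; ring
    have hDc : Continuous fun x => fderiv ℝ (mollify φ (g t)) x (∫ r in s..t, w x r) :=
      ((hmc t h0t htT).continuous_fderiv (by simp)).clm_apply hcint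
    have hDb : ∀ x, |fderiv ℝ (mollify φ (g t)) x (∫ r in s..t, w x r)| ≤ Λ' * (K * (t - s)) := by
      intro x
      refine ((fderiv ℝ (mollify φ (g t)) x).le_opNorm _).trans ?_
      refine mul_le_mul (norm_fderiv_le_of_lipschitz ℝ (lipschitzWith_mollify φ (hgL t h0t htT)))
        ?_ (norm_nonneg _) Λ'.2
      simpa [abs_of_nonneg hts] using hw.norm_integral_le (fun _ => x) s t
    have i1 := hθi s hsI _ (hmc t h0t htT).continuous ⟨M, hmb t⟩
    have i2 := hθi s hsI _ (hmc s hs (hst.trans htT)).continuous ⟨M, hmb s⟩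
    have i3 := hθi s hsI _ hDc ⟨_, hDb⟩
    have b2 : |∫ x, θ x * mollify φ (g t) x ∂(ρ s) - ∫ x, θ x * mollify φ (g s) x ∂(ρ s) +
        ∫ x, θ x * fderiv ℝ (mollify φ (g t)) x (∫ r in s..t, w x r) ∂(ρ s)| ≤
        Λ' * K * ε * (t - s) + (Λ' * K ^ 2 + C * K ^ 2) * (t - s) ^ 2 := by
      have i12 : Integrable (fun x => θ x * mollify φ (g t) x - θ x * mollify φ (g s) x) (ρ s) :=
        i1.sub i2
      rw [← integral_sub i1 i2, ← integral_add i12 i3]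
      refine abs_integral_le_of_abs_le fun x => ?_
      rw [← mul_sub, ← mul_add, abs_mul]
      have := abs_mollify_flow_sub_le hw φ (hgL t h0t htT) (hC _ (hgL t h0t htT)) hs hst ht1 x
      rw [← hgs, hφε] at this
      rw [← one_mul (Λ' * K * ε * (t - s) + (Λ' * K ^ 2 + C * K ^ 2) * (t - s) ^ 2)]
      exact mul_le_mul (hθ1 x) this (abs_nonneg _) zero_le_one
    have eV := integral_sub_primitive hV2 hsI htI
    have em := integral_sub_primitive hmi hsI htI
    rw [eV] at b1
    rw [em] at b1
    have := abs_add_le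
      (∫ x, θ x * mollify φ (g t) x ∂(ρ t) - ∫ x, θ x * mollify φ (g t) x ∂(ρ s) -
        ∫ x, θ x * fderiv ℝ (mollify φ (g t)) x (∫ r in s..t, w x r) ∂(ρ s))
      (∫ x, θ x * mollify φ (g t) x ∂(ρ s) - ∫ x, θ x * mollify φ (g s) x ∂(ρ s) +
        ∫ x, θ x * fderiv ℝ (mollify φ (g t)) x (∫ r in s..t, w x r) ∂(ρ s))
    calc |∫ x, θ x * mollify φ (g t) x ∂(ρ t) - ∫ x, θ x * mollify φ (g s) x ∂(ρ s)|
        = _ := by congr 1; ring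
      _ ≤ _ := this
      _ ≤ _ := add_le_add b1 b2
      _ = _ := by simp only [C1]; ring

/-! ### Truncated fields and uniqueness for the continuity equation -/

/-- Coordinatewise truncation to the cube `[-n,n]^d`: a nonexpansive retraction. -/
def clamp (n : ℝ) (x : E d) : E d := WithLp.toLp 2 fun i => max (-n) (min n (x i))

theorem lipschitzWith_clamp (n : ℝ) : LipschitzWith 1 (clamp n : E d → E d) := by
  refine LipschitzWith.of_dist_le_mul fun x y => ?_
  rw [NNReal.coe_one, one_mul, EuclideanSpace.dist_eq, EuclideanSpace.dist_eq]
  refine Real.sqrt_le_sqrt (Finset.sum_le_sum fun i _ => ?_)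
  refine pow_le_pow_left₀ dist_nonneg ?_ 2
  simp only [clamp, Real.dist_eq]
  refine (abs_max_sub_max_le_max _ _ _ _).trans (max_le (by simp) ?_)
  exact (abs_min_sub_min_le_max _ _ _ _).trans (max_le (by simp) le_rfl)

theorem clamp_eq_self {n : ℝ} {x : E d} (h : ‖x‖ ≤ n) : clamp n x = x := by
  ext i
  have := abs_le.1 ((PiLp.norm_apply_le x i).trans h)
  simp only [clamp]
  rw [min_eq_right this.2, max_eq_right this.1]

theorem exists_isCompact_clamp_mem (n : ℝ) : ∃ B : Set (E d), IsCompact B ∧ ∀ x, clamp n x ∈ B := by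
  refine ⟨WithLp.toLp 2 '' Set.pi univ fun _ => Icc (min (-n) n) (max (-n) n),
    (isCompact_univ_pi fun _ => isCompact_Icc).image (PiLp.continuous_toLp 2 _), fun x => ?_⟩
  refine ⟨_, fun i _ => ⟨(min_le_left _ _).trans (le_max_left _ _), ?_⟩, rfl⟩
  exact max_le_max le_rfl (min_le_left _ _)

/-- The field `v`, made globally Lipschitz by truncating the space variable, and switched off
outside the time interval `[0,1]`. -/
def truncField (v : E d → ℝ → E d) (n : ℕ) (x : E d) (t : ℝ) : E d :=
  (Icc (0 : ℝ) 1).indicator (v (clamp n x)) t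

theorem truncField_eq {v : E d → ℝ → E d} {n : ℕ} {x : E d} {t : ℝ} (hx : ‖x‖ ≤ n)
    (ht : t ∈ Icc (0 : ℝ) 1) : truncField v n x t = v x t := by
  rw [truncField, indicator_of_mem ht, clamp_eq_self hx]

theorem CV.exists_bddLip {v : E d → ℝ → E d} (hv : CV v)
    (hm : Measurable fun p : E d × ℝ => v p.1 p.2) (n : ℕ) : ∃ K, BddLip K (truncField v n) := by
  obtain ⟨B, hB, hBn⟩ := exists_isCompact_clamp_mem (d := d) n
  obtain ⟨K, hK⟩ := hv B hB
  refine ⟨K, ?_, fun x t => ?_, fun t => ?_⟩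
  · have e : (fun p : E d × ℝ => truncField v n p.1 p.2) =
        (Prod.snd ⁻¹' Icc (0 : ℝ) 1).indicator fun p => v (clamp n p.1) p.2 := by
      ext p; simp [truncField, indicator]
    rw [e]
    refine Measurable.indicator ?_ (measurable_snd measurableSet_Icc)
    exact hm.comp (((lipschitzWith_clamp (n : ℝ)).continuous.measurable.comp
      measurable_fst).prodMk measurable_snd)
  · by_cases ht : t ∈ Icc (0 : ℝ) 1
    · rw [truncField, indicator_of_mem ht]; exact (hK t ht).1 _ (hBn x)
    · rw [truncField, indicator_of_notMem ht, norm_zero]; exact K.2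
  · by_cases ht : t ∈ Icc (0 : ℝ) 1
    · simp only [truncField, indicator_of_mem ht]
      refine LipschitzWith.of_dist_le_mul fun x y => ?_
      refine ((hK t ht).2.dist_le_mul _ (hBn x) _ (hBn y)).trans ?_
      have := (lipschitzWith_clamp (n : ℝ)).dist_le_mul x y
      rw [NNReal.coe_one, one_mul] at this
      gcongr
    · simp only [truncField, indicator_of_notMem ht]; exact LipschitzWith.const' _

theorem eqOn_flow_truncField {v : E d → ℝ → E d} {n : ℕ} {K : ℝ≥0} (hw : BddLip K (truncField v n))
    {T : ℝ} (hT : T ≤ 1) {x : E d} {y : ℝ → E d} (hy : ContinuousOn y (Icc 0 T))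
    (hyn : ∀ t ∈ Icc 0 T, ‖y t‖ ≤ n)
    (h : ∀ t ∈ Icc 0 T, y t = x + ∫ r in (0 : ℝ)..t, v (y r) r) :
    EqOn y (flow (truncField v n) 0 x) (Icc 0 T) := by
  refine hw.eqOn_flow le_rfl hT hy fun t ht => ?_
  rw [h t ht]
  congr 1
  refine intervalIntegral.integral_congr fun r hr => ?_
  rw [uIcc_of_le ht.1] at hr
  exact (truncField_eq (hyn r ⟨hr.1, hr.2.trans ht.2⟩) ⟨hr.1, hr.2.trans (ht.2.trans hT)⟩).symm

theorem flow_truncField_eq {v : E d → ℝ → E d} {n : ℕ} {K : ℝ≥0} (hw : BddLip K (truncField v n))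
    {T : ℝ} (hT : T ≤ 1) {x : E d} (hn : ∀ t ∈ Icc 0 T, ‖flow (truncField v n) 0 x t‖ ≤ n) :
    ∀ t ∈ Icc 0 T, flow (truncField v n) 0 x t =
      x + ∫ r in (0 : ℝ)..t, v (flow (truncField v n) 0 x r) r := by
  intro t ht
  rw [hw.flow_eq le_rfl ht.1 (ht.2.trans hT)]
  congr 1
  refine intervalIntegral.integral_congr fun r hr => ?_
  rw [uIcc_of_le ht.1] at hr
  exact truncField_eq (hn r ⟨hr.1, hr.2.trans ht.2⟩) ⟨hr.1, hr.2.trans (ht.2.trans hT)⟩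

/-- Smooth cutoffs at scale `k + 1` with gradient of size `O(1 / (k + 1))`. -/
theorem exists_cutoff (d : ℕ) : ∃ (C : ℝ≥0) (θ : ℕ → E d → ℝ), ∀ k, ContDiff ℝ ∞ (θ k) ∧
    HasCompactSupport (θ k) ∧ (∀ x, 0 ≤ θ k x ∧ θ k x ≤ 1) ∧
    LipschitzWith (C * ((k : ℝ≥0) + 1)⁻¹) (θ k) ∧
    (∀ x, ‖x‖ ≤ k + 1 → θ k x = 1) ∧ ∀ x, θ k x ≠ 0 → ‖x‖ ≤ (2 * (k + 1) : ℕ) := by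
  let f : ContDiffBump (0 : E d) := ⟨1, 2, one_pos, one_lt_two⟩
  obtain ⟨C, hC⟩ := (f.contDiff (n := 1)).lipschitzWith_of_hasCompactSupport
    f.hasCompactSupport one_ne_zero
  refine ⟨C, fun k x => f (((k : ℝ) + 1)⁻¹ • x), fun k => ?_⟩
  have hk : (0 : ℝ) < k + 1 := by positivity
  have hn : ∀ x : E d, ‖((k : ℝ) + 1)⁻¹ • x‖ = ((k : ℝ) + 1)⁻¹ * ‖x‖ := fun x => by
    rw [norm_smul, Real.norm_of_nonneg (by positivity)]
  refine ⟨f.contDiff.comp (contDiff_const_smul _), ?_, fun x => ⟨f.nonneg, f.le_one⟩, ?_,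
    fun x hx => ?_, fun x hx => ?_⟩
  · exact f.hasCompactSupport.comp_homeomorph (Homeomorph.smulOfNeZero _ (inv_ne_zero hk.ne'))
  · refine hC.comp (LipschitzWith.of_dist_le_mul fun x y => ?_)
    rw [dist_smul₀, Real.norm_of_nonneg (by positivity)]
    simp
  · refine f.one_of_mem_closedBall ?_
    rw [mem_closedBall_zero_iff, hn, inv_mul_le_iff₀ hk]
    exact hx.trans_eq (mul_one _).symm
  · have : ((k : ℝ) + 1)⁻¹ • x ∈ Function.support f := hx
    rw [f.support_eq, mem_ball_zero_iff, hn, inv_mul_lt_iff₀ hk] at this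
    push_cast
    linarith [this]

/-- Closed sets suffice by inner regularity. -/
theorem le_of_forall_isClosed_le {ν ρ : Measure (E d)} [IsFiniteMeasure ν]
    (h : ∀ F, IsClosed F → ν F ≤ ρ F) : ν ≤ ρ := by
  refine Measure.le_iff.2 fun s hs => ?_
  rw [hs.measure_eq_iSup_isClosed_of_ne_top (measure_ne_top _ _)]
  exact iSup₂_le fun F hF => iSup_le fun hFc => (h F hFc).trans (measure_mono hF)

theorem le_of_forall_integral_le {ν ρ : Measure (E d)} [IsFiniteMeasure ν] [IsFiniteMeasure ρ]
    (h : ∀ (ψ : E d → ℝ) (L : ℝ≥0), LipschitzWith L ψ → (∀ x, 0 ≤ ψ x ∧ ψ x ≤ 1) →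
      ∫ x, ψ x ∂ν ≤ ∫ x, ψ x ∂ρ) : ν ≤ ρ := by
  refine le_of_forall_isClosed_le fun F hF => ?_
  have hδ : ∀ n : ℕ, (0 : ℝ) < 1 / (n + 1) := fun n => Nat.one_div_pos_of_nat
  have hlim := fun (κ : Measure (E d)) (_ : IsFiniteMeasure κ) =>
    tendsto_integral_thickenedIndicator_of_isClosed κ hF hδ tendsto_one_div_add_atTop_nhds_zero_nat
  have := le_of_tendsto_of_tendsto' (hlim ν inferInstance) (hlim ρ inferInstance) fun n =>
    h _ _ (lipschitzWith_thickenedIndicator (hδ n) F) fun x =>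
      ⟨NNReal.coe_nonneg _, by exact_mod_cast thickenedIndicator_le_one (hδ n) F x⟩
  exact (ENNReal.toReal_le_toReal (measure_ne_top _ _) (measure_ne_top _ _)).1 this

/-- Mass carried by trajectories that are eventually captured by the truncated flows is carried by
the curve. -/
theorem CRhoV.map_le {μ : Measure (E d)} [IsProbabilityMeasure μ] {ρ : ℝ → Measure (E d)}
    {v : E d → ℝ → E d} (h : CRhoV μ ρ v) (hv : CV v) {T : ℝ} (hT : T ∈ Icc (0 : ℝ) 1)
    {A : Set (E d)} {Z : E d → E d} (hZ : AEMeasurable Z (μ.restrict A))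
    (hZA : ∀ᵐ x ∂μ.restrict A, ∀ᶠ n : ℕ in atTop, flow (truncField v n) 0 x T = Z x) :
    (μ.restrict A).map Z ≤ ρ T := by
  have hρT := (h.curve.1 T hT).1
  obtain ⟨C, θ, hθ⟩ := exists_cutoff d
  set V : ℝ := ∫ r in (0 : ℝ)..1, ∫ x, ‖v x r‖ ∂(ρ r)
  refine le_of_forall_integral_le fun ψ L hψ hψ1 => ?_
  rw [integral_map hZ hψ.continuous.aestronglyMeasurable]
  set N : ℕ → ℕ := fun k => 2 * (k + 1)
  have hN : Tendsto N atTop atTop := by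
    refine tendsto_atTop_mono (fun k => ?_) tendsto_id
    simp only [N, id]; omega
  have hψa : ∀ x, |ψ x| ≤ (1 : ℝ≥0) := fun x => by
    rw [abs_of_nonneg (hψ1 x).1]; simpa using (hψ1 x).2
  have hle1 : ∀ k (y z : E d), ‖θ k y * ψ z‖ ≤ 1 := fun k y z => by
    rw [norm_mul, ← one_mul (1 : ℝ), Real.norm_of_nonneg ((hθ k).2.2.1 y).1,
      Real.norm_of_nonneg (hψ1 z).1]
    exact mul_le_mul ((hθ k).2.2.1 y).2 (hψ1 z).2 (hψ1 z).1 zero_le_one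
  have hfc : ∀ k, Continuous fun x => flow (truncField v (N k)) 0 x T := fun k => by
    obtain ⟨K, hK⟩ := hv.exists_bddLip h.meas (N k)
    exact (hK.lipschitzWith_flow T).continuous
  have hcont : ∀ k, Continuous fun x => θ k x * ψ (flow (truncField v (N k)) 0 x T) := fun k =>
    (hθ k).1.continuous.mul (hψ.continuous.comp (hfc k))
  have bound : ∀ k : ℕ, ∫ x in A, θ k x * ψ (flow (truncField v (N k)) 0 x T) ∂μ ≤
      ∫ x, ψ x ∂(ρ T) + C * V * (1 / ((k : ℝ) + 1)) := by
    intro k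
    obtain ⟨K, hK⟩ := hv.exists_bddLip h.meas (N k)
    obtain ⟨h1, h2, h3, h4, h5, h6⟩ := hθ k
    have key := h.abs_integral_cutoff_sub_flow_le hK h1 h2
      (fun x => by rw [abs_of_nonneg (h3 x).1]; exact (h3 x).2) h4
      (fun t ht x hx => truncField_eq (h6 x hx) ht) hψ hψa hT
    have e1 : ∫ x in A, θ k x * ψ (flow (truncField v (N k)) 0 x T) ∂μ ≤
        ∫ x, θ k x * ψ (flow (truncField v (N k)) 0 x T) ∂μ :=
      setIntegral_le_integral (Integrable.of_bound (hcont k).aestronglyMeasurable 1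
        (Eventually.of_forall fun x => hle1 k _ _))
        (Eventually.of_forall fun x => mul_nonneg (h3 x).1 (hψ1 _).1)
    have e2 : ∫ x, θ k x * ψ x ∂(ρ T) ≤ ∫ x, ψ x ∂(ρ T) := by
      refine integral_mono (Integrable.of_bound
        (h1.continuous.mul hψ.continuous).aestronglyMeasurable 1
        (Eventually.of_forall fun x => hle1 k _ _)) (Integrable.of_bound
        hψ.continuous.aestronglyMeasurable 1 (Eventually.of_forall fun x => hψa x)) fun x => ?_
      exact mul_le_of_le_one_left (hψ1 x).1 (h3 x).2
    have e3 := (abs_le.1 key).1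
    push_cast at e3
    have e4 : (1 : ℝ) * (C * ((k : ℝ) + 1)⁻¹) * V = C * V * (1 / ((k : ℝ) + 1)) := by
      rw [one_div]; ring
    rw [e4] at e3
    linarith
  have hlim : Tendsto (fun k => ∫ x in A, θ k x * ψ (flow (truncField v (N k)) 0 x T) ∂μ) atTop
      (𝓝 (∫ x in A, ψ (Z x) ∂μ)) := by
    refine tendsto_integral_of_dominated_convergence (fun _ => 1)
      (fun k => (hcont k).aestronglyMeasurable) (integrable_const _)
      (fun k => Eventually.of_forall fun x => hle1 k _ _) ?_
    filter_upwards [hZA] with x hx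
    refine tendsto_const_nhds.congr' ?_
    filter_upwards [hN.eventually hx, eventually_ge_atTop ⌈‖x‖⌉₊] with k hk hkx
    have hkx' : ‖x‖ ≤ k + 1 := by
      have := Nat.ceil_le.1 hkx
      linarith
    rw [hk, (hθ k).2.2.2.2.1 x hkx', one_mul]
  have hlim2 : Tendsto (fun k : ℕ => ∫ x, ψ x ∂(ρ T) + C * V * (1 / ((k : ℝ) + 1))) atTop
      (𝓝 (∫ x, ψ x ∂(ρ T))) := by
    simpa using (tendsto_one_div_add_atTop_nhds_zero_nat.const_mul (C * V)).const_add
      (∫ x, ψ x ∂(ρ T))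
  exact le_of_tendsto_of_tendsto' hlim hlim2 bound

/-- A family of global trajectories of the velocity field transports the initial measure along the
curve. -/
theorem CRhoV.pushCurve_eq {μ : Measure (E d)} [IsProbabilityMeasure μ] {ρ : ℝ → Measure (E d)}
    {v : E d → ℝ → E d} (h : CRhoV μ ρ v) (hv : CV v) {X : E d → ℝ → E d}
    (hX : ∀ᵐ x ∂μ, ContinuousOn (X x) (Icc 0 1) ∧
      ∀ t ∈ Icc (0 : ℝ) 1, X x t = x + ∫ r in (0 : ℝ)..t, v (X x r) r)
    {t : ℝ} (ht : t ∈ Icc (0 : ℝ) 1) : pushCurve μ X t = ρ t := by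
  have hev : ∀ᵐ x ∂μ, ∀ᶠ n : ℕ in atTop, flow (truncField v n) 0 x t = X x t := by
    filter_upwards [hX] with x hx
    obtain ⟨R, hR⟩ := isCompact_Icc.exists_bound_of_continuousOn hx.1
    filter_upwards [eventually_ge_atTop ⌈R⌉₊] with n hn
    obtain ⟨K, hK⟩ := hv.exists_bddLip h.meas n
    exact (eqOn_flow_truncField hK le_rfl hx.1
      (fun s hs => (hR s hs).trans (Nat.ceil_le.1 hn)) hx.2 ht).symm
  have hm : AEMeasurable (fun x => X x t) μ := by
    refine aemeasurable_of_tendsto_metrizable_ae atTop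
      (f := fun n x => flow (truncField v n) 0 x t) (fun n => ?_) ?_
    · obtain ⟨K, hK⟩ := hv.exists_bddLip h.meas n
      exact (hK.lipschitzWith_flow t).continuous.aemeasurable
    · filter_upwards [hev] with x hx
      exact tendsto_const_nhds.congr' (hx.mono fun n hn => hn.symm)
  have hρ := (h.curve.1 t ht).1
  have hp : IsProbabilityMeasure (μ.map fun x => X x t) := Measure.isProbabilityMeasure_map hm
  have := h.map_le hv ht (A := univ) (Z := fun x => X x t) (by simpa using hm)
    (by simpa using hev)
  rw [Measure.restrict_univ] at this
  change μ.map (fun x => X x t) = ρ t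
  exact Measure.eq_of_le_of_isProbabilityMeasure this

/-! ### Existence of characteristics -/

/-- The trajectory of `x` under the `n`-th truncated flow stays in the ball of radius `n` up to
time `t`. -/
def staysIn (v : E d → ℝ → E d) (n : ℕ) : Set (E d × ℝ) :=
  {p | ∀ r ∈ Icc (0 : ℝ) 1, ‖flow (truncField v n) 0 p.1 (r * p.2)‖ ≤ n}

theorem isClosed_staysIn {v : E d → ℝ → E d} {n : ℕ} {K : ℝ≥0} (hw : BddLip K (truncField v n)) :
    IsClosed (staysIn v n) := by
  simp only [staysIn, ofPred_forall]
  refine isClosed_iInter fun r => isClosed_iInter fun _ => isClosed_le ?_ continuous_const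
  have : Continuous fun p : E d × ℝ => (p.1, r * p.2) := by fun_prop
  exact (hw.continuous_flow.comp this).norm

theorem norm_flow_le_of_mem_staysIn {v : E d → ℝ → E d} {n : ℕ} {x : E d} {t : ℝ}
    (h : (x, t) ∈ staysIn v n) {s : ℝ} (hs : s ∈ Icc 0 t) :
    ‖flow (truncField v n) 0 x s‖ ≤ n := by
  rcases hs.1.eq_or_lt with rfl | h0
  · simpa using h 0 ⟨le_rfl, zero_le_one⟩
  · have ht : 0 < t := h0.trans_le hs.2
    have := h (s / t) ⟨div_nonneg hs.1 ht.le, div_le_one_of_le₀ hs.2 ht.le⟩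
    simpa [div_mul_cancel₀ _ ht.ne'] using this

/-- Before leaving the ball of radius `n`, a trajectory has length at least `n - ‖x‖`. -/
theorem ofReal_le_lintegral_of_notMem_staysIn {v : E d → ℝ → E d} {n : ℕ} {K : ℝ≥0}
    (hw : BddLip K (truncField v n)) {x : E d} (hx : (x, 1) ∉ staysIn v n) :
    ENNReal.ofReal (n - ‖x‖) ≤ ∫⁻ t in Icc (0 : ℝ) 1, (staysIn v n).indicator
      (fun p => ‖v (flow (truncField v n) 0 p.1 p.2) p.2‖ₑ) (x, t) := by
  set y := flow (truncField v n) 0 x with hy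
  have hyc : Continuous y := hw.continuous_flow_right 0 x
  obtain ⟨s, hs, hsn⟩ : ∃ s ∈ Icc (0 : ℝ) 1, (n : ℝ) < ‖y s‖ := by
    by_contra! hcon
    exact hx fun r hr => by simpa using hcon r hr
  have hQ : IsCompact {t ∈ Icc (0 : ℝ) s | (n : ℝ) ≤ ‖y t‖} :=
    isCompact_Icc.inter_right (isClosed_le continuous_const hyc.norm)
  obtain ⟨τ, ⟨hτ, hτn⟩, hmin⟩ := hQ.exists_isLeast ⟨s, ⟨hs.1, le_rfl⟩, hsn.le⟩
  have hbelow : ∀ t, 0 ≤ t → t < τ → ‖y t‖ ≤ n := fun t h0 h1 => by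
    by_contra! hcon
    exact absurd (hmin ⟨⟨h0, h1.le.trans hτ.2⟩, hcon.le⟩) (not_le.2 h1)
  have hstay : ∀ t, 0 ≤ t → t < τ → (x, t) ∈ staysIn v n := fun t h0 h1 r hr =>
    hbelow _ (mul_nonneg hr.1 h0) ((mul_le_of_le_one_left h0 hr.2).trans_lt h1)
  have hflow := hw.flow_eq le_rfl hτ.1 (hτ.2.trans hs.2) x
  calc ENNReal.ofReal (n - ‖x‖) ≤ ENNReal.ofReal ‖∫ r in (0 : ℝ)..τ, truncField v n (y r) r‖ := by
        refine ENNReal.ofReal_le_ofReal ?_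
        have h1 : ∫ r in (0 : ℝ)..τ, truncField v n (y r) r = y τ - x := by
          rw [hy, hflow, add_sub_cancel_left, ← hy]
        rw [h1]
        linarith [norm_sub_norm_le (y τ) x]
    _ = ‖∫ r in Ioo 0 τ, truncField v n (y r) r‖ₑ := by
        rw [ofReal_norm, intervalIntegral.integral_of_le hτ.1, integral_Ioc_eq_integral_Ioo]
    _ ≤ ∫⁻ r in Ioo 0 τ, ‖truncField v n (y r) r‖ₑ := enorm_integral_le_lintegral_enorm _
    _ = ∫⁻ r in Ioo 0 τ, (staysIn v n).indicator
          (fun p => ‖v (flow (truncField v n) 0 p.1 p.2) p.2‖ₑ) (x, r) := by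
        refine setLIntegral_congr_fun measurableSet_Ioo fun r hr => ?_
        rw [indicator_of_mem (hstay r hr.1.le hr.2), truncField_eq (hbelow r hr.1.le hr.2)
          ⟨hr.1.le, hr.2.le.trans (hτ.2.trans hs.2)⟩]
    _ ≤ _ := lintegral_mono_set (Ioo_subset_Icc_self.trans (Icc_subset_Icc_right (hτ.2.trans hs.2)))

theorem CRhoV.lintegral_speed_lt_top {μ : Measure (E d)} {ρ : ℝ → Measure (E d)}
    {v : E d → ℝ → E d} (h : CRhoV μ ρ v) :
    ∫⁻ t in Icc (0 : ℝ) 1, ∫⁻ x, ‖v x t‖ₑ ∂(ρ t) < ⊤ := by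
  have hle : ∫⁻ t in Icc (0 : ℝ) 1, ∫⁻ x, ‖v x t‖ₑ ∂(ρ t) ≤
      ∫⁻ t in Icc (0 : ℝ) 1, (1 + ∫⁻ x, ‖v x t‖ₑ ^ 2 ∂(ρ t)) := by
    refine setLIntegral_mono' measurableSet_Icc fun t ht => ?_
    have := (h.curve.1 t ht).1
    calc ∫⁻ x, ‖v x t‖ₑ ∂(ρ t) ≤ ∫⁻ x, (1 + ‖v x t‖ₑ ^ 2) ∂(ρ t) := by
          refine lintegral_mono fun x => ?_
          rcases le_total ‖v x t‖ₑ 1 with h1 | h1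
          · exact h1.trans le_self_add
          · exact (le_self_pow₀ h1 two_ne_zero).trans le_add_self
      _ = _ := by rw [lintegral_add_left measurable_const]; simp
  refine hle.trans_lt ?_
  rw [lintegral_add_left measurable_const]
  refine ENNReal.add_lt_top.2 ⟨by simp, h.sq_int⟩

/-- For almost every starting point, the trajectory under some truncated flow never reaches the
region where the field was truncated: blow-up would cost infinite length. -/
theorem CRhoV.ae_exists_mem_staysIn {μ : Measure (E d)} [IsProbabilityMeasure μ]
    {ρ : ℝ → Measure (E d)} {v : E d → ℝ → E d} (h : CRhoV μ ρ v) (hv : CV v) :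
    ∀ᵐ x ∂μ, ∃ n, (x, (1 : ℝ)) ∈ staysIn v n := by
  set f : ℕ → E d × ℝ → ℝ≥0∞ := fun n => (staysIn v n).indicator
    (fun p => ‖v (flow (truncField v n) 0 p.1 p.2) p.2‖ₑ) with hf
  have hfm : ∀ n, Measurable (f n) := fun n => by
    obtain ⟨K, hK⟩ := hv.exists_bddLip h.meas n
    refine Measurable.indicator ?_ (isClosed_staysIn hK).measurableSet
    exact (h.meas.comp (hK.continuous_flow.measurable.prodMk measurable_snd)).enorm
  -- Until they are truncated, the trajectories carry no more mass than the curve.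
  have hI : ∀ n, ∫⁻ x, (∫⁻ t in Icc (0 : ℝ) 1, f n (x, t)) ∂μ ≤
      ∫⁻ t in Icc (0 : ℝ) 1, ∫⁻ x, ‖v x t‖ₑ ∂(ρ t) := by
    intro n
    obtain ⟨K, hK⟩ := hv.exists_bddLip h.meas n
    rw [lintegral_lintegral_swap (f := fun x t => f n (x, t)) (hfm n).aemeasurable]
    refine setLIntegral_mono' measurableSet_Icc fun t ht => ?_
    set A : Set (E d) := {x | (x, t) ∈ staysIn v n}
    have hA : MeasurableSet A := (isClosed_staysIn hK).measurableSet.preimage (by fun_prop)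
    have hZ : Measurable fun x => flow (truncField v n) 0 x t :=
      (hK.lipschitzWith_flow t).continuous.measurable
    have hvt : Measurable fun x => ‖v x t‖ₑ :=
      (h.meas.comp (by fun_prop : Measurable fun x : E d => (x, t))).enorm
    have hle : (μ.restrict A).map (fun x => flow (truncField v n) 0 x t) ≤ ρ t := by
      refine h.map_le hv ht hZ.aemeasurable ?_
      filter_upwards [ae_restrict_mem hA] with x hx
      filter_upwards [eventually_ge_atTop n] with m hm
      obtain ⟨K', hK'⟩ := hv.exists_bddLip h.meas m
      have hn : ∀ s ∈ Icc 0 t, ‖flow (truncField v n) 0 x s‖ ≤ n := fun s hs =>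
        norm_flow_le_of_mem_staysIn hx hs
      exact (eqOn_flow_truncField hK' ht.2 (hK.continuous_flow_right 0 x).continuousOn
        (fun s hs => (hn s hs).trans (by exact_mod_cast hm)) (flow_truncField_eq hK ht.2 hn)
        ⟨ht.1, le_rfl⟩).symm
    calc ∫⁻ x, f n (x, t) ∂μ
        = ∫⁻ x in A, ‖v (flow (truncField v n) 0 x t) t‖ₑ ∂μ := by
          rw [← lintegral_indicator hA]; rfl
      _ = ∫⁻ y, ‖v y t‖ₑ ∂((μ.restrict A).map fun x => flow (truncField v n) 0 x t) :=
          (lintegral_map hvt hZ).symm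
      _ ≤ _ := lintegral_mono' hle le_rfl
  -- By Fatou's lemma, almost no trajectory leaves every ball: its length would be infinite.
  have hlim : ∫⁻ x, liminf (fun n => ∫⁻ t in Icc (0 : ℝ) 1, f n (x, t)) atTop ∂μ < ⊤ := by
    refine ((lintegral_liminf_le fun n => (hfm n).lintegral_prod_right').trans ?_).trans_lt
      h.lintegral_speed_lt_top
    exact (liminf_le_liminf (Eventually.of_forall hI)).trans (liminf_const _).le
  have hmeas : Measurable fun x => liminf (fun n => ∫⁻ t in Icc (0 : ℝ) 1, f n (x, t)) atTop :=
    Measurable.liminf fun n => (hfm n).lintegral_prod_right'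
  filter_upwards [ae_lt_top hmeas hlim.ne] with x hx
  by_contra! hcon
  have htop : Tendsto (fun n => ∫⁻ t in Icc (0 : ℝ) 1, f n (x, t)) atTop (𝓝 ⊤) := by
    refine tendsto_nhds_top_mono (f := fun n : ℕ => ENNReal.ofReal (n - ‖x‖)) ?_
      (Eventually.of_forall fun n => ?_)
    · exact ENNReal.tendsto_ofReal_atTop.comp
        (tendsto_atTop_add_const_right _ _ tendsto_natCast_atTop_atTop)
    · obtain ⟨K, hK⟩ := hv.exists_bddLip h.meas n
      exact ofReal_le_lintegral_of_notMem_staysIn hK (hcon n)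
  rw [htop.liminf_eq] at hx
  exact lt_irrefl _ hx

/-- A trajectory given as a primitive has the right derivative almost everywhere. -/
theorem ae_hasDerivAt_of_eq_add_integral {y : ℝ → E d} {x : E d} {u : ℝ → E d}
    (hu : IntervalIntegrable u volume 0 1)
    (h : ∀ t ∈ Icc (0 : ℝ) 1, y t = x + ∫ r in (0 : ℝ)..t, u r) :
    ∀ᵐ t ∂volume.restrict (Icc (0 : ℝ) 1), HasDerivAt y (u t) t := by
  have hne : ∀ q : ℝ, ∀ᵐ r ∂(volume : Measure ℝ), r ≠ q := fun q => by
    simp [ae_iff, measure_singleton]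
  rw [ae_restrict_iff' measurableSet_Icc]
  filter_upwards [hu.ae_hasDerivAt_integral, hne 0, hne 1] with t ht h0 h1 htI
  have hd := (ht (by rwa [uIcc_of_le zero_le_one]) 0 left_mem_uIcc).const_add x
  refine hd.congr_of_eventuallyEq ?_
  filter_upwards [Icc_mem_nhds (lt_of_le_of_ne htI.1 h0.symm) (lt_of_le_of_ne htI.2 h1)]
    with s hs using h s hs

theorem continuousOn_of_eq_add_integral {y : ℝ → E d} {x : E d} {u : ℝ → E d}
    (hu : IntervalIntegrable u volume 0 1)
    (h : ∀ t ∈ Icc (0 : ℝ) 1, y t = x + ∫ r in (0 : ℝ)..t, u r) : ContinuousOn y (Icc 0 1) := by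
  have := intervalIntegral.continuousOn_primitive_interval (μ := volume) (f := u) (a := 0) (b := 1)
    (by rwa [← intervalIntegrable_iff'])
  rw [uIcc_of_le zero_le_one] at this
  exact (continuousOn_const.add this).congr h

/-- The velocity of a map in `C_X` can be chosen Borel. -/
theorem CX.exists_velocity {μ : Measure (E d)} [IsProbabilityMeasure μ] {X : E d → ℝ → E d}
    (hX : CX μ X) : ∃ u : E d → ℝ → E d, Measurable (fun p : E d × ℝ => u p.1 p.2) ∧
      MemLp (fun p : E d × ℝ => u p.1 p.2) 2 (μ.prod (volume.restrict (Icc (0 : ℝ) 1))) ∧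
      ∀ᵐ x ∂μ, IntervalIntegrable (u x) volume 0 1 ∧
        ∀ t ∈ Icc (0 : ℝ) 1, X x t = x + ∫ r in (0 : ℝ)..t, u x r := by
  obtain ⟨u, hu, hXu⟩ := hX
  have hum := hu.aestronglyMeasurable
  refine ⟨fun x t => hum.mk _ (x, t), hum.stronglyMeasurable_mk.measurable,
    hu.ae_eq hum.ae_eq_mk, ?_⟩
  have hint := (hu.integrable one_le_two).prod_right_ae
  filter_upwards [hXu, Measure.ae_ae_of_ae_prod hum.ae_eq_mk, hint] with x h1 h2 h3
  have h2' := (ae_restrict_iff' measurableSet_Icc).1 h2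
  constructor
  · rw [intervalIntegrable_iff', uIcc_of_le zero_le_one]
    exact h3.congr h2
  · intro t ht
    rw [h1 t ht]
    congr 1
    refine intervalIntegral.integral_congr_ae ?_
    filter_upwards [h2'] with r hr hrt
    rw [uIoc_of_le ht.1] at hrt
    exact hr ⟨hrt.1.le, hrt.2.trans ht.2⟩

/-- Characteristics solve the integral equation of the field. -/
theorem CXV.ae_integral_eq {μ : Measure (E d)} [IsProbabilityMeasure μ] {X v : E d → ℝ → E d}
    (h : CXV μ X v) : ∀ᵐ x ∂μ, ContinuousOn (X x) (Icc 0 1) ∧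
      ∀ t ∈ Icc (0 : ℝ) 1, X x t = x + ∫ r in (0 : ℝ)..t, v (X x r) r := by
  obtain ⟨u, -, -, hu⟩ := h.1.exists_velocity
  filter_upwards [hu, h.2] with x h1 h2
  refine ⟨continuousOn_of_eq_add_integral h1.1 h1.2, fun t ht => ?_⟩
  rw [h1.2 t ht]
  congr 1
  have h3 : ∀ᵐ r ∂volume.restrict (Icc (0 : ℝ) 1), u x r = v (X x r) r := by
    filter_upwards [h2, ae_hasDerivAt_of_eq_add_integral h1.1 h1.2] with r h4 h5
    rw [← h4, h5.deriv]
  refine intervalIntegral.integral_congr_ae ?_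
  filter_upwards [(ae_restrict_iff' measurableSet_Icc).1 h3] with r hr hrt
  rw [uIoc_of_le ht.1] at hrt
  exact hr ⟨hrt.1.le, hrt.2.trans ht.2⟩

/-- A locally Lipschitz velocity field of a curve has characteristics. -/
theorem CRhoV.exists_characteristics {μ : Measure (E d)} [IsProbabilityMeasure μ]
    {ρ : ℝ → Measure (E d)} {v : E d → ℝ → E d} (h : CRhoV μ ρ v) (hv : CV v) :
    ∃ X, CXV μ X v := by
  classical
  choose K hK using hv.exists_bddLip h.meas
  -- Follow the first truncated flow whose trajectory is never truncated.
  let p : E d → ℕ → Prop := fun x n => (x, (1 : ℝ)) ∈ staysIn v n ∨ ∀ m, (x, (1 : ℝ)) ∉ staysIn v m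
  have hp : ∀ x, ∃ n, p x n := fun x => by
    by_cases hx : ∃ n, (x, (1 : ℝ)) ∈ staysIn v n
    · exact ⟨hx.choose, Or.inl hx.choose_spec⟩
    · exact ⟨0, Or.inr (not_exists.1 hx)⟩
  have hS : ∀ n, MeasurableSet {x : E d | (x, (1 : ℝ)) ∈ staysIn v n} := fun n =>
    (isClosed_staysIn (hK n)).measurableSet.preimage (by fun_prop)
  have hpm : ∀ n, MeasurableSet {x | p x n} := fun n => by
    have : {x : E d | p x n} = {x | (x, (1 : ℝ)) ∈ staysIn v n} ∪
        ⋂ m, {x : E d | (x, (1 : ℝ)) ∈ staysIn v m}ᶜ := by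
      ext x; simp [p]
    rw [this]
    exact (hS n).union (MeasurableSet.iInter fun m => (hS m).compl)
  let N : E d → ℕ := fun x => Nat.find (hp x)
  have hN : Measurable N := measurable_find hp hpm
  let X : E d → ℝ → E d := fun x => flow (truncField v (N x)) 0 x
  have hXm : Measurable fun p : E d × ℝ => X p.1 p.2 := by
    have h1 : Measurable fun q : ℕ × (E d × ℝ) => flow (truncField v q.1) 0 q.2.1 q.2.2 :=
      measurable_from_prod_countable_right fun n => (hK n).continuous_flow.measurable
    exact h1.comp ((hN.comp measurable_fst).prodMk measurable_id)
  have hX : ∀ᵐ x ∂μ, ContinuousOn (X x) (Icc 0 1) ∧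
      ∀ t ∈ Icc (0 : ℝ) 1, X x t = x + ∫ r in (0 : ℝ)..t, v (X x r) r := by
    filter_upwards [h.ae_exists_mem_staysIn hv] with x hx
    have hmem : (x, (1 : ℝ)) ∈ staysIn v (N x) := by
      rcases Nat.find_spec (hp x) with h1 | h1
      · exact h1
      · exact absurd hx (not_exists.2 h1)
    exact ⟨((hK _).continuous_flow_right 0 x).continuousOn, flow_truncField_eq (hK _) le_rfl
      fun s hs => norm_flow_le_of_mem_staysIn hmem hs⟩
  have hpush : ∀ t ∈ Icc (0 : ℝ) 1, pushCurve μ X t = ρ t := fun t ht => h.pushCurve_eq hv hX ht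
  have hum : Measurable fun p : E d × ℝ => v (X p.1 p.2) p.2 :=
    h.meas.comp (hXm.prodMk measurable_snd)
  have hu : MemLp (fun p : E d × ℝ => v (X p.1 p.2) p.2) 2
      (μ.prod (volume.restrict (Icc (0 : ℝ) 1))) := by
    refine memLp_two_of_lintegral_lt_top hum.aestronglyMeasurable ?_
    rw [lintegral_prod_symm' _ (hum.enorm.pow_const 2)]
    refine lt_of_eq_of_lt (setLIntegral_congr_fun measurableSet_Icc fun t ht => ?_) h.sq_int
    simp only
    rw [← hpush t ht, pushCurve, lintegral_map]
    · exact (h.meas.comp (by fun_prop : Measurable fun x : E d => (x, t))).enorm.pow_const 2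
    · exact hXm.comp (by fun_prop : Measurable fun x : E d => (x, t))
  refine ⟨X, ⟨fun x t => v (X x t) t, hu, hX.mono fun x hx => hx.2⟩, ?_⟩
  filter_upwards [hX, (hu.integrable one_le_two).prod_right_ae] with x h1 h2
  have h2' : IntervalIntegrable (fun t => v (X x t) t) volume 0 1 := by
    rw [intervalIntegrable_iff', uIcc_of_le zero_le_one]; exact h2
  filter_upwards [ae_hasDerivAt_of_eq_add_integral h2' h1.2] with t ht using ht.deriv

/-! ### Trajectory maps and their Borel versions -/

/-- The chain rule and the fundamental theorem of calculus along an absolutely continuous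
trajectory, for a space-time test function vanishing at both ends. -/
theorem integral_fderiv_trajectory_eq_zero {y : ℝ → E d} {x : E d} {u : ℝ → E d}
    (hu : IntervalIntegrable u volume 0 1)
    (h : ∀ t ∈ Icc (0 : ℝ) 1, y t = x + ∫ r in (0 : ℝ)..t, u r) {φ : ℝ × E d → ℝ}
    (hφ : ContDiff ℝ ∞ φ) (hφc : HasCompactSupport φ)
    (hφs : tsupport φ ⊆ Ioo (0 : ℝ) 1 ×ˢ (univ : Set (E d))) :
    ∫ t in Icc (0 : ℝ) 1, fderiv ℝ φ (t, y t) (1, u t) = 0 := by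
  obtain ⟨L, hL⟩ := (hφ.of_le (by simp)).lipschitzWith_of_hasCompactSupport hφc one_ne_zero
  have hnac : AbsolutelyContinuousOnInterval (fun t => ∫ r in (0 : ℝ)..t, ‖u r‖) 0 1 :=
    hu.norm.absolutelyContinuousOnInterval_intervalIntegral left_mem_uIcc
  have htac : AbsolutelyContinuousOnInterval (fun t : ℝ => t) 0 1 :=
    (LipschitzWith.id.lipschitzOnWith (s := uIcc (0 : ℝ) 1)).absolutelyContinuousOnInterval
  have hdist : ∀ s ∈ uIcc (0 : ℝ) 1, ∀ t ∈ uIcc (0 : ℝ) 1,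
      dist (∫ r in (0 : ℝ)..s, u r) (∫ r in (0 : ℝ)..t, u r) ≤
        dist (∫ r in (0 : ℝ)..s, ‖u r‖) (∫ r in (0 : ℝ)..t, ‖u r‖) := by
    intro s hs t ht
    have hsub : ∀ r ∈ uIcc (0 : ℝ) 1, IntervalIntegrable u volume 0 r := fun r hr =>
      hu.mono_set (uIcc_subset_uIcc left_mem_uIcc hr)
    rw [dist_eq_norm, Real.dist_eq, intervalIntegral.integral_interval_sub_left (hsub s hs)
      (hsub t ht), intervalIntegral.integral_interval_sub_left (hsub s hs).norm (hsub t ht).norm]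
    exact intervalIntegral.norm_integral_le_abs_integral_norm
  have hac : AbsolutelyContinuousOnInterval (fun t => φ (t, x + ∫ r in (0 : ℝ)..t, u r)) 0 1 := by
    have hsum := (Tendsto.add htac hnac).const_mul (L : ℝ)
    rw [add_zero, mul_zero] at hsum
    refine squeeze_zero' (Eventually.of_forall fun _ => Finset.sum_nonneg fun _ _ => dist_nonneg)
      ?_ hsum
    refine eventually_inf_principal.2 (Eventually.of_forall fun E hE => ?_)
    simp only [AbsolutelyContinuousOnInterval.disjWithin, mem_ofPred_eq] at hE
    rw [← Finset.sum_add_distrib, Finset.mul_sum]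
    refine Finset.sum_le_sum fun i hi => (hL.dist_le_mul _ _).trans ?_
    refine mul_le_mul_of_nonneg_left ?_ L.2
    rw [Prod.dist_eq, dist_add_left]
    have := hdist _ (hE.left i hi).1 _ (hE.left i hi).2
    exact (max_le_add_of_nonneg dist_nonneg dist_nonneg).trans (by gcongr)
  have hftc := hac.integral_deriv_eq_sub
  have hb : ∀ z : E d, φ (0, z) = 0 ∧ φ (1, z) = 0 := fun z => by
    constructor
    · refine image_eq_zero_of_notMem_tsupport fun hz => ?_
      exact lt_irrefl _ (hφs hz).1.1
    · refine image_eq_zero_of_notMem_tsupport fun hz => ?_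
      exact lt_irrefl _ (hφs hz).1.2
  rw [(hb _).1, (hb _).2, sub_zero, intervalIntegral.integral_of_le zero_le_one,
    ← integral_Icc_eq_integral_Ioc] at hftc
  have hd := ae_hasDerivAt_of_eq_add_integral
    (y := fun t => x + ∫ r in (0 : ℝ)..t, u r) (x := x) hu
    (fun _ _ => rfl)
  refine (integral_congr_ae ?_).trans hftc
  filter_upwards [hd, ae_restrict_mem measurableSet_Icc] with t ht htI
  have h1 : HasDerivAt (fun t => (t, x + ∫ r in (0 : ℝ)..t, u r)) (1, u t) t :=
    (hasDerivAt_id t).prodMk ht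
  have h2 := ((hφ.differentiable (by simp)) (t, x + ∫ r in (0 : ℝ)..t, u r)).hasFDerivAt
  rw [h t htI]
  exact (HasFDerivAt.comp_hasDerivAt (f := fun t => (t, x + ∫ r in (0 : ℝ)..t, u r)) t h2
    h1).deriv.symm

/-- Minkowski's integral inequality in `L²`. -/
theorem lintegral_lintegral_sq_rpow_le {μ : Measure (E d)} [SFinite μ] {ν : Measure ℝ} [SFinite ν]
    {f : E d × ℝ → ℝ≥0∞} (hf : Measurable f) :
    (∫⁻ x, (∫⁻ r, f (x, r) ∂ν) ^ 2 ∂μ) ^ (1 / 2 : ℝ) ≤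
      ∫⁻ r, (∫⁻ x, f (x, r) ^ 2 ∂μ) ^ (1 / 2 : ℝ) ∂ν := by
  set M : ℝ → ℝ≥0∞ := fun r => (∫⁻ x, f (x, r) ^ 2 ∂μ) ^ (1 / 2 : ℝ) with hM
  have hMm : Measurable M := ((hf.pow_const 2).lintegral_prod_left').pow_const _
  have hfx : ∀ x, Measurable fun r => f (x, r) := fun x =>
    hf.comp (by fun_prop : Measurable fun r : ℝ => (x, r))
  have hfr : ∀ r, Measurable fun x => f (x, r) := fun r =>
    hf.comp (by fun_prop : Measurable fun x : E d => (x, r))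
  have hI : Measurable fun x => ∫⁻ r, f (x, r) ∂ν := hf.lintegral_prod_right'
  have key : ∫⁻ x, (∫⁻ r, f (x, r) ∂ν) ^ 2 ∂μ ≤ (∫⁻ r, M r ∂ν) ^ 2 := by
    calc ∫⁻ x, (∫⁻ r, f (x, r) ∂ν) ^ 2 ∂μ
        = ∫⁻ x, (∫⁻ r, f (x, r) * (∫⁻ r', f (x, r') ∂ν) ∂ν) ∂μ := by
          refine lintegral_congr fun x => ?_
          rw [lintegral_mul_const _ (hfx x), pow_two]
      _ = ∫⁻ r, (∫⁻ x, f (x, r) * (∫⁻ r', f (x, r') ∂ν) ∂μ) ∂ν :=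
          lintegral_lintegral_swap (f := fun x r => f (x, r) * (∫⁻ r', f (x, r') ∂ν))
            (hf.mul (hI.comp measurable_fst)).aemeasurable
      _ = ∫⁻ r, (∫⁻ r', (∫⁻ x, f (x, r) * f (x, r') ∂μ) ∂ν) ∂ν := by
          refine lintegral_congr fun r => ?_
          rw [← lintegral_lintegral_swap (f := fun x r' => f (x, r) * f (x, r'))
            (((hfr r).comp measurable_fst).mul hf).aemeasurable]
          exact lintegral_congr fun x => (lintegral_const_mul _ (hfx x)).symm
      _ ≤ ∫⁻ r, (∫⁻ r', M r * M r' ∂ν) ∂ν := by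
          refine lintegral_mono fun r => lintegral_mono fun r' => ?_
          have := ENNReal.lintegral_mul_le_Lp_mul_Lq μ Real.HolderConjugate.two_two
            (hfr r).aemeasurable (hfr r').aemeasurable
          simpa [hM] using this
      _ = _ := by
          simp_rw [lintegral_const_mul _ hMm]
          rw [lintegral_mul_const _ hMm, pow_two]
  refine (ENNReal.rpow_le_rpow key (by norm_num)).trans_eq ?_
  rw [← ENNReal.rpow_natCast, ← ENNReal.rpow_mul]
  norm_num

/-- A jointly Borel version `Y` of a map `X` in `C_X`, with Borel velocity `u`. -/
structure IsVersion (μ : Measure (E d)) (X Y u : E d → ℝ → E d) : Prop where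
  meas : Measurable fun p : E d × ℝ => Y p.1 p.2
  meas_vel : Measurable fun p : E d × ℝ => u p.1 p.2
  memLp : MemLp (fun p : E d × ℝ => u p.1 p.2) 2 (μ.prod (volume.restrict (Icc (0 : ℝ) 1)))
  ae_eq : ∀ᵐ x ∂μ, IntervalIntegrable (u x) volume 0 1 ∧ Continuous (Y x) ∧
    (∀ t ∈ Icc (0 : ℝ) 1, X x t = Y x t) ∧ ∀ t ∈ Icc (0 : ℝ) 1, Y x t = x + ∫ r in (0 : ℝ)..t, u x r

/-- The primitive of a Borel velocity is jointly Borel; it is extended by constants outside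
`[0,1]`. -/
theorem CX.exists_isVersion {μ : Measure (E d)} [IsProbabilityMeasure μ] {X : E d → ℝ → E d}
    (hX : CX μ X) : ∃ Y u, IsVersion μ X Y u := by
  obtain ⟨u, hum, hu, hXu⟩ := hX.exists_velocity
  let Y : E d → ℝ → E d := fun x t =>
    x + ∫ r in Icc (0 : ℝ) 1, (Iic (projIcc (0 : ℝ) 1 zero_le_one t : ℝ)).indicator (u x) r
  have hY : ∀ x, ∀ t ∈ Icc (0 : ℝ) 1, Y x t = x + ∫ r in (0 : ℝ)..t, u x r := fun x t ht => by
    simp only [Y]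
    rw [projIcc_of_mem zero_le_one ht, setIntegral_indicator measurableSet_Iic,
      intervalIntegral.integral_of_le ht.1, ← integral_Icc_eq_integral_Ioc]
    congr 3
    ext r
    simp only [mem_inter_iff, mem_Icc, mem_Iic]
    constructor
    · rintro ⟨⟨h1, _⟩, h3⟩; exact ⟨h1, h3⟩
    · rintro ⟨h1, h3⟩; exact ⟨⟨h1, h3.trans ht.2⟩, h3⟩
  have hYp : ∀ x t, Y x t = Y x (projIcc (0 : ℝ) 1 zero_le_one t) := fun x t => by
    simp [Y]
  refine ⟨Y, u, ?_, hum, hu, ?_⟩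
  · refine measurable_fst.add (StronglyMeasurable.measurable ?_)
    refine StronglyMeasurable.integral_prod_right' (f := fun q : (E d × ℝ) × ℝ =>
      (Iic (projIcc (0 : ℝ) 1 zero_le_one q.1.2 : ℝ)).indicator (u q.1.1) q.2) ?_
    have e : (fun q : (E d × ℝ) × ℝ =>
        (Iic (projIcc (0 : ℝ) 1 zero_le_one q.1.2 : ℝ)).indicator (u q.1.1) q.2) =
        {q : (E d × ℝ) × ℝ | q.2 ≤ (projIcc (0 : ℝ) 1 zero_le_one q.1.2 : ℝ)}.indicator
          fun q => u q.1.1 q.2 := by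
      ext q; simp [indicator]
    rw [e]
    refine (Measurable.indicator (hum.comp (by fun_prop : Measurable fun q : (E d × ℝ) × ℝ =>
      (q.1.1, q.2))) ?_).stronglyMeasurable
    refine measurableSet_le measurable_snd ?_
    exact (continuous_subtype_val.comp (continuous_projIcc.comp
      (continuous_snd.comp continuous_fst))).measurable
  · filter_upwards [hXu] with x hx
    refine ⟨hx.1, ?_, fun t ht => ?_, hY x⟩
    · have h1 := continuousOn_of_eq_add_integral hx.1 (hY x)
      have h2 : Y x = (Y x ∘ (Subtype.val : Icc (0 : ℝ) 1 → ℝ)) ∘ projIcc (0 : ℝ) 1 zero_le_one :=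
        funext fun t => hYp x t
      rw [h2]
      exact (continuousOn_iff_continuous_domRestrict.1 h1).comp continuous_projIcc
    · rw [hY x t ht, hx.2 t ht]

namespace IsVersion

variable {μ : Measure (E d)} {X Y u : E d → ℝ → E d}

theorem measurable_apply (hV : IsVersion μ X Y u) (t : ℝ) : Measurable fun x => Y x t :=
  hV.meas.comp (by fun_prop : Measurable fun x : E d => (x, t))

theorem apply_ae_eq (hV : IsVersion μ X Y u) {t : ℝ} (ht : t ∈ Icc (0 : ℝ) 1) :
    (fun x => X x t) =ᵐ[μ] fun x => Y x t := by
  filter_upwards [hV.ae_eq] with x hx using hx.2.2.1 t ht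

theorem pushCurve_eq (hV : IsVersion μ X Y u) {t : ℝ} (ht : t ∈ Icc (0 : ℝ) 1) :
    pushCurve μ X t = μ.map fun x => Y x t := Measure.map_congr (hV.apply_ae_eq ht)

theorem ae_ae_hasDerivAt (hV : IsVersion μ X Y u) :
    ∀ᵐ x ∂μ, ∀ᵐ t ∂volume.restrict (Icc (0 : ℝ) 1), HasDerivAt (X x) (u x t) t := by
  filter_upwards [hV.ae_eq] with x hx
  exact ae_hasDerivAt_of_eq_add_integral hx.1 fun t ht => (hx.2.2.1 t ht).trans (hx.2.2.2 t ht)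

/-- The times at which `u x` is the derivative of `Y x`, as a countable combination of conditions
on rational increments. -/
def derivSet (Y u : E d → ℝ → E d) : Set (E d × ℝ) :=
  {p | ∀ n : ℕ, ∃ k : ℕ, ∀ q : ℚ, |(q : ℝ)| < 1 / (k + 1) →
    ‖Y p.1 (p.2 + q) - Y p.1 p.2 - (q : ℝ) • u p.1 p.2‖ ≤ 1 / ((n : ℝ) + 1) * |(q : ℝ)|}

theorem measurableSet_derivSet (hV : IsVersion μ X Y u) : MeasurableSet (derivSet Y u) := by
  simp only [derivSet, ofPred_forall, ofPred_exists]
  refine MeasurableSet.iInter fun n => MeasurableSet.iUnion fun k => MeasurableSet.iInter fun q =>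
    MeasurableSet.iInter fun _ => measurableSet_le ?_ measurable_const
  have h1 : Measurable fun p : E d × ℝ => Y p.1 (p.2 + q) :=
    hV.meas.comp (by fun_prop : Measurable fun p : E d × ℝ => (p.1, p.2 + (q : ℝ)))
  exact ((h1.sub hV.meas).sub (hV.meas_vel.const_smul (q : ℝ))).norm

theorem mem_derivSet_of_hasDerivAt {x : E d} {t : ℝ} (h : HasDerivAt (Y x) (u x t) t) :
    (x, t) ∈ derivSet Y u := by
  intro n
  rw [hasDerivAt_iff_isLittleO_nhds_zero, Asymptotics.isLittleO_iff] at h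
  have hn := h (c := 1 / ((n : ℝ) + 1)) (by positivity)
  obtain ⟨ε, hε, hball⟩ := Metric.eventually_nhds_iff.1 hn
  obtain ⟨k, hk⟩ := exists_nat_one_div_lt hε
  exact ⟨k, fun q hq => hball (by rw [Real.dist_eq, sub_zero]; exact hq.trans hk)⟩

theorem hasDerivAt_of_mem_derivSet {x : E d} {t : ℝ} (hc : Continuous (Y x))
    (h : (x, t) ∈ derivSet Y u) : HasDerivAt (Y x) (u x t) t := by
  rw [hasDerivAt_iff_isLittleO_nhds_zero, Asymptotics.isLittleO_iff]
  intro c hcpos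
  obtain ⟨n, hn⟩ := exists_nat_one_div_lt hcpos
  obtain ⟨k, hk⟩ := h n
  have hkpos : (0 : ℝ) < 1 / (k + 1) := Nat.one_div_pos_of_nat
  filter_upwards [Metric.ball_mem_nhds (0 : ℝ) hkpos] with r hr
  have hclosed : IsClosed {r : ℝ | ‖Y x (t + r) - Y x t - r • u x t‖ ≤ c * ‖r‖} := by
    refine isClosed_le ?_ (by fun_prop)
    exact (((hc.comp (by fun_prop)).sub continuous_const).sub (by fun_prop)).norm
  refine hclosed.closure_subset_iff.2 ?_
    (Rat.denseRange_cast.open_subset_closure_inter Metric.isOpen_ball hr)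
  rintro _ ⟨hq, q, rfl⟩
  rw [Metric.mem_ball, Real.dist_eq, sub_zero] at hq
  exact (hk q hq).trans (mul_le_mul_of_nonneg_right hn.le (abs_nonneg _))

/-- The quantifiers over `x` and `t` can be exchanged because differentiability of the trajectories
is a Borel condition. -/
theorem ae_ae_deriv_eq [SFinite μ] (hV : IsVersion μ X Y u) :
    ∀ᵐ t ∂volume.restrict (Icc (0 : ℝ) 1), ∀ᵐ x ∂μ, deriv (X x) t = u x t := by
  have h1 : ∀ᵐ x ∂μ, ∀ᵐ t ∂volume.restrict (Icc (0 : ℝ) 1), (x, t) ∈ derivSet Y u := by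
    filter_upwards [hV.ae_eq] with x hx
    filter_upwards [ae_hasDerivAt_of_eq_add_integral hx.1 hx.2.2.2] with t ht
      using mem_derivSet_of_hasDerivAt ht
  have h2 : ∀ᵐ p ∂μ.prod (volume.restrict (Icc (0 : ℝ) 1)), p ∈ derivSet Y u :=
    (Measure.ae_prod_iff_ae_ae hV.measurableSet_derivSet).2 h1
  have h3 : ∀ᵐ t ∂volume.restrict (Icc (0 : ℝ) 1), ∀ᵐ x ∂μ, (x, t) ∈ derivSet Y u := by
    rw [← Measure.prod_swap] at h2
    exact Measure.ae_ae_of_ae_prod (ae_of_ae_map measurable_swap.aemeasurable h2)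
  have hne : ∀ q : ℝ, ∀ᵐ r ∂volume.restrict (Icc (0 : ℝ) 1), r ≠ q := fun q =>
    ae_restrict_of_ae (by simp [ae_iff, measure_singleton])
  filter_upwards [h3, hne 0, hne 1, ae_restrict_mem measurableSet_Icc] with t ht h0 h1 htI
  filter_upwards [ht, hV.ae_eq] with x hx hxV
  refine ((hasDerivAt_of_mem_derivSet hxV.2.1 hx).congr_of_eventuallyEq ?_).deriv
  filter_upwards [Icc_mem_nhds (lt_of_le_of_ne htI.1 h0.symm) (lt_of_le_of_ne htI.2 h1)]
    with s hs using hxV.2.2.1 s hs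

theorem lintegral_enorm_sq_lt_top (hV : IsVersion μ X Y u) :
    ∫⁻ p, ‖u p.1 p.2‖ₑ ^ 2 ∂(μ.prod (volume.restrict (Icc (0 : ℝ) 1))) < ⊤ := by
  have := (eLpNorm_lt_top_iff_lintegral_rpow_enorm_lt_top two_ne_zero ENNReal.ofNat_ne_top).1
    hV.memLp.eLpNorm_lt_top
  simpa using this

/-- Space-time integrals along the curve of laws are integrals along trajectories. -/
theorem lintegral_pushCurve [SFinite μ] (hV : IsVersion μ X Y u) {f : E d × ℝ → ℝ≥0∞}
    (hf : Measurable f) : ∫⁻ t in Icc (0 : ℝ) 1, ∫⁻ y, f (y, t) ∂(pushCurve μ X t) =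
      ∫⁻ p, f (Y p.1 p.2, p.2) ∂(μ.prod (volume.restrict (Icc (0 : ℝ) 1))) := by
  have hm : Measurable fun p : E d × ℝ => f (Y p.1 p.2, p.2) :=
    hf.comp (hV.meas.prodMk measurable_snd)
  rw [lintegral_prod_symm' _ hm]
  refine setLIntegral_congr_fun measurableSet_Icc fun t ht => ?_
  simp only
  have hft : Measurable fun y : E d => f (y, t) :=
    hf.comp (by fun_prop : Measurable fun x : E d => (x, t))
  rw [hV.pushCurve_eq ht, lintegral_map hft (hV.measurable_apply t)]

end IsVersion

/-! ### The curve of laws of a trajectory map -/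

namespace IsVersion

variable {μ : Measure (E d)} {X Y u : E d → ℝ → E d}

/-- The `L²(μ)` norm of the velocity at time `r`, which serves as metric speed of the curve of
laws. -/
def speed (μ : Measure (E d)) (u : E d → ℝ → E d) (r : ℝ) : ℝ≥0∞ :=
  (∫⁻ x, ‖u x r‖ₑ ^ 2 ∂μ) ^ (1 / 2 : ℝ)

theorem measurable_speed [SFinite μ] (hV : IsVersion μ X Y u) : Measurable (speed μ u) := by
  have h : Measurable fun p : E d × ℝ => ‖u p.1 p.2‖ₑ ^ 2 := hV.meas_vel.enorm.pow_const 2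
  exact (h.lintegral_prod_left').pow_const _

theorem speed_sq (μ : Measure (E d)) (u : E d → ℝ → E d) (r : ℝ) :
    speed μ u r ^ 2 = ∫⁻ x, ‖u x r‖ₑ ^ 2 ∂μ := by
  rw [speed, ← ENNReal.rpow_natCast, ← ENNReal.rpow_mul]
  norm_num

theorem lintegral_speed_sq_lt_top [SFinite μ] (hV : IsVersion μ X Y u) :
    ∫⁻ r in Icc (0 : ℝ) 1, speed μ u r ^ 2 < ⊤ := by
  have h : Measurable fun p : E d × ℝ => ‖u p.1 p.2‖ₑ ^ 2 := hV.meas_vel.enorm.pow_const 2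
  simp_rw [speed_sq]
  rw [← lintegral_prod_symm' _ h]
  exact hV.lintegral_enorm_sq_lt_top

theorem memLp_speed [SFinite μ] (hV : IsVersion μ X Y u) :
    MemLp (fun r => (speed μ u r).toReal) 2 (volume.restrict (Icc (0 : ℝ) 1)) := by
  refine memLp_two_of_lintegral_lt_top hV.measurable_speed.ennreal_toReal.aestronglyMeasurable
    ((lintegral_mono fun r => ?_).trans_lt hV.lintegral_speed_sq_lt_top)
  gcongr
  rw [← ofReal_norm, Real.norm_of_nonneg ENNReal.toReal_nonneg]
  exact ENNReal.ofReal_toReal_le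

theorem lintegral_speed_eq [SFinite μ] (hV : IsVersion μ X Y u) {s t : ℝ} (hs : 0 ≤ s)
    (hst : s ≤ t) (ht : t ≤ 1) : ∫⁻ r in Ioc s t, speed μ u r =
      ENNReal.ofReal (∫ r in s..t, (speed μ u r).toReal) := by
  have hsub : Ioc s t ⊆ Icc (0 : ℝ) 1 := Ioc_subset_Icc_self.trans (Icc_subset_Icc hs ht)
  have hfin : ∀ᵐ r ∂volume.restrict (Icc (0 : ℝ) 1), speed μ u r < ⊤ := by
    filter_upwards [ae_lt_top (hV.measurable_speed.pow_const 2) hV.lintegral_speed_sq_lt_top.ne]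
      with r hr
    by_contra hcon
    simp [not_lt_top_iff.1 hcon] at hr
  rw [intervalIntegral.integral_of_le hst, ofReal_integral_eq_lintegral_ofReal
    ((hV.memLp_speed.integrable one_le_two).mono_measure (Measure.restrict_mono_set _ hsub))
    (Eventually.of_forall fun _ => ENNReal.toReal_nonneg)]
  refine lintegral_congr_ae ?_
  filter_upwards [ae_restrict_of_ae_restrict_of_subset hsub hfin] with r hr
    using (ENNReal.ofReal_toReal hr.ne).symm

/-- The `L²(μ)` distance of two positions is at most the length of the curve between them. -/
theorem lintegral_edist_sq_le [SFinite μ] (hV : IsVersion μ X Y u) {s t : ℝ} (hs : 0 ≤ s)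
    (hst : s ≤ t) (ht : t ≤ 1) : (∫⁻ x, edist (Y x s) (Y x t) ^ 2 ∂μ) ^ (1 / 2 : ℝ) ≤
      ENNReal.ofReal (∫ r in s..t, (speed μ u r).toReal) := by
  rw [← hV.lintegral_speed_eq hs hst ht]
  have h := lintegral_lintegral_sq_rpow_le (μ := μ) (ν := volume.restrict (Ioc s t))
    (f := fun p => ‖u p.1 p.2‖ₑ) hV.meas_vel.enorm
  refine le_trans (ENNReal.rpow_le_rpow (lintegral_mono_ae ?_) (by norm_num)) h
  filter_upwards [hV.ae_eq] with x hx
  have hi : ∀ r ∈ Icc (0 : ℝ) 1, IntervalIntegrable (u x) volume 0 r := fun r hr =>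
    hx.1.mono_set (uIcc_subset_uIcc left_mem_uIcc (by rwa [uIcc_of_le zero_le_one]))
  have hsI : s ∈ Icc (0 : ℝ) 1 := ⟨hs, hst.trans ht⟩
  have htI : t ∈ Icc (0 : ℝ) 1 := ⟨hs.trans hst, ht⟩
  rw [edist_comm, edist_eq_enorm_sub, hx.2.2.2 t htI, hx.2.2.2 s hsI, add_sub_add_left_eq_sub,
    intervalIntegral.integral_interval_sub_left (hi t htI) (hi s hsI),
    intervalIntegral.integral_of_le hst]
  gcongr
  exact enorm_integral_le_lintegral_enorm _

theorem pushCurve_zero (hV : IsVersion μ X Y u) : pushCurve μ X 0 = μ := by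
  have h0 : (0 : ℝ) ∈ Icc (0 : ℝ) 1 := ⟨le_rfl, zero_le_one⟩
  have : (fun x => X x 0) =ᵐ[μ] id := by
    filter_upwards [hV.ae_eq] with x hx
    rw [hx.2.2.1 0 h0, hx.2.2.2 0 h0]
    simp
  rw [pushCurve, Measure.map_congr this, Measure.map_id]

/-- Laws along a map in `C_X` form an absolutely continuous curve. -/
theorem cRho_pushCurve (hμ : IsP2 μ) (hV : IsVersion μ X Y u) : CRho (pushCurve μ X) := by
  have := hμ.1
  refine ⟨fun t ht => ?_, _, hV.memLp_speed, fun s t hs hst ht => ?_⟩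
  · rw [hV.pushCurve_eq ht]
    refine ⟨Measure.isProbabilityMeasure_map (hV.measurable_apply t).aemeasurable, ?_⟩
    rw [lintegral_map (by fun_prop) (hV.measurable_apply t)]
    have h1 := hV.lintegral_edist_sq_le le_rfl ht.1 ht.2
    have h2 : ∫⁻ x, edist (Y x 0) (Y x t) ^ 2 ∂μ < ⊤ := by
      by_contra hcon
      rw [not_lt_top_iff.1 hcon, ENNReal.top_rpow_of_pos (by norm_num)] at h1
      exact absurd h1 (by simp)
    have h3 : ∫⁻ x, ‖Y x t‖ₑ ^ 2 ∂μ ≤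
        ∫⁻ x, (2 * ‖x‖ₑ ^ 2 + 2 * edist (Y x 0) (Y x t) ^ 2) ∂μ := by
      refine lintegral_mono_ae ?_
      filter_upwards [hV.ae_eq] with x hx
      have hx0 : Y x 0 = x := by
        rw [hx.2.2.2 0 ⟨le_rfl, zero_le_one⟩]; simp
      rw [hx0, edist_eq_enorm_sub, ← enorm_neg (x - Y x t), neg_sub]
      have h4 : ‖Y x t‖ₑ ≤ ‖x‖ₑ + ‖Y x t - x‖ₑ := by
        simpa using enorm_add_le x (Y x t - x)
      refine (pow_le_pow_left₀ (by positivity) h4 2).trans ?_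
      have := ENNReal.rpow_add_le_mul_rpow_add_rpow ‖x‖ₑ ‖Y x t - x‖ₑ (p := 2) (by norm_num)
      norm_num at this
      rwa [mul_add] at this
    refine h3.trans_lt ?_
    rw [lintegral_add_left (by fun_prop), lintegral_const_mul _ (by fun_prop),
      lintegral_const_mul' _ _ ENNReal.ofNat_ne_top]
    exact ENNReal.add_lt_top.2 ⟨ENNReal.mul_lt_top (by simp) hμ.2, ENNReal.mul_lt_top (by simp) h2⟩
  · refine le_trans ?_ (hV.lintegral_edist_sq_le hs hst ht)
    rw [hV.pushCurve_eq ⟨hs, hst.trans ht⟩, hV.pushCurve_eq ⟨hs.trans hst, ht⟩, W2]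
    refine ENNReal.rpow_le_rpow ?_ (by norm_num)
    refine (iInf₂_le (μ.map fun x => (Y x s, Y x t))
      ⟨Measure.fst_map_prodMk (hV.measurable_apply t),
        Measure.snd_map_prodMk (hV.measurable_apply s)⟩).trans_eq ?_
    rw [lintegral_map (f := fun p : E d × E d => edist p.1 p.2 ^ 2) (by fun_prop)
      ((hV.measurable_apply s).prodMk (hV.measurable_apply t))]

end IsVersion

/-! ### Orthogonal projection in `L²` -/

theorem lintegral_enorm_sq_eq_ofReal {Ω F : Type*} [MeasurableSpace Ω] [NormedAddCommGroup F]
    {m : Measure Ω} {f : Ω → F} (hf : MemLp f 2 m) :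
    ∫⁻ p, ‖f p‖ₑ ^ 2 ∂m = ENNReal.ofReal (∫ p, ‖f p‖ ^ 2 ∂m) := by
  rw [ofReal_integral_eq_lintegral_ofReal (by exact_mod_cast hf.integrable_norm_pow two_ne_zero)
    (Eventually.of_forall fun _ => by positivity)]
  refine lintegral_congr fun p => ?_
  rw [← ofReal_norm, ENNReal.ofReal_pow (norm_nonneg _)]

/-- Pythagoras' theorem in `L²`. -/
theorem lintegral_enorm_add_sq {Ω : Type*} [MeasurableSpace Ω] {m : Measure Ω} {f g : Ω → E d}
    (hf : MemLp f 2 m) (hg : MemLp g 2 m) (h : ∫ p, inner ℝ (f p) (g p) ∂m = 0) :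
    ∫⁻ p, ‖f p + g p‖ₑ ^ 2 ∂m = ∫⁻ p, ‖f p‖ₑ ^ 2 ∂m + ∫⁻ p, ‖g p‖ₑ ^ 2 ∂m := by
  have hs : ∀ {k : Ω → E d}, MemLp k 2 m → Integrable (fun p => ‖k p‖ ^ 2) m := fun hk => by
    exact_mod_cast hk.integrable_norm_pow two_ne_zero
  have hi : Integrable (fun p => inner ℝ (f p) (g p)) m := by
    have h1 := L2.integrable_inner (𝕜 := ℝ) (hf.toLp f) (hg.toLp g)
    refine h1.congr ?_
    filter_upwards [hf.coeFn_toLp, hg.coeFn_toLp] with p hp hq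
    rw [hp, hq]
  have e := lintegral_enorm_sq_eq_ofReal (hf.add hg)
  simp only [Pi.add_apply] at e
  rw [e, lintegral_enorm_sq_eq_ofReal hf, lintegral_enorm_sq_eq_ofReal hg,
    ← ENNReal.ofReal_add (by positivity) (by positivity)]
  congr 1
  have hfi : Integrable (fun p => ‖f p‖ ^ 2 + 2 * inner ℝ (f p) (g p)) m :=
    (hs hf).add (hi.const_mul 2)
  simp_rw [norm_add_sq_real]
  rw [integral_add hfi (hs hg), integral_add (hs hf) (hi.const_mul 2),
    integral_const_mul, h]
  ring

/-- The orthogonal projection of `u ∈ L²(m)` onto the fields that factor through `T`. -/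
theorem exists_orthogonal_factor {Ω Ω' : Type*} [MeasurableSpace Ω] [MeasurableSpace Ω']
    {m : Measure Ω} {T : Ω → Ω'} (hT : Measurable T) {u : Ω → E d} (hu : MemLp u 2 m) :
    ∃ v : Ω' → E d, Measurable v ∧ MemLp (v ∘ T) 2 m ∧
      ∀ w : Ω' → E d, Measurable w → MemLp (w ∘ T) 2 m →
        ∫ p, inner ℝ (w (T p)) (u p - v (T p)) ∂m = 0 := by
  have hmp : MeasurePreserving T m (m.map T) := hT.measurePreserving m
  let A := Lp.compMeasurePreservingₗᵢ (E := E d) (p := 2) ℝ T hmp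
  let U := hu.toLp u
  let V : Lp (E d) 2 (m.map T) := ContinuousLinearMap.adjoint A.toContinuousLinearMap U
  have hVm : AEStronglyMeasurable V (m.map T) := Lp.aestronglyMeasurable V
  have hV : MemLp (hVm.mk V) 2 (m.map T) := (Lp.memLp V).ae_eq hVm.ae_eq_mk
  have hVT : hVm.mk V ∘ T =ᵐ[m] A V :=
    (hmp.quasiMeasurePreserving.ae_eq_comp hVm.ae_eq_mk.symm).trans
      (Lp.coeFn_compMeasurePreserving V hmp).symm
  refine ⟨hVm.mk V, hVm.stronglyMeasurable_mk.measurable, hV.comp_measurePreserving hmp,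
    fun w hw hwT => ?_⟩
  have hw2 : MemLp w 2 (m.map T) :=
    (memLp_map_measure_iff hw.aestronglyMeasurable hT.aemeasurable).2 hwT
  have hAW : w ∘ T =ᵐ[m] A (hw2.toLp w) :=
    (hmp.quasiMeasurePreserving.ae_eq_comp hw2.coeFn_toLp.symm).trans
      (Lp.coeFn_compMeasurePreserving _ hmp).symm
  have key : inner ℝ (A (hw2.toLp w)) (U - A V) = 0 := by
    rw [inner_sub_right, A.inner_map_map, sub_eq_zero]
    exact (ContinuousLinearMap.adjoint_inner_right A.toContinuousLinearMap (hw2.toLp w) U).symm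
  rw [L2.inner_def] at key
  rw [← key]
  refine integral_congr_ae ?_
  filter_upwards [hAW, hVT, Lp.coeFn_sub U (A V), hu.coeFn_toLp] with p h1 h2 h3 h4
  simp only [Function.comp_apply] at h1 h2
  rw [h1, h2, h3, Pi.sub_apply, h4]

/-- The distance of `u` to a field `w ∘ T` in terms of its projection `v ∘ T`. -/
theorem lintegral_enorm_sub_sq_eq_add {Ω Ω' : Type*} [MeasurableSpace Ω] [MeasurableSpace Ω']
    {m : Measure Ω} {T : Ω → Ω'} {u : Ω → E d} (hu : MemLp u 2 m) {v w : Ω' → E d}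
    (hv : Measurable v) (hvT : MemLp (v ∘ T) 2 m)
    (horth : ∀ w : Ω' → E d, Measurable w → MemLp (w ∘ T) 2 m →
      ∫ p, inner ℝ (w (T p)) (u p - v (T p)) ∂m = 0)
    (hw : Measurable w) (hwT : MemLp (w ∘ T) 2 m) :
    ∫⁻ p, ‖w (T p) - u p‖ₑ ^ 2 ∂m =
      ∫⁻ p, ‖w (T p) - v (T p)‖ₑ ^ 2 ∂m + ∫⁻ p, ‖v (T p) - u p‖ₑ ^ 2 ∂m := by
  have h := lintegral_enorm_add_sq (hwT.sub hvT) (hvT.sub hu) (by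
    have := horth (w - v) (hw.sub hv) (hwT.sub hvT)
    rw [← neg_eq_zero, ← integral_neg, ← this]
    refine integral_congr_ae (Eventually.of_forall fun p => ?_)
    simp only [Pi.sub_apply, Function.comp_apply]
    rw [← inner_neg_right, neg_sub])
  simpa using h

/-! ### Flow matching -/

theorem flowMatchLoss_eq {μ : Measure (E d)} [SFinite μ] {X Y u : E d → ℝ → E d}
    (hV : IsVersion μ X Y u) {w : E d → ℝ → E d} (hw : Measurable fun p : E d × ℝ => w p.1 p.2) :
    flowMatchLoss μ X w = ∫⁻ p, ‖w (Y p.1 p.2) p.2 - u p.1 p.2‖ₑ ^ 2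
      ∂(μ.prod (volume.restrict (Icc (0 : ℝ) 1))) := by
  have hm : Measurable fun p : E d × ℝ => ‖w (Y p.1 p.2) p.2 - u p.1 p.2‖ₑ ^ 2 :=
    ((hw.comp (hV.meas.prodMk measurable_snd)).sub hV.meas_vel).enorm.pow_const 2
  rw [lintegral_prod_symm' _ hm, flowMatchLoss]
  refine lintegral_congr_ae ?_
  filter_upwards [hV.ae_ae_deriv_eq, ae_restrict_mem measurableSet_Icc] with t h1 ht
  refine lintegral_congr_ae ?_
  filter_upwards [h1, hV.apply_ae_eq ht] with x h2 h3
  rw [h2, h3]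

/-- Flow-matched fields exist, and along the trajectories each of them is the orthogonal projection
of the velocity onto the square-integrable functions of position and time. -/
theorem IsVersion.exists_isFlowMatched_and_orthogonal {μ : Measure (E d)} [SFinite μ]
    {X Y u : E d → ℝ → E d} (hV : IsVersion μ X Y u) :
    (∃ v, IsFlowMatched μ X v) ∧ ∀ v, IsFlowMatched μ X v →
      MemLp (fun p : E d × ℝ => v (Y p.1 p.2) p.2) 2 (μ.prod (volume.restrict (Icc (0 : ℝ) 1))) ∧
      ∀ w : E d → ℝ → E d, Measurable (fun p : E d × ℝ => w p.1 p.2) →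
        MemLp (fun p : E d × ℝ => w (Y p.1 p.2) p.2) 2
          (μ.prod (volume.restrict (Icc (0 : ℝ) 1))) →
        ∫ p, inner ℝ (w (Y p.1 p.2) p.2) (u p.1 p.2 - v (Y p.1 p.2) p.2)
          ∂(μ.prod (volume.restrict (Icc (0 : ℝ) 1))) = 0 := by
  set m := μ.prod (volume.restrict (Icc (0 : ℝ) 1)) with hm
  let T : E d × ℝ → E d × ℝ := fun p => (Y p.1 p.2, p.2)
  have hT : Measurable T := hV.meas.prodMk measurable_snd
  obtain ⟨V, hVm, hVT, horth⟩ := exists_orthogonal_factor hT hV.memLp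
  -- A field of finite loss is square integrable along the trajectories.
  have hmem : ∀ w : E d → ℝ → E d, Measurable (fun p : E d × ℝ => w p.1 p.2) →
      flowMatchLoss μ X w < ⊤ → MemLp ((fun p : E d × ℝ => w p.1 p.2) ∘ T) 2 m := by
    intro w hw hfin
    rw [flowMatchLoss_eq hV hw] at hfin
    have h1 : MemLp (fun p => w (Y p.1 p.2) p.2 - u p.1 p.2) 2 m :=
      memLp_two_of_lintegral_lt_top ((hw.comp hT).sub hV.meas_vel).aestronglyMeasurable hfin
    convert h1.add hV.memLp using 1
    ext1 p
    simp [T]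
  have hpyth : ∀ w : E d → ℝ → E d, Measurable (fun p : E d × ℝ => w p.1 p.2) →
      MemLp ((fun p : E d × ℝ => w p.1 p.2) ∘ T) 2 m → flowMatchLoss μ X w =
        ∫⁻ p, ‖w (T p).1 (T p).2 - V (T p)‖ₑ ^ 2 ∂m +
          flowMatchLoss μ X (fun x t => V (x, t)) := by
    intro w hw hwT
    rw [flowMatchLoss_eq hV hw, flowMatchLoss_eq hV (w := fun x t => V (x, t)) hVm]
    exact lintegral_enorm_sub_sq_eq_add (T := T) (u := fun p => u p.1 p.2) (v := V)
      (w := fun p => w p.1 p.2) hV.memLp hVm hVT horth hw hwT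
  have hVfin : flowMatchLoss μ X (fun x t => V (x, t)) < ⊤ := by
    have h0 := hpyth (fun _ _ => 0) measurable_const MemLp.zero'
    rw [flowMatchLoss_eq hV (w := fun _ _ => 0) measurable_const] at h0
    refine lt_of_le_of_lt (le_add_self.trans_eq h0.symm) ?_
    simp only [zero_sub, enorm_neg]
    exact hV.lintegral_enorm_sq_lt_top
  refine ⟨⟨fun x t => V (x, t), hVm, fun w hw => ?_⟩, fun v hv => ?_⟩
  · rcases (le_top : flowMatchLoss μ X w ≤ ⊤).lt_or_eq with hfin | htop
    · rw [hpyth w hw (hmem w hw hfin)]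
      exact le_add_self
    · rw [htop]; exact le_top
  · have hle := hv.2 (fun x t => V (x, t)) hVm
    have hvT := hmem v hv.1 (hle.trans_lt hVfin)
    refine ⟨hvT, fun w hw hwT => ?_⟩
    rw [hpyth v hv.1 hvT] at hle
    -- By Pythagoras, a minimizer coincides with the projection along the trajectories.
    have hzero : ∫⁻ p, ‖v (T p).1 (T p).2 - V (T p)‖ₑ ^ 2 ∂m = 0 := by
      by_contra hne
      exact absurd hle (not_le.2 (by
        rw [add_comm]; exact ENNReal.lt_add_right hVfin.ne hne))
    have hdm : Measurable fun p => ‖v (T p).1 (T p).2 - V (T p)‖ₑ ^ 2 :=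
      ((hv.1.comp hT).sub (hVm.comp hT)).enorm.pow_const 2
    rw [lintegral_eq_zero_iff hdm] at hzero
    rw [← horth _ hw hwT]
    refine integral_congr_ae ?_
    filter_upwards [hzero] with p hp
    have : v (Y p.1 p.2) p.2 = V (T p) := by simpa [T, sub_eq_zero] using hp
    rw [this]

theorem exists_norm_fderiv_le {φ : ℝ × E d → ℝ} (hφ : ContDiff ℝ ∞ φ) (hφc : HasCompactSupport φ) :
    ∃ C : ℝ≥0, ∀ z, ‖fderiv ℝ φ z‖ ≤ C := by
  obtain ⟨L, hL⟩ := (hφ.of_le (by simp)).lipschitzWith_of_hasCompactSupport hφc one_ne_zero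
  exact ⟨L, fun z => norm_fderiv_le_of_lipschitz ℝ hL⟩

/-- The spatial gradient of a space-time test function. -/
def spaceGrad (φ : ℝ × E d → ℝ) (x : E d) (t : ℝ) : E d :=
  (InnerProductSpace.toDual ℝ (E d)).symm
    ((fderiv ℝ φ (t, x)).comp (ContinuousLinearMap.inr ℝ ℝ (E d)))

theorem inner_spaceGrad_sub (φ : ℝ × E d → ℝ) (x y z : E d) (t : ℝ) :
    inner ℝ (spaceGrad φ x t) (y - z) = fderiv ℝ φ (t, x) (1, y) - fderiv ℝ φ (t, x) (1, z) := by
  rw [spaceGrad, InnerProductSpace.toDual_symm_apply, ← map_sub]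
  simp

theorem norm_spaceGrad_le {φ : ℝ × E d → ℝ} {C : ℝ≥0} (hC : ∀ z, ‖fderiv ℝ φ z‖ ≤ C) (x : E d)
    (t : ℝ) : ‖spaceGrad φ x t‖ ≤ C := by
  rw [spaceGrad, LinearIsometryEquiv.norm_map]
  refine (ContinuousLinearMap.opNorm_comp_le _ _).trans ?_
  exact (mul_le_of_le_one_right (norm_nonneg _)
    (ContinuousLinearMap.norm_inr_le_one ℝ ℝ (E d))).trans (hC _)

theorem continuous_spaceGrad {φ : ℝ × E d → ℝ} (hφ : ContDiff ℝ ∞ φ) :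
    Continuous fun p : E d × ℝ => spaceGrad φ p.1 p.2 := by
  have h1 : Continuous fun p : E d × ℝ => fderiv ℝ φ (p.2, p.1) :=
    (hφ.continuous_fderiv (by simp)).comp continuous_swap
  exact (LinearIsometryEquiv.continuous _).comp (h1.clm_comp continuous_const)

/-- The laws of a map in `C_X` solve the continuity equation with any flow-matched field: tested
against a gradient, which is a function of the position, the flow-matched field can be replaced by
the velocity. -/
theorem IsVersion.continuityEq {μ : Measure (E d)} [IsFiniteMeasure μ] {X Y u : E d → ℝ → E d}
    (hV : IsVersion μ X Y u) {v : E d → ℝ → E d} (hv : IsFlowMatched μ X v) :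
    ContinuityEq (pushCurve μ X) v := by
  intro φ hφ hφc hφs
  obtain ⟨hvT, horth⟩ := hV.exists_isFlowMatched_and_orthogonal.2 v hv
  set m := μ.prod (volume.restrict (Icc (0 : ℝ) 1)) with hm
  obtain ⟨C, hC⟩ := exists_norm_fderiv_le hφ hφc
  have heval : Measurable fun q : (ℝ × E d →L[ℝ] ℝ) × (ℝ × E d) => q.1 q.2 :=
    (by fun_prop : Continuous fun q : (ℝ × E d →L[ℝ] ℝ) × (ℝ × E d) => q.1 q.2).measurable
  have hfd : Measurable (fderiv ℝ φ) := (hφ.continuous_fderiv (by simp)).measurable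
  have hmeas : ∀ {g : E d × ℝ → E d}, Measurable g →
      Measurable fun p : E d × ℝ => fderiv ℝ φ (p.2, Y p.1 p.2) (1, g p) := fun hg =>
    heval.comp ((hfd.comp (measurable_snd.prodMk hV.meas)).prodMk (measurable_const.prodMk hg))
  have hint : ∀ {g : E d × ℝ → E d}, Measurable g → MemLp g 2 m →
      Integrable (fun p : E d × ℝ => fderiv ℝ φ (p.2, Y p.1 p.2) (1, g p)) m := by
    intro g hgm hg
    refine (((integrable_const (1 : ℝ)).add (hg.integrable one_le_two).norm).const_mul
      (C : ℝ)).mono' (hmeas hgm).aestronglyMeasurable (Eventually.of_forall fun p => ?_)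
    refine (ContinuousLinearMap.le_opNorm _ _).trans ?_
    refine mul_le_mul (hC _) ?_ (norm_nonneg _) C.2
    rw [Prod.norm_def]
    simp only [norm_one, Pi.add_apply]
    exact max_le_add_of_nonneg zero_le_one (norm_nonneg _)
  have hvm : Measurable fun p : E d × ℝ => v (Y p.1 p.2) p.2 :=
    hv.1.comp (hV.meas.prodMk measurable_snd)
  calc ∫ t in Icc (0 : ℝ) 1, ∫ x, fderiv ℝ φ (t, x) (1, v x t) ∂(pushCurve μ X t)
      = ∫ t in Icc (0 : ℝ) 1, ∫ x, fderiv ℝ φ (t, Y x t) (1, v (Y x t) t) ∂μ := by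
        refine setIntegral_congr_fun measurableSet_Icc fun t ht => ?_
        rw [hV.pushCurve_eq ht, integral_map (hV.measurable_apply t).aemeasurable]
        refine (Measurable.aestronglyMeasurable ?_)
        exact heval.comp ((hfd.comp (measurable_const.prodMk measurable_id)).prodMk
          (measurable_const.prodMk (hv.1.comp (measurable_id.prodMk measurable_const))))
    _ = ∫ p, fderiv ℝ φ (p.2, Y p.1 p.2) (1, v (Y p.1 p.2) p.2) ∂m :=
        (integral_prod_symm _ (hint hvm hvT)).symm
    _ = ∫ p, fderiv ℝ φ (p.2, Y p.1 p.2) (1, u p.1 p.2) ∂m := by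
        have h1 := horth (spaceGrad φ) (continuous_spaceGrad hφ).measurable
          (MemLp.of_bound (((continuous_spaceGrad hφ).measurable.comp
            (hV.meas.prodMk measurable_snd)).aestronglyMeasurable) C
            (Eventually.of_forall fun p => norm_spaceGrad_le hC _ _))
        have h2 : ∀ p : E d × ℝ,
            inner ℝ (spaceGrad φ (Y p.1 p.2) p.2) (u p.1 p.2 - v (Y p.1 p.2) p.2) = _ :=
          fun p => inner_spaceGrad_sub φ _ _ _ _
        rw [integral_congr_ae (Eventually.of_forall h2),
          integral_sub (hint hV.meas_vel hV.memLp) (hint hvm hvT), sub_eq_zero] at h1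
        exact h1.symm
    _ = ∫ x, (∫ t in Icc (0 : ℝ) 1, fderiv ℝ φ (t, Y x t) (1, u x t)) ∂μ :=
        integral_prod _ (hint hV.meas_vel hV.memLp)
    _ = ∫ x, 0 ∂μ := by
        refine integral_congr_ae ?_
        filter_upwards [hV.ae_eq] with x hx
        exact integral_fderiv_trajectory_eq_zero hx.1 hx.2.2.2 hφ hφc hφs
    _ = 0 := integral_zero _ _

theorem IsVersion.lintegral_deriv_sq {μ : Measure (E d)} [SFinite μ] {X Y u : E d → ℝ → E d}
    (hV : IsVersion μ X Y u) :
    ∫⁻ x, (∫⁻ t in Icc (0 : ℝ) 1, ‖deriv (X x) t‖ₑ ^ 2) ∂μ =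
      ∫⁻ p, ‖u p.1 p.2‖ₑ ^ 2 ∂(μ.prod (volume.restrict (Icc (0 : ℝ) 1))) := by
  rw [lintegral_prod _ (hV.meas_vel.enorm.pow_const 2).aemeasurable]
  refine lintegral_congr_ae ?_
  filter_upwards [hV.ae_ae_hasDerivAt] with x hx
  refine lintegral_congr_ae ?_
  filter_upwards [hx] with t ht
  rw [ht.deriv]

/-- Orthogonal projection does not increase the kinetic energy. -/
theorem IsVersion.lintegral_flowMatched_sq_le {μ : Measure (E d)} [SFinite μ]
    {X Y u : E d → ℝ → E d} (hV : IsVersion μ X Y u) {v : E d → ℝ → E d}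
    (hv : IsFlowMatched μ X v) :
    ∫⁻ t in Icc (0 : ℝ) 1, ∫⁻ x, ‖v x t‖ₑ ^ 2 ∂(pushCurve μ X t) ≤
      ∫⁻ x, (∫⁻ t in Icc (0 : ℝ) 1, ‖deriv (X x) t‖ₑ ^ 2) ∂μ := by
  obtain ⟨hvT, horth⟩ := hV.exists_isFlowMatched_and_orthogonal.2 v hv
  rw [hV.lintegral_deriv_sq, hV.lintegral_pushCurve (f := fun p => ‖v p.1 p.2‖ₑ ^ 2)
    (hv.1.enorm.pow_const 2)]
  have h := lintegral_enorm_add_sq hvT (hV.memLp.sub hvT) (horth v hv.1 hvT)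
  simp only [Pi.sub_apply, add_sub_cancel] at h
  exact h ▸ le_self_add

theorem CX.exists_isFlowMatched {μ : Measure (E d)} [IsProbabilityMeasure μ] {X : E d → ℝ → E d}
    (hX : CX μ X) : ∃ v, IsFlowMatched μ X v := by
  obtain ⟨Y, u, hV⟩ := hX.exists_isVersion
  exact hV.exists_isFlowMatched_and_orthogonal.1

/-- A flow-matched Eulerian representation of a map in `C_X` is admissible, and has no more kinetic
energy than the map. -/
theorem IsFlowMatched.cRhoV {μ : Measure (E d)} (hμ : IsP2 μ) {X v : E d → ℝ → E d}
    (hX : CX μ X) (hv : IsFlowMatched μ X v) : CRhoV μ (pushCurve μ X) v ∧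
    ∫⁻ t in Icc (0 : ℝ) 1, ∫⁻ x, ‖v x t‖ₑ ^ 2 ∂(pushCurve μ X t) ≤
      ∫⁻ x, (∫⁻ t in Icc (0 : ℝ) 1, ‖deriv (X x) t‖ₑ ^ 2) ∂μ := by
  have := hμ.1
  obtain ⟨Y, u, hV⟩ := hX.exists_isVersion
  have hle := hV.lintegral_flowMatched_sq_le hv
  refine ⟨⟨hV.cRho_pushCurve hμ, hV.pushCurve_zero, hv.1, hle.trans_lt ?_, hV.continuityEq hv⟩, hle⟩
  rw [hV.lintegral_deriv_sq]
  exact hV.lintegral_enorm_sq_lt_top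

/-! ### Comparison of costs -/

theorem extDiff_mono_left {a a' b : ℝ≥0∞} (h : a ≤ a') : extDiff a b ≤ extDiff a' b := by
  unfold extDiff
  split_ifs with h1 h2
  · exact le_rfl
  · exact absurd (top_le_iff.1 (h1 ▸ h)) h2
  · exact le_top
  · exact EReal.sub_le_sub (by exact_mod_cast h) le_rfl

/-- Characteristics have the kinetic energy of their velocity field. -/
theorem CXV.lintegral_sq_eq {μ : Measure (E d)} [IsProbabilityMeasure μ] {X v : E d → ℝ → E d}
    (h : CXV μ X v) (hv : Measurable fun p : E d × ℝ => v p.1 p.2) :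
    ∫⁻ t in Icc (0 : ℝ) 1, ∫⁻ x, ‖v x t‖ₑ ^ 2 ∂(pushCurve μ X t) =
      ∫⁻ x, (∫⁻ t in Icc (0 : ℝ) 1, ‖deriv (X x) t‖ₑ ^ 2) ∂μ := by
  obtain ⟨Y, u, hV⟩ := h.1.exists_isVersion
  have hm : Measurable fun p : E d × ℝ => ‖v (Y p.1 p.2) p.2‖ₑ ^ 2 :=
    (hv.comp (hV.meas.prodMk measurable_snd)).enorm.pow_const 2
  rw [hV.lintegral_pushCurve (f := fun p => ‖v p.1 p.2‖ₑ ^ 2) (hv.enorm.pow_const 2),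
    lintegral_prod _ hm.aemeasurable]
  refine lintegral_congr_ae ?_
  filter_upwards [h.2, hV.ae_eq] with x h1 h2
  refine lintegral_congr_ae ?_
  filter_upwards [h1, ae_restrict_mem measurableSet_Icc] with t h3 ht
  rw [h3, h2.2.2.1 t ht]

/-- The parts of the cost that do not involve the velocity depend on the laws only. -/
theorem CX.lintegral_cost {μ : Measure (E d)} [IsProbabilityMeasure μ] {X : E d → ℝ → E d}
    (hX : CX μ X) {f : ℝ → E d → ℝ≥0∞} {g : E d → ℝ≥0∞}
    (hf : Measurable fun p : Icc (0 : ℝ) 1 × E d => f p.1 p.2) (hg : Measurable g) :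
    ∫⁻ x, ((∫⁻ t in Icc (0 : ℝ) 1, f t (X x t)) + g (X x 1)) ∂μ =
      (∫⁻ t in Icc (0 : ℝ) 1, ∫⁻ y, f t y ∂(pushCurve μ X t)) + ∫⁻ y, g y ∂(pushCurve μ X 1) := by
  obtain ⟨Y, u, hV⟩ := hX.exists_isVersion
  have h1 : (1 : ℝ) ∈ Icc (0 : ℝ) 1 := ⟨zero_le_one, le_rfl⟩
  let f' : E d × ℝ → ℝ≥0∞ := fun p => f (projIcc (0 : ℝ) 1 zero_le_one p.2) p.1
  have hf' : Measurable f' := hf.comp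
    (((continuous_projIcc (h := zero_le_one)).measurable.comp measurable_snd).prodMk measurable_fst)
  have hff' : ∀ t ∈ Icc (0 : ℝ) 1, ∀ y, f t y = f' (y, t) := fun t ht y => by
    simp only [f', projIcc_of_mem zero_le_one ht]
  have hfY : Measurable fun p : E d × ℝ => f' (Y p.1 p.2, p.2) :=
    hf'.comp (hV.meas.prodMk measurable_snd)
  calc ∫⁻ x, ((∫⁻ t in Icc (0 : ℝ) 1, f t (X x t)) + g (X x 1)) ∂μ
      = ∫⁻ x, ((∫⁻ t in Icc (0 : ℝ) 1, f' (Y x t, t)) + g (Y x 1)) ∂μ := by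
        refine lintegral_congr_ae ?_
        filter_upwards [hV.ae_eq] with x hx
        rw [hx.2.2.1 1 h1]
        congr 1
        refine setLIntegral_congr_fun measurableSet_Icc fun t ht => ?_
        simp only [hx.2.2.1 t ht, hff' t ht]
    _ = ∫⁻ x, (∫⁻ t in Icc (0 : ℝ) 1, f' (Y x t, t)) ∂μ + ∫⁻ x, g (Y x 1) ∂μ :=
        lintegral_add_left hfY.lintegral_prod_right' _
    _ = _ := by
        rw [hV.pushCurve_eq h1, lintegral_map hg (hV.measurable_apply 1)]
        congr 1
        rw [← lintegral_prod _ hfY.aemeasurable, ← hV.lintegral_pushCurve hf']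
        refine setLIntegral_congr_fun measurableSet_Icc fun t ht => ?_
        simp only [hff' t ht]

theorem CX.lintegral_kinetic_add_cost {μ : Measure (E d)} [IsProbabilityMeasure μ]
    {X : E d → ℝ → E d} (hX : CX μ X) {f : ℝ → E d → ℝ≥0∞} {g : E d → ℝ≥0∞}
    (hf : Measurable fun p : Icc (0 : ℝ) 1 × E d => f p.1 p.2) (hg : Measurable g) :
    ∫⁻ x, ((∫⁻ t in Icc (0 : ℝ) 1, (2⁻¹ * ‖deriv (X x) t‖ₑ ^ 2 + f t (X x t))) + g (X x 1)) ∂μ =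
      2⁻¹ * ∫⁻ x, (∫⁻ t in Icc (0 : ℝ) 1, ‖deriv (X x) t‖ₑ ^ 2) ∂μ +
      ((∫⁻ t in Icc (0 : ℝ) 1, ∫⁻ y, f t y ∂(pushCurve μ X t)) + ∫⁻ y, g y ∂(pushCurve μ X 1)) := by
  obtain ⟨Y, u, hV⟩ := hX.exists_isVersion
  have hu : Measurable fun p : E d × ℝ => ‖u p.1 p.2‖ₑ ^ 2 := hV.meas_vel.enorm.pow_const 2
  have hI : Measurable fun x => ∫⁻ t in Icc (0 : ℝ) 1, ‖u x t‖ₑ ^ 2 := hu.lintegral_prod_right'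
  have hder : ∀ᵐ x ∂μ, ∫⁻ t in Icc (0 : ℝ) 1, ‖deriv (X x) t‖ₑ ^ 2 =
      ∫⁻ t in Icc (0 : ℝ) 1, ‖u x t‖ₑ ^ 2 := by
    filter_upwards [hV.ae_ae_hasDerivAt] with x hx
    refine lintegral_congr_ae ?_
    filter_upwards [hx] with t ht
    rw [ht.deriv]
  rw [← hX.lintegral_cost hf hg, lintegral_congr_ae hder, ← lintegral_const_mul _ hI,
    ← lintegral_add_left (hI.const_mul _)]
  refine lintegral_congr_ae ?_
  filter_upwards [hder] with x hx
  have hdm : Measurable fun t => ‖deriv (X x) t‖ₑ ^ 2 := (measurable_deriv _).enorm.pow_const 2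
  rw [← hx, ← add_assoc, ← lintegral_const_mul _ hdm, ← lintegral_add_left (hdm.const_mul _)]

theorem CRho.lintegral_kinetic_add_cost {ρ : ℝ → Measure (E d)} (hρ : CRho ρ) {v : E d → ℝ → E d}
    (hv : Measurable fun p : E d × ℝ => v p.1 p.2) (f : ℝ → E d → ℝ≥0∞) (a : ℝ≥0∞) :
    (∫⁻ t in Icc (0 : ℝ) 1, ∫⁻ x, (2⁻¹ * ‖v x t‖ₑ ^ 2 + f t x) ∂(ρ t)) + a =
      2⁻¹ * (∫⁻ t in Icc (0 : ℝ) 1, ∫⁻ x, ‖v x t‖ₑ ^ 2 ∂(ρ t)) +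
      ((∫⁻ t in Icc (0 : ℝ) 1, ∫⁻ x, f t x ∂(ρ t)) + a) := by
  obtain ⟨κ, hκ, hκρ⟩ := hρ.exists_kernel
  have hm : Measurable fun t => ∫⁻ x, ‖v x t‖ₑ ^ 2 ∂(κ t) :=
    Measurable.lintegral_kernel_prod_right' (f := fun p : ℝ × E d => ‖v p.2 p.1‖ₑ ^ 2)
      ((hv.comp measurable_swap).enorm.pow_const 2)
  have e : ∫⁻ t in Icc (0 : ℝ) 1, ∫⁻ x, ‖v x t‖ₑ ^ 2 ∂(ρ t) =
      ∫⁻ t in Icc (0 : ℝ) 1, ∫⁻ x, ‖v x t‖ₑ ^ 2 ∂(κ t) :=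
    setLIntegral_congr_fun measurableSet_Icc fun t ht => by simp only [hκρ t ht]
  rw [e, ← add_assoc, ← lintegral_const_mul _ hm, ← lintegral_add_left (hm.const_mul _)]
  congr 1
  refine setLIntegral_congr_fun measurableSet_Icc fun t ht => ?_
  have hvt : Measurable fun x => ‖v x t‖ₑ ^ 2 :=
    (hv.comp (by fun_prop : Measurable fun x : E d => (x, t))).enorm.pow_const 2
  rw [hκρ t ht, ← lintegral_const_mul _ hvt, lintegral_add_left (hvt.const_mul _)]

section Congr

variable {μ : Measure (E d)} {ρ σ : ℝ → Measure (E d)} {v : E d → ℝ → E d}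

theorem CRhoV.congr (h : CRhoV μ ρ v) (hρ : ∀ t ∈ Icc (0 : ℝ) 1, ρ t = σ t) : CRhoV μ σ v where
  curve := by
    obtain ⟨h1, m, hm, h2⟩ := h.curve
    refine ⟨fun t ht => hρ t ht ▸ h1 t ht, m, hm, fun s t hs hst ht => ?_⟩
    rw [← hρ s ⟨hs, hst.trans ht⟩, ← hρ t ⟨hs.trans hst, ht⟩]
    exact h2 s t hs hst ht
  init := (hρ 0 (left_mem_Icc.2 zero_le_one)).symm.trans h.init
  meas := h.meas
  sq_int := by
    refine lt_of_eq_of_lt (setLIntegral_congr_fun measurableSet_Icc fun t ht => ?_) h.sq_int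
    simp only [hρ t ht]
  cont_eq φ h1 h2 h3 := by
    refine (setIntegral_congr_fun measurableSet_Icc fun t ht => ?_).trans (h.cont_eq φ h1 h2 h3)
    simp only [hρ t ht]

theorem costEuler_congr (F G : Measure (E d) → E d → EReal) {ρ' σ' : ℝ → Measure (E d)}
    (hρ' : ∀ t ∈ Icc (0 : ℝ) 1, ρ' t = σ' t) (hρ : ∀ t ∈ Icc (0 : ℝ) 1, ρ t = σ t) :
    costEuler F G ρ' v ρ = costEuler F G σ' v σ := by
  have h1 : (1 : ℝ) ∈ Icc (0 : ℝ) 1 := ⟨zero_le_one, le_rfl⟩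
  unfold costEuler
  rw [hρ 1 h1, hρ' 1 h1]
  congr 2 <;>
    exact setLIntegral_congr_fun measurableSet_Icc fun t ht => by simp only [hρ t ht, hρ' t ht]

theorem potCostEuler_congr (Φ Ψ : Measure (E d) → EReal) (hρ : ∀ t ∈ Icc (0 : ℝ) 1, ρ t = σ t) :
    potCostEuler Φ Ψ ρ v = potCostEuler Φ Ψ σ v := by
  unfold potCostEuler
  rw [hρ 1 ⟨zero_le_one, le_rfl⟩]
  congr 2
  on_goal 1 => congr 1
  all_goals
    exact setLIntegral_congr_fun measurableSet_Icc fun t ht => by simp only [hρ t ht]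

theorem SolvesEulerMFG.congr {F G : Measure (E d) → E d → EReal} (h : SolvesEulerMFG μ F G ρ v)
    (hρ : ∀ t ∈ Icc (0 : ℝ) 1, ρ t = σ t) : SolvesEulerMFG μ F G σ v := by
  refine ⟨h.1.congr hρ, fun ρ' v' h' => ?_⟩
  rw [← costEuler_congr F G hρ hρ, ← costEuler_congr F G (fun _ _ => rfl) hρ]
  exact h.2 ρ' v' h'

theorem SolvesEulerPot.congr {Φ Ψ : Measure (E d) → EReal} (h : SolvesEulerPot μ Φ Ψ ρ v)
    (hρ : ∀ t ∈ Icc (0 : ℝ) 1, ρ t = σ t) : SolvesEulerPot μ Φ Ψ σ v := by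
  refine ⟨h.1.congr hρ, fun ρ' v' h' => ?_⟩
  rw [← potCostEuler_congr Φ Ψ hρ]
  exact h.2 ρ' v' h'

end Congr

section Costs

variable {μ : Measure (E d)} {X v : E d → ℝ → E d}

theorem costLagr_eq_extDiff [IsProbabilityMeasure μ] {F G : Measure (E d) → E d → EReal}
    (hFG : MeasurableCouplings F G) (hX : CX μ X) {ρ : ℝ → Measure (E d)} (hρ : CRho ρ) :
    costLagr μ F G X ρ = extDiff
      (2⁻¹ * ∫⁻ x, (∫⁻ t in Icc (0 : ℝ) 1, ‖deriv (X x) t‖ₑ ^ 2) ∂μ +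
        ((∫⁻ t in Icc (0 : ℝ) 1, ∫⁻ y, (F (ρ t) y).toENNReal ∂(pushCurve μ X t)) +
          ∫⁻ y, (G (ρ 1) y).toENNReal ∂(pushCurve μ X 1)))
      ((∫⁻ t in Icc (0 : ℝ) 1, ∫⁻ y, (-F (ρ t) y).toENNReal ∂(pushCurve μ X t)) +
          ∫⁻ y, (-G (ρ 1) y).toENNReal ∂(pushCurve μ X 1)) := by
  obtain ⟨hF, hG⟩ := hFG ρ hρ
  rw [costLagr, hX.lintegral_kinetic_add_cost (f := fun t y => (F (ρ t) y).toENNReal)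
      (g := fun y => (G (ρ 1) y).toENNReal) hF.ereal_toENNReal hG.ereal_toENNReal,
    hX.lintegral_cost (f := fun t y => (-F (ρ t) y).toENNReal)
      (g := fun y => (-G (ρ 1) y).toENNReal) hF.neg.ereal_toENNReal hG.neg.ereal_toENNReal]

theorem CRho.costEuler_eq_extDiff {σ : ℝ → Measure (E d)} (hσ : CRho σ)
    (hv : Measurable fun p : E d × ℝ => v p.1 p.2) (F G : Measure (E d) → E d → EReal)
    (ρ : ℝ → Measure (E d)) : costEuler F G σ v ρ = extDiff
      (2⁻¹ * (∫⁻ t in Icc (0 : ℝ) 1, ∫⁻ x, ‖v x t‖ₑ ^ 2 ∂(σ t)) +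
        ((∫⁻ t in Icc (0 : ℝ) 1, ∫⁻ y, (F (ρ t) y).toENNReal ∂(σ t)) +
          ∫⁻ y, (G (ρ 1) y).toENNReal ∂(σ 1)))
      ((∫⁻ t in Icc (0 : ℝ) 1, ∫⁻ y, (-F (ρ t) y).toENNReal ∂(σ t)) +
          ∫⁻ y, (-G (ρ 1) y).toENNReal ∂(σ 1)) := by
  rw [costEuler, hσ.lintegral_kinetic_add_cost hv fun t y => (F (ρ t) y).toENNReal]

/-- Characteristics have the individual cost of their velocity field. -/
theorem CXV.costLagr_eq [IsProbabilityMeasure μ] {F G : Measure (E d) → E d → EReal}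
    (hFG : MeasurableCouplings F G) (h : CXV μ X v) (hv : CRhoV μ (pushCurve μ X) v)
    {ρ : ℝ → Measure (E d)} (hρ : CRho ρ) :
    costLagr μ F G X ρ = costEuler F G (pushCurve μ X) v ρ := by
  rw [costLagr_eq_extDiff hFG h.1 hρ, hv.curve.costEuler_eq_extDiff hv.meas,
    h.lintegral_sq_eq hv.meas]

/-- Flow matching does not increase the individual cost. -/
theorem IsFlowMatched.costEuler_le {F G : Measure (E d) → E d → EReal} (hμ : IsP2 μ)
    (hFG : MeasurableCouplings F G) (hX : CX μ X) (hv : IsFlowMatched μ X v)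
    {ρ : ℝ → Measure (E d)} (hρ : CRho ρ) :
    costEuler F G (pushCurve μ X) v ρ ≤ costLagr μ F G X ρ := by
  have := hμ.1
  obtain ⟨h1, h2⟩ := hv.cRhoV hμ hX
  rw [costLagr_eq_extDiff hFG hX hρ, h1.curve.costEuler_eq_extDiff hv.1]
  exact extDiff_mono_left (by gcongr)

theorem potCostLagr_eq_extDiff (Φ Ψ : Measure (E d) → EReal) : potCostLagr μ Φ Ψ X = extDiff
    (2⁻¹ * ∫⁻ x, (∫⁻ t in Icc (0 : ℝ) 1, ‖deriv (X x) t‖ₑ ^ 2) ∂μ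
      + (∫⁻ t in Icc (0 : ℝ) 1, (Φ (pushCurve μ X t)).toENNReal) + (Ψ (pushCurve μ X 1)).toENNReal)
    ((∫⁻ t in Icc (0 : ℝ) 1, (-Φ (pushCurve μ X t)).toENNReal)
      + (-Ψ (pushCurve μ X 1)).toENNReal) := by
  have h2 : (2⁻¹ : ℝ≥0∞) ≠ ⊤ := by simp
  simp_rw [potCostLagr, lintegral_const_mul' _ _ h2]

theorem potCostEuler_eq_extDiff (Φ Ψ : Measure (E d) → EReal) (ρ : ℝ → Measure (E d))
    (v : E d → ℝ → E d) : potCostEuler Φ Ψ ρ v = extDiff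
    (2⁻¹ * (∫⁻ t in Icc (0 : ℝ) 1, ∫⁻ x, ‖v x t‖ₑ ^ 2 ∂(ρ t))
      + (∫⁻ t in Icc (0 : ℝ) 1, (Φ (ρ t)).toENNReal) + (Ψ (ρ 1)).toENNReal)
    ((∫⁻ t in Icc (0 : ℝ) 1, (-Φ (ρ t)).toENNReal) + (-Ψ (ρ 1)).toENNReal) := by
  have h2 : (2⁻¹ : ℝ≥0∞) ≠ ⊤ := by simp
  simp_rw [potCostEuler, lintegral_const_mul' _ _ h2]

/-- Characteristics have the population cost of their velocity field. -/
theorem CXV.potCostLagr_eq [IsProbabilityMeasure μ] (Φ Ψ : Measure (E d) → EReal) (h : CXV μ X v)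
    (hv : Measurable fun p : E d × ℝ => v p.1 p.2) :
    potCostLagr μ Φ Ψ X = potCostEuler Φ Ψ (pushCurve μ X) v := by
  rw [potCostLagr_eq_extDiff, potCostEuler_eq_extDiff, h.lintegral_sq_eq hv]

/-- Flow matching does not increase the population cost. -/
theorem IsFlowMatched.potCostEuler_le (Φ Ψ : Measure (E d) → EReal) (hμ : IsP2 μ) (hX : CX μ X)
    (hv : IsFlowMatched μ X v) :
    potCostEuler Φ Ψ (pushCurve μ X) v ≤ potCostLagr μ Φ Ψ X := by
  rw [potCostLagr_eq_extDiff, potCostEuler_eq_extDiff]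
  have := (hv.cRhoV hμ hX).2
  exact extDiff_mono_left (by gcongr)

theorem SolvesEulerMFG.solvesLagrMFG {F G : Measure (E d) → E d → EReal} (hμ : IsP2 μ)
    (hFG : MeasurableCouplings F G) (h : SolvesEulerMFG μ F G (pushCurve μ X) v) (hX : CXV μ X v) :
    SolvesLagrMFG μ F G X := by
  have := hμ.1
  refine ⟨hX.1, fun X' hX' => ?_⟩
  obtain ⟨v', hv'⟩ := hX'.exists_isFlowMatched
  calc costLagr μ F G X (pushCurve μ X) = costEuler F G (pushCurve μ X) v (pushCurve μ X) :=
        hX.costLagr_eq hFG h.1 h.1.curve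
    _ ≤ costEuler F G (pushCurve μ X') v' (pushCurve μ X) := h.2 _ _ (hv'.cRhoV hμ hX').1
    _ ≤ costLagr μ F G X' (pushCurve μ X) := hv'.costEuler_le hμ hFG hX' h.1.curve

theorem SolvesEulerPot.solvesLagrPot {Φ Ψ : Measure (E d) → EReal} (hμ : IsP2 μ)
    (h : SolvesEulerPot μ Φ Ψ (pushCurve μ X) v) (hX : CXV μ X v) : SolvesLagrPot μ Φ Ψ X := by
  have := hμ.1
  refine ⟨hX.1, fun X' hX' => ?_⟩
  obtain ⟨v', hv'⟩ := hX'.exists_isFlowMatched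
  calc potCostLagr μ Φ Ψ X = potCostEuler Φ Ψ (pushCurve μ X) v := hX.potCostLagr_eq Φ Ψ h.1.meas
    _ ≤ potCostEuler Φ Ψ (pushCurve μ X') v' := h.2 _ _ (hv'.cRhoV hμ hX').1
    _ ≤ potCostLagr μ Φ Ψ X' := hv'.potCostEuler_le Φ Ψ hμ hX'

/-- Once the Lagrangian and Eulerian minimal costs agree, flow matching a Lagrangian solution
leaves no room for a strict inequality. -/
theorem SolvesLagrPot.solvesEulerPot {Φ Ψ : Measure (E d) → EReal} (hμ : IsP2 μ)
    {ρs : ℝ → Measure (E d)} {Xs vs : E d → ℝ → E d} (hs : SolvesEulerPot μ Φ Ψ ρs vs)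
    (hXs : CX μ Xs) (hcost : potCostLagr μ Φ Ψ Xs = potCostEuler Φ Ψ ρs vs)
    (hX : SolvesLagrPot μ Φ Ψ X) (hv : IsFlowMatched μ X v) :
    SolvesEulerPot μ Φ Ψ (pushCurve μ X) v ∧
      potCostLagr μ Φ Ψ X = potCostEuler Φ Ψ (pushCurve μ X) v ∧
      potCostEuler Φ Ψ (pushCurve μ X) v = potCostEuler Φ Ψ ρs vs := by
  have hadm := (hv.cRhoV hμ hX.1).1
  have h1 := hv.potCostEuler_le Φ Ψ hμ hX.1
  have h2 := (hX.2 Xs hXs).trans_eq hcost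
  have h3 := hs.2 _ _ hadm
  refine ⟨⟨hadm, fun ρ' v' h' => (h1.trans h2).trans (hs.2 ρ' v' h')⟩, ?_, ?_⟩
  · exact le_antisymm (h2.trans h3) h1
  · exact le_antisymm (h1.trans h2) h3

end Costs

end MFG

end

theorem theorem1 (d : ℕ) (μ : MeasureTheory.Measure (MFG.E d)) (hμ : MFG.IsP2r μ) :
    -- (i) general mean-field games
    (∀ F G : MeasureTheory.Measure (MFG.E d) → MFG.E d → EReal, MFG.MeasurableCouplings F G →
      ∀ (ρs : ℝ → MeasureTheory.Measure (MFG.E d)) (vs : MFG.E d → ℝ → MFG.E d),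
        MFG.SolvesEulerMFG μ F G ρs vs → MFG.CV vs →
          (∃ Xs : MFG.E d → ℝ → MFG.E d, MFG.CXV μ Xs vs) ∧
          ∀ Xs : MFG.E d → ℝ → MFG.E d, MFG.CXV μ Xs vs →
            (∀ t ∈ Set.Icc (0 : ℝ) 1, MFG.pushCurve μ Xs t = ρs t) ∧
            MFG.SolvesLagrMFG μ F G Xs) ∧
    -- (ii) potential mean-field games
    (∀ Φ Ψ : MeasureTheory.Measure (MFG.E d) → EReal,
      ∀ (ρs : ℝ → MeasureTheory.Measure (MFG.E d)) (vs : MFG.E d → ℝ → MFG.E d),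
        MFG.SolvesEulerPot μ Φ Ψ ρs vs → MFG.CV vs →
          (∃ Xs : MFG.E d → ℝ → MFG.E d, MFG.CXV μ Xs vs) ∧
          (∀ Xs : MFG.E d → ℝ → MFG.E d, MFG.CXV μ Xs vs →
            (∀ t ∈ Set.Icc (0 : ℝ) 1, MFG.pushCurve μ Xs t = ρs t) ∧
            MFG.SolvesLagrPot μ Φ Ψ Xs ∧
            MFG.potCostLagr μ Φ Ψ Xs = MFG.potCostEuler Φ Ψ ρs vs) ∧
          (∀ X : MFG.E d → ℝ → MFG.E d, MFG.SolvesLagrPot μ Φ Ψ X →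
            (∃ v : MFG.E d → ℝ → MFG.E d, MFG.IsFlowMatched μ X v) ∧
            ∀ v : MFG.E d → ℝ → MFG.E d, MFG.IsFlowMatched μ X v →
              MFG.SolvesEulerPot μ Φ Ψ (MFG.pushCurve μ X) v ∧
              MFG.potCostLagr μ Φ Ψ X = MFG.potCostEuler Φ Ψ (MFG.pushCurve μ X) v ∧
              MFG.potCostEuler Φ Ψ (MFG.pushCurve μ X) v = MFG.potCostEuler Φ Ψ ρs vs)) := by
  have := hμ.1.1
  refine ⟨fun F G hFG ρs vs hs hv => ⟨hs.1.exists_characteristics hv, fun Xs hX => ?_⟩,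
    fun Φ Ψ ρs vs hs hv => ?_⟩
  · have hpush : ∀ t ∈ Set.Icc (0 : ℝ) 1, MFG.pushCurve μ Xs t = ρs t := fun t ht =>
      hs.1.pushCurve_eq hv hX.ae_integral_eq ht
    exact ⟨hpush, (hs.congr fun t ht => (hpush t ht).symm).solvesLagrMFG hμ.1 hFG hX⟩
  · have hchar : ∀ Xs : MFG.E d → ℝ → MFG.E d, MFG.CXV μ Xs vs →
        (∀ t ∈ Set.Icc (0 : ℝ) 1, MFG.pushCurve μ Xs t = ρs t) ∧
        MFG.SolvesLagrPot μ Φ Ψ Xs ∧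
        MFG.potCostLagr μ Φ Ψ Xs = MFG.potCostEuler Φ Ψ ρs vs := fun Xs hX => by
      have hpush : ∀ t ∈ Set.Icc (0 : ℝ) 1, MFG.pushCurve μ Xs t = ρs t := fun t ht =>
        hs.1.pushCurve_eq hv hX.ae_integral_eq ht
      exact ⟨hpush, (hs.congr fun t ht => (hpush t ht).symm).solvesLagrPot hμ.1 hX,
        (hX.potCostLagr_eq Φ Ψ hs.1.meas).trans (MFG.potCostEuler_congr Φ Ψ hpush)⟩
    obtain ⟨Xs, hXs⟩ := hs.1.exists_characteristics hv
    refine ⟨⟨Xs, hXs⟩, hchar, fun X hX => ⟨hX.1.exists_isFlowMatched, fun v hv' => ?_⟩⟩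
    exact hX.solvesEulerPot hμ.1 hs hXs.1 (hchar Xs hXs).2.2 hv'
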